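/- Let $F$ be a sub-Gaussian distribution on $\mathbb{R}^d$ (every one-dimensional marginal $Y$ satisfies $\mathbb{P}[|Y|>t]\le 2e^{-t^2/K^2}$ for all $t \ge 0$, for some $K>0$) with mean $\mu$ and nonsingular covariance matrix $\Xi$, and let $Z_1,Z_2,\dots$ be i.i.d. with distribution $F$. For each $n$ let $D$ be the $n\times n$ matrix with entries $D_{ij}=\|Z_i-Z_j\|$, and let $\Delta=D+E$, where the random noise matrix $E=E^{(n)}$ is independent of $Z_1,\dots,Z_n$, symmetric and hollow (zero diagonal), its entries $E_{ij}$, $i<j$, are independent (not necessarily identically distributed) and, for $i\ne j$, $$\mathbb{E}[E_{ij}]=0,\quad \mathrm{Var}(E_{ij})=\sigma^2,\quad \mathbb{E}[E_{ij}^3]=\gamma,\quad \mathbb{E}[E_{ij}^4]=\xi,$$ and all $E_{ij}$ are sub-Gaussian with a common constant: $\mathbb{P}[|E_{ij}|>t]\le 2e^{-t^2/K^2}$ for all $t\ge0$. Here $\sigma,\gamma,\xi,K$ do not depend on $i,j,n$. Let $\hat X_n\in\mathbb{R}^{n\times d}$ be a (measurable version of the) classical multidimensional scaling embedding of $\Delta$: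 with $P=I-\frac1n\mathbf{1}\mathbf{1}^\top$ and $\hat B=-\frac12P\Delta^2P$ ($\Delta^2$ the entrywise square), $\hat X_n=U S^{1/2}$, where $S$ is the diagonal matrix of the $d$ largest eigenvalues of $\hat B$ in decreasing order (negative ones replaced by $0$) and the columns of $U$ are corresponding orthonormal eigenvectors (if $n<d$, the columns of $\hat X_n$ beyond the $n$-th are $0$). For $z\in\mathbb{R}^d$ and $Z\sim F$ put $$\Sigma(z)=\Xi^{-1}\widetilde\Sigma(z)\,\Xi^{-1},\qquad \widetilde\Sigma(z)=\mathbb{E}\Bigl[\bigl(\sigma^2\|z-Z\|^2+\gamma\|z-Z\|+\tfrac{\xi}{4}-\tfrac{\sigma^4}{4}\bigr)(Z-\mu)(Z-\mu)^\top\Bigr],$$ let $\Phi(\cdot,\Sigma)$ be the distribution function of the centered Gaussian on $\mathbb{R}^d$ with covariance matrix $\Sigma$, and let $G(\alpha)=\int\Phi(\alpha,\Sigma(z))\,dF(z)$. Then there is a sequence of (random, measurable) orthogonal $d\times d$ matrices $W_n$ such that for every fixed row index $i$ the vectors $\sqrt n\,[(\hat X_nW_n)_i-(Z_i-\bar Z)]$,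 with $\bar Z=\frac1n\sum_{k=1}^nZ_k$, converge in distribution to the Gaussian mixture with distribution function $G$: $$\lim_{n\to\infty}\mathbb{P}\bigl\{\sqrt n\,[(\hat X_nW_n)_i-(Z_i-\bar Z)]\le\alpha\bigr\}=\int\Phi(\alpha,\Sigma(z))\,dF(z)$$ (coordinatewise inequality) at every continuity point $\alpha$ of $G$; and for every $\alpha\in\mathbb{R}^d$ if $\Sigma(z)$ is nonsingular for $F$-almost every $z$. -/

import Mathlib

open MeasureTheory ProbabilityTheory Filter Topology

noncomputable section

/-- The real random variable `Y` satisfies `P[|Y| > t] ≤ 2 exp(-t² / K²)` for all `t ≥ 0`: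
it is sub-Gaussian with constant `K`. -/
def HasSubGaussianTail {Ω : Type*} [MeasurableSpace Ω] (P : Measure Ω) (Y : Ω → ℝ) (K : ℝ) :
    Prop :=
  0 < K ∧ ∀ t : ℝ, 0 ≤ t → P.real {ω | t < |Y ω|} ≤ 2 * Real.exp (-t ^ 2 / K ^ 2)

/-- A distribution `F` on `ℝᵈ` is sub-Gaussian if all its one-dimensional marginals are. -/
def IsSubGaussianLaw {d : ℕ} (F : Measure (EuclideanSpace ℝ (Fin d))) : Prop :=
  ∀ x : EuclideanSpace ℝ (Fin d), ∃ K : ℝ, HasSubGaussianTail F (fun z => inner ℝ z x) K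

/-- The Euclidean distance matrix of the points `x₁, …, xₙ`. -/
def distMatrix {d n : ℕ} (x : Fin n → EuclideanSpace ℝ (Fin d)) : Matrix (Fin n) (Fin n) ℝ :=
  Matrix.of fun i j => ‖x i - x j‖

/-- The double centering matrix `P = I - 11ᵀ/n`. -/
def centeringMatrix (n : ℕ) : Matrix (Fin n) (Fin n) ℝ :=
  1 - (n : ℝ)⁻¹ • Matrix.of fun _ _ => (1 : ℝ)

/-- The doubly centered matrix `-½ P Δ² P`, where `Δ²` is the entrywise square. -/
def doubleCentered {n : ℕ} (Δ : Matrix (Fin n) (Fin n) ℝ) : Matrix (Fin n) (Fin n) ℝ :=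
  (-(1 / 2) : ℝ) • (centeringMatrix n * Δ.map (fun x => x ^ 2) * centeringMatrix n)

/-- `X` is a configuration returned by classical multidimensional scaling of the dissimilarity
matrix `Δ` into `ℝᵈ`: for some spectral decomposition `B = V diag(s) Vᵀ` of the doubly centered
matrix `B`, with `V` orthogonal and eigenvalues `s` in decreasing order, the `k`-th column of `X`
is the `k`-th column of `V` times `√s_k`, for `k = 1, …, d`. Here `√s_k` is `0` if `s_k < 0`, and
the columns beyond the `n`-th are `0` if `n < d`. -/
def IsCMDSEmbedding {d n : ℕ} (Δ : Matrix (Fin n) (Fin n) ℝ) (X : Matrix (Fin n) (Fin d) ℝ) :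
    Prop :=
  ∃ V ∈ Matrix.orthogonalGroup (Fin n) ℝ, ∃ s : Fin n → ℝ, Antitone s ∧
    doubleCentered Δ = V * Matrix.diagonal s * V.transpose ∧
    ∀ (i : Fin n) (k : Fin d),
      X i k = if h : (k : ℕ) < n then V i ⟨k, h⟩ * √(s ⟨k, h⟩) else 0

/-- The covariance matrix `Ξ` of a distribution `F` on `ℝᵈ`. -/
def covMatrix {d : ℕ} (F : Measure (EuclideanSpace ℝ (Fin d))) : Matrix (Fin d) (Fin d) ℝ :=
  Matrix.of fun k l => covariance (fun z => z k) (fun z => z l) F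

/-- `Σ̃(z) = E[(σ²‖z - Z‖² + γ‖z - Z‖ + ξ/4 - σ⁴/4) (Z - μ)(Z - μ)ᵀ]` with `Z ∼ F`, `μ = E[Z]`. -/
def sigmaTilde {d : ℕ} (F : Measure (EuclideanSpace ℝ (Fin d))) (σ γ ξ : ℝ)
    (z : EuclideanSpace ℝ (Fin d)) : Matrix (Fin d) (Fin d) ℝ :=
  Matrix.of fun k l => ∫ w, (σ ^ 2 * ‖z - w‖ ^ 2 + γ * ‖z - w‖ + ξ / 4 - σ ^ 4 / 4) *
    ((w k - ∫ v, v k ∂F) * (w l - ∫ v, v l ∂F)) ∂F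

/-- `Σ(z) = Ξ⁻¹ Σ̃(z) Ξ⁻¹`. -/
def sigmaMatrix {d : ℕ} (F : Measure (EuclideanSpace ℝ (Fin d))) (σ γ ξ : ℝ)
    (z : EuclideanSpace ℝ (Fin d)) : Matrix (Fin d) (Fin d) ℝ :=
  (covMatrix F)⁻¹ * sigmaTilde F σ γ ξ z * (covMatrix F)⁻¹

/-- `Φ(α, S)`: the distribution function at `α` of the centered Gaussian on `ℝᵈ` with covariance
matrix `S`. -/
def gaussianCDF {d : ℕ} (α : EuclideanSpace ℝ (Fin d)) (S : Matrix (Fin d) (Fin d) ℝ) : ℝ :=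
  (multivariateGaussian 0 S).real {x | ∀ k, x k ≤ α k}

/-- The distribution function `α ↦ ∫ Φ(α, Σ(z)) dF(z)` of the Gaussian mixture. -/
def mixtureCDF {d : ℕ} (F : Measure (EuclideanSpace ℝ (Fin d))) (σ γ ξ : ℝ)
    (α : EuclideanSpace ℝ (Fin d)) : ℝ :=
  ∫ z, gaussianCDF α (sigmaMatrix F σ γ ξ z) ∂F

end

/-! ### Deterministic perturbation theory for the rows of a spectral embedding. -/

section MatrixPerturbation

open Matrix
open scoped Matrix.Norms.Frobenius

variable {ι κ : Type*} [Fintype ι] [Fintype κ] [DecidableEq κ]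

/-! Squaring `Δ = D + E` entrywise and centering doubly turns the theorem into a problem of
eigenvector perturbation. The squared distances become the Gram matrix `X Xᵀ` of the centered
points, the off-diagonal mean `σ²` of `E_ij²` becomes `(σ²/2) P`, and what is left is `-P H P`,
where `H` has the centered entries `D_ij E_ij + (E_ij² - σ²)/2` (`doubleCentered_distMatrix_add`).
Given the points, `H` is symmetric and hollow with independent entries above the diagonal, and the
variance of `H_ij` is exactly the scalar weight in `Σ̃`, taken at the distance `‖Z_i - Z_j‖`.

Put `N = (σ²/2) P - P H P`. After alignment by an orthogonal `W`, the embedding is `X + N X (XᵀX)⁻¹`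
up to terms that vanish after multiplication of a row by `√n` (`spectral_embedding_row_expansion`).
A bound on the whole error matrix would be too weak for a single row, so the eigenvector equation is
iterated until `N` appears three times, and the row products `e N`, `e N X` and `e N N X` are
estimated separately. This needs little of the noise: second moments of linear and bilinear forms in
`H` and of linear forms in rows of `H²`, which follow from independence and fourth moments, and an
operator norm of order `o(n)`. The latter comes from the Frobenius norm of `H²`, which is
`O(n^{3/2})` in probability; no sharp random matrix bound is used.

Since `n (XᵀX)⁻¹` tends to `Ξ⁻¹` by the law of large numbers, row `i` of the scaled error is
asymptotically `-n^{-1/2} ∑_j H_ij (Z_j - μ)ᵀ Ξ⁻¹` (`nullInProb_remainder`). Given the points this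
is a sum of independent centered terms, and its characteristic function is close to a Gaussian one
by a third order Taylor estimate. The conditional variance in direction `t` converges to `tᵀ Σ(Z_i)
t`, because `Z_i` is independent of the other points (`tendsto_integral_exp_row`). Averaging over
the points yields the characteristic function of the Gaussian mixture.

Lévy's continuity theorem, Slutsky's lemma and the portmanteau theorem then give convergence on
every orthant whose boundary is null for the mixture (`tendsto_measure_row_error`). Each of the two
alternative conditions on `α` makes that boundary null. The matrix `W` is selected measurably from
the whole configuration and does not depend on the row, so one sequence serves all rows. -/

lemma frobenius_norm_mul_le_of_le {l m n : Type*} [Fintype l] [Fintype m] [Fintype n]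
    {A : Matrix l m ℝ} {B : Matrix m n ℝ} {a b : ℝ} (hA : ‖A‖ ≤ a) (hB : ‖B‖ ≤ b) :
    ‖A * B‖ ≤ a * b :=
  (frobenius_norm_mul A B).trans
    (mul_le_mul hA hB (norm_nonneg _) ((norm_nonneg _).trans hA))

set_option maxHeartbeats 1000000 in
/-- Row-wise first order expansion of a (scaled) spectral embedding of `X Xᵀ + N`. -/
lemma spectral_embedding_row_expansion
    {X Xh : Matrix ι κ ℝ} {N : Matrix ι ι ℝ} {e : Matrix (Fin 1) ι ℝ} {S T G W : Matrix κ κ ℝ}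
    {C η ε : ℝ} (hN : Nᵀ = N) (hST : S * T = 1) (hT : Tᵀ = T) (hS : Xhᵀ * Xh = S)
    (hB : (X * Xᵀ + N) * Xh = Xh * S) (hG : G * (Xᵀ * X) = 1)
    (hC : 1 ≤ C) (hε : 0 ≤ ε) (hεη : ε ≤ η) (hη : C * η ≤ 1 / 2)
    (hX : ‖X‖ ≤ C) (hNop : ∀ M : Matrix ι κ ℝ, ‖N * M‖ ≤ η * ‖M‖)
    (hNX : ‖N * X‖ ≤ C * ε) (hXNX : ‖Xᵀ * N * X‖ ≤ C * ε ^ 2) (heX : ‖e * X‖ ≤ C * ε)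
    (heN : ‖e * N‖ ≤ C * ε) (heNX : ‖e * N * X‖ ≤ C * ε ^ 2)
    (heNNX : ‖e * N * N * X‖ ≤ C * ε ^ 3) (hTn : ‖T‖ ≤ C) (hYn : ‖Xh * T‖ ≤ C) (hGn : ‖G‖ ≤ C)
    (hWn : ‖W‖ ≤ C)
    (hW : ‖Xᵀ * (Xh * T) * W - 1‖
      ≤ ‖(Xᵀ * (Xh * T))ᵀ * (Xᵀ * (Xh * T)) - 1‖ + ε ^ 2) :
    ‖e * (Xh * W - X - N * X * G)‖ ≤ 22 * C ^ 11 * η * ε ^ 2 := by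
  -- Here `Yh` is the basis dual to the columns of `Xh`, and `Q` holds the overlaps of `X` with it.
  -- The natural scale is `ε = n^{-1/2}`: `X` and `Xh` are divided by `√n` and `N` by `n`.
  set Yh := Xh * T with hYh
  set Q := Xᵀ * Yh with hQ
  have hC0 : 0 ≤ C := by linarith
  have hη0 : 0 ≤ η := hε.trans hεη
  have hη1 : η ≤ 1 := by nlinarith
  have hε1 : ε ≤ 1 := hεη.trans hη1
  have pw : ∀ {a b : ℕ}, a ≤ b → C ^ a ≤ C ^ b := fun h => pow_le_pow_right₀ hC h
  -- The eigenvector equation in fixed point form: `X Xᵀ + N` maps `Yh` to `Xh`. Substituting it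
  -- into itself produces every expansion below.
  have e1 : Xh = X * Q + N * Yh := by
    have : (X * Xᵀ + N) * Xh * T = Xh := by rw [hB, Matrix.mul_assoc, hST, Matrix.mul_one]
    rw [hQ, hYh, ← Matrix.mul_assoc X, ← Matrix.add_mul, ← Matrix.mul_assoc, this]
  have e2 : Yh = X * Q * T + N * Yh * T := by
    rw [← Matrix.add_mul, ← e1]
  have hQn : ‖Q‖ ≤ C * C := by
    refine frobenius_norm_mul_le_of_le ?_ hYn
    rwa [frobenius_norm_transpose]
  have hQt : ‖Qᵀ‖ ≤ C * C := by rwa [frobenius_norm_transpose]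
  have e3 : N * Yh = N * X * Q * T + N * (N * Yh) * T := by
    conv_lhs => rw [e2]
    simp only [Matrix.mul_add, Matrix.mul_assoc]
  -- Self-bounding: `N Yh` recurs on the right of `e3` with a factor of at most `C η ≤ 1/2` and is
  -- absorbed, so the size of `N X` decides and not the operator norm of `N`.
  have hNY : ‖N * Yh‖ ≤ 2 * C ^ 4 * ε := by
    have h1 : ‖N * X * Q * T‖ ≤ C * ε * (C * C) * C :=
      frobenius_norm_mul_le_of_le (frobenius_norm_mul_le_of_le hNX hQn) hTn
    have h2 : ‖N * (N * Yh) * T‖ ≤ η * ‖N * Yh‖ * C := frobenius_norm_mul_le_of_le (hNop _) hTn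
    have h3 : ‖N * Yh‖ ≤ C * ε * (C * C) * C + η * ‖N * Yh‖ * C := by
      calc ‖N * Yh‖ = ‖N * X * Q * T + N * (N * Yh) * T‖ := by rw [← e3]
        _ ≤ _ := (norm_add_le _ _).trans (add_le_add h1 h2)
    have h4 : η * ‖N * Yh‖ * C ≤ 1 / 2 * ‖N * Yh‖ := by
      have := mul_le_mul_of_nonneg_right hη (norm_nonneg (N * Yh))
      linarith
    nlinarith
  have hXNY : ‖Xᵀ * (N * Yh)‖ ≤ 3 * C ^ 6 * ε ^ 2 := by
    have e : Xᵀ * (N * Yh) = Xᵀ * N * X * Q * T + (N * X)ᵀ * (N * Yh) * T := by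
      conv_lhs => rw [e3]
      rw [Matrix.transpose_mul, hN]
      simp only [Matrix.mul_add, Matrix.mul_assoc]
    rw [e]
    have h1 : ‖Xᵀ * N * X * Q * T‖ ≤ C * ε ^ 2 * (C * C) * C :=
      frobenius_norm_mul_le_of_le (frobenius_norm_mul_le_of_le hXNX hQn) hTn
    have h2 : ‖(N * X)ᵀ * (N * Yh) * T‖ ≤ C * ε * (2 * C ^ 4 * ε) * C :=
      frobenius_norm_mul_le_of_le
        (frobenius_norm_mul_le_of_le (by rwa [frobenius_norm_transpose]) hNY) hTn
    refine (norm_add_le _ _).trans ((add_le_add h1 h2).trans ?_)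
    have := mul_le_mul_of_nonneg_right (pw (show 4 ≤ 6 by norm_num)) (sq_nonneg ε)
    nlinarith
  -- Duality `Yhᵀ Xh = 1` shows that `Q` is orthogonal up to `Yhᵀ N Yh`. This is of second order
  -- because the compression of `N` to the range of `X` is, which is what makes a rotation `W` with
  -- `Q W ≈ 1` accurate enough.
  have hQQ : ‖Qᵀ * Q - 1‖ ≤ 7 * C ^ 9 * ε ^ 2 := by
    have hYX : Yhᵀ * Xh = 1 := by
      rw [hYh, Matrix.transpose_mul, hT, Matrix.mul_assoc, hS]
      exact mul_eq_one_comm.1 hST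
    have e4 : Qᵀ * Q + Yhᵀ * (N * Yh) = 1 := by
      rw [← hYX]
      conv_rhs => rw [e1]
      rw [hQ, Matrix.transpose_mul, Matrix.transpose_transpose]
      simp only [Matrix.mul_add, Matrix.mul_assoc]
    have e5 : Yhᵀ * (N * Yh) = T * (Qᵀ * (Xᵀ * (N * Yh))) + T * ((N * Yh)ᵀ * (N * Yh)) := by
      conv_lhs =>
        enter [1]
        rw [e2]
      simp only [Matrix.transpose_add, Matrix.transpose_mul, hT, Matrix.add_mul, Matrix.mul_assoc]
    have e6 : Qᵀ * Q - 1 = -(T * (Qᵀ * (Xᵀ * (N * Yh))) + T * ((N * Yh)ᵀ * (N * Yh))) := by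
      rw [← e5, ← e4]; abel
    rw [e6, norm_neg]
    have h1 : ‖T * (Qᵀ * (Xᵀ * (N * Yh)))‖ ≤ C * (C * C * (3 * C ^ 6 * ε ^ 2)) :=
      frobenius_norm_mul_le_of_le hTn (frobenius_norm_mul_le_of_le hQt hXNY)
    have h2 : ‖T * ((N * Yh)ᵀ * (N * Yh))‖ ≤ C * (2 * C ^ 4 * ε * (2 * C ^ 4 * ε)) :=
      frobenius_norm_mul_le_of_le hTn
        (frobenius_norm_mul_le_of_le (by rwa [frobenius_norm_transpose]) hNY)
    refine (norm_add_le _ _).trans ((add_le_add h1 h2).trans (le_of_eq ?_))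
    ring
  have hQW : ‖Q * W - 1‖ ≤ 8 * C ^ 9 * ε ^ 2 := by
    have := mul_le_mul_of_nonneg_right (one_le_pow₀ (n := 9) hC) (sq_nonneg ε)
    linarith
  -- This identifies the coefficient of the first order term: `Q T W` is `G` up to second order,
  -- although `T` holds the perturbed eigenvalues.
  have hQT : Q * T = G * (Q - Xᵀ * (N * Yh) * T) := by
    have : Xᵀ * X * (Q * T) = Q - Xᵀ * (N * Yh) * T := by
      have h : Q = Xᵀ * (X * Q + N * Yh) * T := by rw [← e1, hQ, hYh, Matrix.mul_assoc]
      conv_rhs =>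
        enter [1]
        rw [h]
      simp only [Matrix.mul_add, Matrix.add_mul, Matrix.mul_assoc]
      abel
    rw [← this, ← Matrix.mul_assoc, hG, Matrix.one_mul]
  have key : e * (Xh * W - X - N * X * G) = e * X * (Q * W - 1)
      + e * N * X * (G * (Q * W - 1 - Xᵀ * (N * Yh) * T * W))
      + e * N * N * X * (Q * T * T * W) + e * N * (N * (N * Yh)) * (T * T * W) := by
    have a1 : Xh * W = X * Q * W + N * X * Q * T * W + N * N * X * Q * T * T * W
        + N * (N * (N * Yh)) * T * T * W := by
      have b1 : N * (N * Yh) = N * N * X * Q * T + N * (N * (N * Yh)) * T := by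
        conv_lhs => rw [e3]
        simp only [Matrix.mul_add, Matrix.mul_assoc]
      have b2 : N * Yh = N * X * Q * T + N * N * X * Q * T * T + N * (N * (N * Yh)) * T * T := by
        conv_lhs => rw [e3, b1]
        simp only [Matrix.add_mul, add_assoc]
      conv_lhs => rw [e1, b2]
      simp only [Matrix.add_mul, add_assoc]
    have a2 : G * (Q * W - 1 - Xᵀ * (N * Yh) * T * W) = Q * T * W - G := by
      rw [hQT]
      simp only [Matrix.mul_sub, Matrix.sub_mul, Matrix.mul_assoc, Matrix.mul_one]
      abel
    rw [a1, a2]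
    simp only [Matrix.mul_sub, Matrix.mul_add, Matrix.mul_assoc, Matrix.mul_one]
    abel
  rw [key]
  have t1 : ‖e * X * (Q * W - 1)‖ ≤ C * ε * (8 * C ^ 9 * ε ^ 2) :=
    frobenius_norm_mul_le_of_le heX hQW
  have t2 : ‖e * N * X * (G * (Q * W - 1 - Xᵀ * (N * Yh) * T * W))‖
      ≤ C * ε ^ 2 * (C * (8 * C ^ 9 * ε ^ 2 + 3 * C ^ 6 * ε ^ 2 * C * C)) := by
    refine frobenius_norm_mul_le_of_le heNX (frobenius_norm_mul_le_of_le hGn ?_)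
    exact (norm_sub_le _ _).trans (add_le_add hQW
      (frobenius_norm_mul_le_of_le (frobenius_norm_mul_le_of_le hXNY hTn) hWn))
  have t3 : ‖e * N * N * X * (Q * T * T * W)‖ ≤ C * ε ^ 3 * (C * C * C * C * C) :=
    frobenius_norm_mul_le_of_le heNNX (frobenius_norm_mul_le_of_le
      (frobenius_norm_mul_le_of_le (frobenius_norm_mul_le_of_le hQn hTn) hTn) hWn)
  -- The only term of the expansion in which the operator norm bound is spent; it fixes the final
  -- order `η ε²`, the others being `O(ε³)` with `ε ≤ η`.
  have t4 : ‖e * N * (N * (N * Yh)) * (T * T * W)‖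
      ≤ C * ε * (η * (2 * C ^ 4 * ε)) * (C * C * C) :=
    frobenius_norm_mul_le_of_le (frobenius_norm_mul_le_of_le heN
      ((hNop _).trans (mul_le_mul_of_nonneg_left hNY hη0)))
      (frobenius_norm_mul_le_of_le (frobenius_norm_mul_le_of_le hTn hTn) hWn)
  have hsum := (norm_add_le _ _).trans (add_le_add ((norm_add_le _ _).trans
    (add_le_add ((norm_add_le _ _).trans (add_le_add t1 t2)) t3)) t4)
  refine hsum.trans ?_
  have hK : 0 ≤ C ^ 11 := by positivity
  have hηε : 0 ≤ η * ε ^ 2 := by positivity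
  have hε3 : ε ^ 3 ≤ η * ε ^ 2 := by nlinarith [mul_le_mul_of_nonneg_right hεη (sq_nonneg ε)]
  have hε4 : ε ^ 4 ≤ η * ε ^ 2 := by
    have : ε ^ 4 ≤ ε ^ 3 := pow_le_pow_of_le_one hε hε1 (by norm_num)
    linarith
  have bd : ∀ {a k : ℕ} {x : ℝ}, k ≤ 11 → 0 ≤ x → x ≤ η * ε ^ 2 →
      a * C ^ k * x ≤ a * (C ^ 11 * (η * ε ^ 2)) := by
    intro a k x hk hx0 hx
    rw [mul_assoc]
    exact mul_le_mul_of_nonneg_left (mul_le_mul (pw hk) hx hx0 hK) (Nat.cast_nonneg a)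
  -- The constant `22` is `8 + 8 + 3 + 1 + 2`, one summand for each of the five contributions.
  have c1 := bd (a := 8) (k := 10) (by norm_num) (by positivity) hε3
  have c2 := bd (a := 8) (k := 11) (by norm_num) (by positivity) hε4
  have c2' := bd (a := 3) (k := 10) (by norm_num) (by positivity) hε4
  have c3 := bd (a := 1) (k := 6) (by norm_num) (by positivity) hε3
  have c4 := bd (a := 2) (k := 8) (by norm_num) hηε le_rfl
  push_cast at c1 c2 c2' c3 c4
  nlinarith

end MatrixPerturbation

/-! ### Polar alignment, eigenvalue lower bounds, and the expansion in original scale. -/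

section PolarAndEigen

open Matrix
open scoped Matrix.Norms.Frobenius

lemma frobenius_norm_sq {m n : Type*} [Fintype m] [Fintype n] (A : Matrix m n ℝ) :
    ‖A‖ ^ 2 = ∑ i, ∑ j, A i j ^ 2 := by
  rw [frobenius_norm_def, ← Real.sqrt_eq_rpow, Real.sq_sqrt (by positivity)]
  simp

lemma frobenius_norm_sq_eq_trace {m n : Type*} [Fintype m] [Fintype n] (A : Matrix m n ℝ) :
    ‖A‖ ^ 2 = (Aᵀ * A).trace := by
  rw [frobenius_norm_sq, Finset.sum_comm]
  simp [Matrix.trace, Matrix.mul_apply, sq]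

lemma abs_apply_le_frobenius_norm {m n : Type*} [Fintype m] [Fintype n] (A : Matrix m n ℝ)
    (i : m) (j : n) : |A i j| ≤ ‖A‖ := by
  refine abs_le_of_sq_le_sq ?_ (norm_nonneg _)
  rw [frobenius_norm_sq]
  exact (Finset.single_le_sum (f := fun j => A i j ^ 2) (fun _ _ => sq_nonneg _)
    (Finset.mem_univ j)).trans (Finset.single_le_sum (f := fun i => ∑ j, A i j ^ 2)
      (fun _ _ => by positivity) (Finset.mem_univ i))

/-- Both squared norms expand into traces of powers of `Q Qᵀ` and `Qᵀ Q`, which agree by cyclicity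
of the trace. -/
lemma frobenius_norm_mul_transpose_sub_one {κ : Type*} [Fintype κ] [DecidableEq κ]
    (Q : Matrix κ κ ℝ) : ‖Q * Qᵀ - 1‖ = ‖Qᵀ * Q - 1‖ := by
  have h : ∀ A : Matrix κ κ ℝ, ‖A * Aᵀ - 1‖ ^ 2
      = (A * Aᵀ * (A * Aᵀ)).trace - 2 * (A * Aᵀ).trace + (1 : Matrix κ κ ℝ).trace := by
    intro A
    rw [frobenius_norm_sq_eq_trace]
    simp only [transpose_sub, transpose_mul, transpose_transpose, transpose_one, mul_sub, sub_mul,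
      Matrix.mul_one, Matrix.one_mul, trace_sub]
    ring
  have h1 := h Q
  have h2 := h Qᵀ
  rw [transpose_transpose] at h2
  refine (sq_eq_sq₀ (norm_nonneg _) (norm_nonneg _)).1 ?_
  rw [h1, h2, trace_mul_comm Q Qᵀ]
  congr 2
  rw [Matrix.mul_assoc, trace_mul_comm]
  simp only [Matrix.mul_assoc]

/-- An invertible matrix is carried by some orthogonal matrix as close to `1` as
its Gram matrix is. -/
lemma exists_orthogonal_norm_mul_sub_one_le {κ : Type*} [Fintype κ] [DecidableEq κ]
    (Q : Matrix κ κ ℝ) (hQ : IsUnit Q.det) :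
    ∃ W ∈ orthogonalGroup κ ℝ, ‖Q * W - 1‖ ≤ ‖Qᵀ * Q - 1‖ := by
  have hpsd : (Q * Qᵀ).PosSemidef := by
    simpa [conjTranspose_eq_transpose_of_trivial] using posSemidef_self_mul_conjTranspose Q
  obtain ⟨A, hA, hAA⟩ : ∃ A : Matrix κ κ ℝ, A.PosSemidef ∧ A * A = Q * Qᵀ := by
    open scoped MatrixOrder in
    exact ⟨CFC.sqrt (Q * Qᵀ), nonneg_iff_posSemidef.1 (CFC.sqrt_nonneg _),
      CFC.sqrt_mul_sqrt_self _ hpsd.nonneg⟩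
  have hAt : Aᵀ = A := by simpa [conjTranspose_eq_transpose_of_trivial] using hA.isHermitian.eq
  have hQt : IsUnit Qᵀ.det := by rwa [det_transpose]
  -- Polar decomposition: with `A = (Q Qᵀ)^{1/2}` this choice gives `Q W = A`.
  refine ⟨Q⁻¹ * A, ?_, ?_⟩
  · rw [mem_orthogonalGroup_iff]
    change Q⁻¹ * A * (Q⁻¹ * A)ᵀ = 1
    rw [transpose_mul, hAt, Matrix.mul_assoc, ← Matrix.mul_assoc A, hAA, ← Matrix.mul_assoc,
      ← Matrix.mul_assoc, nonsing_inv_mul _ hQ, Matrix.one_mul, transpose_nonsing_inv,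
      mul_nonsing_inv _ hQt]
  · rw [← Matrix.mul_assoc, mul_nonsing_inv _ hQ, Matrix.one_mul,
      ← frobenius_norm_mul_transpose_sub_one, ← hAA]
    set M := A - 1 with hM
    have e : A * A - 1 = A * M + M := by rw [hM, Matrix.mul_sub, Matrix.mul_one]; abel
    have hMt : Mᵀ = M := by rw [hM, transpose_sub, hAt, transpose_one]
    refine (sq_le_sq₀ (norm_nonneg _) (norm_nonneg _)).1 ?_
    -- Since `A² - 1 = A M + M` with `M = A - 1`, positivity of `A` makes the cross term
    -- nonnegative, so `‖M‖ ≤ ‖A² - 1‖`.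
    have h1 : 0 ≤ (Mᵀ * A * M).trace := by
      simpa [conjTranspose_eq_transpose_of_trivial]
        using (hA.conjTranspose_mul_mul_same M).trace_nonneg
    have h2 : ‖A * M + M‖ ^ 2 = ‖A * M‖ ^ 2 + 2 * (Mᵀ * A * M).trace + ‖M‖ ^ 2 := by
      simp only [frobenius_norm_sq_eq_trace, transpose_add, transpose_mul, hAt, add_mul, mul_add,
        trace_add, Matrix.mul_assoc]
      ring
    rw [e, h2]
    nlinarith [sq_nonneg ‖A * M‖]

lemma frobenius_norm_replicateCol_sq {n : Type*} [Fintype n] (v : n → ℝ) :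
    ‖replicateCol (Fin 1) v‖ ^ 2 = v ⬝ᵥ v := by
  rw [frobenius_norm_sq]
  simp [dotProduct, sq]

lemma abs_dotProduct_le {n : Type*} [Fintype n] (a b : n → ℝ) :
    |a ⬝ᵥ b| ≤ ‖replicateCol (Fin 1) a‖ * ‖replicateCol (Fin 1) b‖ := by
  have h := abs_apply_le_frobenius_norm ((replicateCol (Fin 1) a)ᵀ * replicateCol (Fin 1) b) 0 0
  have h2 := frobenius_norm_mul (replicateCol (Fin 1) a)ᵀ (replicateCol (Fin 1) b)
  rw [frobenius_norm_transpose] at h2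
  refine le_trans (le_of_eq ?_) (h.trans h2)
  simp [Matrix.mul_apply, dotProduct]

lemma abs_dotProduct_mulVec_le {n : Type*} [Fintype n] (A : Matrix n n ℝ) {c : ℝ} (a : n → ℝ)
    (hA : ‖A * replicateCol (Fin 1) a‖ ≤ c * ‖replicateCol (Fin 1) a‖) :
    |a ⬝ᵥ A *ᵥ a| ≤ c * (a ⬝ᵥ a) := by
  refine (abs_dotProduct_le _ _).trans ?_
  rw [replicateCol_mulVec, ← frobenius_norm_replicateCol_sq]
  nlinarith [norm_nonneg (replicateCol (Fin 1) a)]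

/-- Fewer than `d` linear conditions on `d` unknowns have a nonzero solution; padding them to a
square matrix leaves row `k` zero, so the determinant vanishes. It supplies the test vector of the
min-max argument below. -/
lemma exists_ne_zero_forall_lt_eq_zero {n d : ℕ} (A : Matrix (Fin n) (Fin d) ℝ) (k : Fin d) :
    ∃ v : Fin d → ℝ, v ≠ 0 ∧ ∀ l : Fin n, (l : ℕ) < k → (A *ᵥ v) l = 0 := by
  let M : Matrix (Fin d) (Fin d) ℝ := Matrix.of fun i j =>
    if h : (i : ℕ) < n ∧ (i : ℕ) < k then A ⟨i, h.1⟩ j else 0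
  have hM : M.det = 0 := det_eq_zero_of_row_eq_zero k fun j => by simp [M]
  obtain ⟨v, hv, hMv⟩ := exists_mulVec_eq_zero_iff.2 hM
  refine ⟨v, hv, fun l hl => ?_⟩
  have := congrFun hMv ⟨l, hl.trans k.2⟩
  have hl' : (⟨l, hl.trans k.2⟩ : Fin d) < k := hl
  simpa [M, mulVec, dotProduct, hl'] using this

/-- The `d` leading eigenvalues of a small perturbation of `X Xᵀ` are bounded below. -/
lemma le_eigenvalue_of_perturbation {n d : ℕ} {X : Matrix (Fin n) (Fin d) ℝ}
    {N V : Matrix (Fin n) (Fin n) ℝ} {G : Matrix (Fin d) (Fin d) ℝ} {s : Fin n → ℝ} {g δ : ℝ}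
    (hg : 0 < g) (hG : G * (Xᵀ * X) = 1) (hGn : ‖G‖ ≤ g)
    (hN : ∀ y : Matrix (Fin n) (Fin 1) ℝ, ‖N * y‖ ≤ δ * ‖y‖)
    (hV : V ∈ orthogonalGroup (Fin n) ℝ) (hs : Antitone s)
    (hB : X * Xᵀ + N = V * diagonal s * Vᵀ) (k : Fin d) (hk : (k : ℕ) < n) :
    g⁻¹ - δ ≤ s ⟨k, hk⟩ := by
  -- Courant–Fischer: the test vector `y = X v` lies in the range of `X` and is orthogonal to the
  -- eigenvectors preceding the `k`-th. Its quadratic form is at most `s_k |y|²`, and at least `(g⁻¹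
  -- - δ) |y|²`, because `|y|² = wᵀ G w ≤ g |w|²` for `w = Xᵀ y`.
  obtain ⟨v, hv, hVv⟩ := exists_ne_zero_forall_lt_eq_zero (Vᵀ * X) k
  set y := X *ᵥ v with hy
  set u := Vᵀ *ᵥ y with hu
  set w := Xᵀ *ᵥ y with hw
  have hVV : V * Vᵀ = 1 := (mem_orthogonalGroup_iff _ _).1 hV
  have hGw : G *ᵥ w = v := by
    rw [hw, hy, mulVec_mulVec, mulVec_mulVec, Matrix.mul_assoc, hG, one_mulVec]
  have hyw : y ⬝ᵥ y = w ⬝ᵥ G *ᵥ w := by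
    rw [hGw, dotProduct_comm w v, hw, dotProduct_transpose_mulVec]
  have h1 : y ⬝ᵥ y ≤ g * (w ⬝ᵥ w) := by
    rw [hyw]
    refine (le_abs_self _).trans (abs_dotProduct_mulVec_le G w ?_)
    exact frobenius_norm_mul_le_of_le hGn le_rfl
  have hy0 : 0 < y ⬝ᵥ y := by
    refine lt_of_le_of_ne (Finset.sum_nonneg fun _ _ => mul_self_nonneg _) fun h => hv ?_
    have hy' : y = 0 := dotProduct_self_eq_zero.1 h.symm
    rw [← hGw, hw, hy', mulVec_zero, mulVec_zero]
  have h2 : y ⬝ᵥ (X * Xᵀ + N) *ᵥ y = w ⬝ᵥ w + y ⬝ᵥ N *ᵥ y := by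
    rw [add_mulVec, dotProduct_add, ← mulVec_mulVec, ← hw, ← dotProduct_transpose_mulVec, ← hw]
  have h3 : y ⬝ᵥ (X * Xᵀ + N) *ᵥ y = ∑ l, s l * u l ^ 2 := by
    rw [hB, ← mulVec_mulVec, ← hu, ← mulVec_mulVec, ← dotProduct_transpose_mulVec, ← hu]
    simp only [dotProduct, mulVec_diagonal]
    exact Finset.sum_congr rfl fun l _ => by ring
  have h4 : ∑ l, s l * u l ^ 2 ≤ s ⟨k, hk⟩ * (y ⬝ᵥ y) := by
    have huu : y ⬝ᵥ y = ∑ l, u l ^ 2 := by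
      have : y ⬝ᵥ V *ᵥ u = u ⬝ᵥ u := by rw [← dotProduct_transpose_mulVec, ← hu]
      rw [hu, mulVec_mulVec, hVV, one_mulVec, ← hu] at this
      rw [this]
      simp [dotProduct, sq]
    rw [huu, Finset.mul_sum]
    refine Finset.sum_le_sum fun l _ => ?_
    rcases lt_or_ge (l : ℕ) k with hl | hl
    · have : u l = 0 := by rw [hu, hy, mulVec_mulVec]; exact hVv l hl
      simp [this]
    · exact mul_le_mul_of_nonneg_right (hs (show (⟨k, hk⟩ : Fin n) ≤ l from hl)) (sq_nonneg _)
  have h5 := (abs_le.1 (abs_dotProduct_mulVec_le N y (hN _))).1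
  have h6 : g⁻¹ * (y ⬝ᵥ y) ≤ w ⬝ᵥ w := by
    rw [inv_mul_le_iff₀ hg]; exact h1
  refine le_of_mul_le_mul_right ?_ hy0
  linarith [sub_mul g⁻¹ δ (y ⬝ᵥ y)]

lemma frobenius_norm_orthogonal {κ : Type*} [Fintype κ] [DecidableEq κ] {W : Matrix κ κ ℝ}
    (hW : W ∈ orthogonalGroup κ ℝ) : ‖W‖ = √(Fintype.card κ) := by
  rw [← Real.sqrt_sq (norm_nonneg W), frobenius_norm_sq_eq_trace,
    (mem_orthogonalGroup_iff' _ _).1 hW, trace_one]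

/-- Only finitely many shifts `Q + t` are singular, so a small invertible shift reduces to the polar
decomposition; the slack `δ` pays for the shift. No invertibility of `Q` is assumed, so the
alignment can be chosen at every sample point. -/
lemma exists_orthogonal_norm_mul_sub_one_lt {κ : Type*} [Fintype κ] [DecidableEq κ]
    (Q : Matrix κ κ ℝ) {δ : ℝ} (hδ : 0 < δ) :
    ∃ W ∈ orthogonalGroup κ ℝ, ‖Q * W - 1‖ < ‖Qᵀ * Q - 1‖ + δ := by
  have hroots : ∀ᶠ t in 𝓝[≠] (0 : ℝ), IsUnit (Q + t • (1 : Matrix κ κ ℝ)).det := by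
    have h : ∀ᶠ t in 𝓝[≠] (0 : ℝ), t ∉ ((-Q).charpoly.roots.toFinset : Set ℝ) :=
      nhdsNE_le_cofinite 0 (Finset.finite_toSet _).compl_mem_cofinite
    filter_upwards [h] with t ht
    rw [isUnit_iff_ne_zero]
    intro h0
    refine ht ?_
    rw [Finset.mem_coe, Multiset.mem_toFinset, Polynomial.mem_roots (charpoly_monic _).ne_zero,
      Polynomial.IsRoot, eval_charpoly, ← h0, smul_one_eq_diagonal, sub_neg_eq_add, add_comm]
    rfl
  have hcont : Continuous fun t : ℝ => ‖(Q + t • (1 : Matrix κ κ ℝ))ᵀ * (Q + t • 1) - 1‖ +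
      ‖t • (1 : Matrix κ κ ℝ)‖ * √(Fintype.card κ) := by
    have h1 : Continuous fun t : ℝ => Q + t • (1 : Matrix κ κ ℝ) := by fun_prop
    exact (((h1.matrix_transpose.matrix_mul h1).sub continuous_const).norm).add (by fun_prop)
  have hev := (hcont.tendsto 0).eventually_lt_const (u := ‖Qᵀ * Q - 1‖ + δ) (by simpa using hδ)
  obtain ⟨t, ht, htu⟩ := ((hev.filter_mono nhdsWithin_le_nhds).and hroots).exists
  obtain ⟨W, hW, hWle⟩ := exists_orthogonal_norm_mul_sub_one_le _ htu
  refine ⟨W, hW, lt_of_le_of_lt ?_ ht⟩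
  have e : Q * W - 1 = ((Q + t • 1) * W - 1) - (t • 1) * W := by
    rw [Matrix.add_mul]; abel
  rw [e]
  refine (norm_sub_le _ _).trans (add_le_add hWle ?_)
  exact frobenius_norm_mul_le_of_le le_rfl (frobenius_norm_orthogonal hW).le

/-- The rows of a classical scaling embedding, to first order in the perturbation `N`. -/
lemma cmds_row_expansion {n d : ℕ} (hn : 0 < n) (hdn : d ≤ n) {Δ N : Matrix (Fin n) (Fin n) ℝ}
    {X Xh : Matrix (Fin n) (Fin d) ℝ} {G W : Matrix (Fin d) (Fin d) ℝ}
    {e : Matrix (Fin 1) (Fin n) ℝ} {C η : ℝ} (hXh : IsCMDSEmbedding Δ Xh)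
    (hB : doubleCentered Δ = X * Xᵀ + N) (hN : Nᵀ = N) (hG : G * (Xᵀ * X) = 1) (hC : 1 ≤ C)
    (hη : 4 * C * (d + 1) * η ≤ 1 / 2) (hηn : 1 ≤ η * √n) (hX : ‖X‖ ≤ C * √n)
    (hNop : ∀ (m : ℕ) (M : Matrix (Fin n) (Fin m) ℝ), ‖N * M‖ ≤ η * n * ‖M‖)
    (hNX : ‖N * X‖ ≤ C * n) (hXNX : ‖Xᵀ * N * X‖ ≤ C * n) (heX : ‖e * X‖ ≤ C)
    (heN : ‖e * N‖ ≤ C * √n) (heNX : ‖e * N * X‖ ≤ C * √n)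
    (heNNX : ‖e * N * N * X‖ ≤ C * n) (hGn : ‖G‖ ≤ C / n) (hWn : ‖W‖ ≤ C)
    (hW : ‖Xᵀ * Xh * (Xhᵀ * Xh)⁻¹ * W - 1‖
      ≤ ‖(Xᵀ * Xh * (Xhᵀ * Xh)⁻¹)ᵀ * (Xᵀ * Xh * (Xhᵀ * Xh)⁻¹) - 1‖ + (n : ℝ)⁻¹) :
    √n * ‖e * (Xh * W - X - N * X * G)‖ ≤ 22 * (4 * C * (d + 1)) ^ 11 * η := by
  obtain ⟨V, hV, s, hs, hVs, hXV⟩ := hXh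
  have hn0 : (0 : ℝ) < n := by exact_mod_cast hn
  have hr0 : 0 < √(n : ℝ) := Real.sqrt_pos.2 hn0
  have hrr : √(n : ℝ) * √n = n := Real.mul_self_sqrt hn0.le
  have hη0 : 0 ≤ η := by
    by_contra h
    nlinarith
  have hD : (1 : ℝ) ≤ d + 1 := by linarith [Nat.cast_nonneg (α := ℝ) d]
  have hCη : C * η ≤ 1 / 2 := by nlinarith [mul_nonneg (by linarith : 0 ≤ C) hη0]
  set s' : Fin d → ℝ := fun k => s (k.castLE hdn) with hs'
  -- The Gram matrix contributes at least `n / C` and the perturbation removes at most `η n ≤ n / (2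
  -- C)`. Hence the top `d` eigenvalues are positive, no square root is truncated, and `Xhᵀ Xh` is
  -- invertible.
  have hs'le : ∀ k, n / (2 * C) ≤ s' k := by
    intro k
    have h := le_eigenvalue_of_perturbation (δ := η * n) (by positivity) hG hGn (hNop 1) hV hs
      (hB ▸ hVs) k (k.2.trans_le hdn)
    refine le_trans ?_ h
    rw [inv_div, div_sub' (by positivity), div_le_div_iff₀ (by positivity) (by positivity)]
    nlinarith [mul_nonneg (mul_nonneg hn0.le (by linarith : 0 ≤ C))
      (by linarith : 0 ≤ 1 - 2 * (C * η))]
  have hs'pos : ∀ k, 0 < s' k := fun k => lt_of_lt_of_le (by positivity) (hs'le k)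
  have hXh : ∀ i k, Xh i k = V i (k.castLE hdn) * √(s' k) := by
    intro i k
    rw [hXV, dif_pos (k.2.trans_le hdn)]
    rfl
  have hVV : Vᵀ * V = 1 := (mem_orthogonalGroup_iff' _ _).1 hV
  -- `J` picks the first `d` columns of `V`, so that `Xh` is the matrix product `V J √s'`.
  set J : Matrix (Fin n) (Fin d) ℝ := Matrix.of fun i k => if i = k.castLE hdn then 1 else 0
    with hJ
  have hJJ : Jᵀ * J = 1 := by
    ext k l
    simp [hJ, Matrix.mul_apply, Matrix.one_apply, (Fin.castLE_injective hdn).eq_iff, eq_comm]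
  have hXhV : Xh = V * J * diagonal (fun k => √(s' k)) := by
    ext i k
    rw [mul_diagonal, hXh]
    simp [hJ, Matrix.mul_apply]
  have hsJ : diagonal s * J = J * diagonal s' := by
    ext i k
    rw [mul_diagonal, diagonal_mul]
    by_cases h : i = k.castLE hdn
    · simp [hJ, h, hs']
    · simp [hJ, h]
  have hS : Xhᵀ * Xh = diagonal s' := by
    rw [hXhV, transpose_mul, transpose_mul, diagonal_transpose, Matrix.mul_assoc, Matrix.mul_assoc,
      ← Matrix.mul_assoc Vᵀ, ← Matrix.mul_assoc Vᵀ, hVV, Matrix.one_mul, ← Matrix.mul_assoc Jᵀ,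
      hJJ, Matrix.one_mul, diagonal_mul_diagonal]
    congr 1
    ext k
    exact Real.mul_self_sqrt (hs'pos k).le
  have hBX : (X * Xᵀ + N) * Xh = Xh * diagonal s' := by
    rw [← hB, hVs, hXhV]
    simp only [Matrix.mul_assoc]
    rw [← Matrix.mul_assoc Vᵀ, hVV, Matrix.one_mul, ← Matrix.mul_assoc (diagonal s), hsJ,
      Matrix.mul_assoc, diagonal_mul_diagonal, diagonal_mul_diagonal]
    simp only [mul_comm]
  set a : ℝ := (√n)⁻¹ with ha
  have haa : a * a = (n : ℝ)⁻¹ := by rw [ha, ← mul_inv, hrr]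
  have hd : diagonal s' * diagonal (fun k => (s' k)⁻¹) = 1 := by
    rw [diagonal_mul_diagonal, ← diagonal_one]
    congr 1
    ext k
    exact mul_inv_cancel₀ (hs'pos k).ne'
  have hinv : (Xhᵀ * Xh)⁻¹ = diagonal (fun k => (s' k)⁻¹) := by
    rw [hS]; exact inv_eq_right_inv hd
  set T : Matrix (Fin d) (Fin d) ℝ := (n : ℝ) • diagonal (fun k => (s' k)⁻¹) with hT
  have hQ : (a • X)ᵀ * (a • Xh * T) = Xᵀ * Xh * (Xhᵀ * Xh)⁻¹ := by
    rw [hinv, hT]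
    simp only [transpose_smul, Matrix.smul_mul, Matrix.mul_smul, smul_smul, Matrix.mul_assoc, haa]
    rw [mul_assoc, haa, mul_inv_cancel₀ hn0.ne', one_smul]
  have hT' : ∀ k, (n : ℝ) * (s' k)⁻¹ ≤ 2 * C := by
    intro k
    rw [← div_eq_mul_inv, div_le_iff₀ (hs'pos k)]
    have := hs'le k
    rw [div_le_iff₀ (by positivity)] at this
    linarith
  have hT0 : ∀ k, 0 ≤ (n : ℝ) * (s' k)⁻¹ := fun k =>
    mul_nonneg hn0.le (inv_nonneg.2 (hs'pos k).le)
  have hTd : T = diagonal fun k => (n : ℝ) * (s' k)⁻¹ := by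
    rw [hT, ← diagonal_smul]; rfl
  have hTn : ‖T‖ ≤ 4 * C * (d + 1) := by
    refine abs_le_of_sq_le_sq' ?_ (by positivity) |>.2
    rw [frobenius_norm_sq_eq_trace, hTd, diagonal_transpose, diagonal_mul_diagonal, trace_diagonal]
    calc ∑ k, (n : ℝ) * (s' k)⁻¹ * ((n : ℝ) * (s' k)⁻¹) ≤ ∑ _k : Fin d, 2 * C * (2 * C) :=
          Finset.sum_le_sum fun k _ => mul_le_mul (hT' k) (hT' k) (hT0 k) (by positivity)
      _ = d * (4 * C ^ 2) := by
          simp only [Finset.sum_const, Finset.card_univ, Fintype.card_fin, nsmul_eq_mul]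
          ring
      _ ≤ (4 * C * (d + 1)) ^ 2 := by nlinarith [sq_nonneg C, mul_nonneg (sq_nonneg C) (Nat.cast_nonneg (α := ℝ) d)]
  have hYn : ‖a • Xh * T‖ ≤ 4 * C * (d + 1) := by
    refine abs_le_of_sq_le_sq' ?_ (by positivity) |>.2
    have : (a • Xh * T)ᵀ * (a • Xh * T) = T := by
      rw [transpose_mul, hTd, diagonal_transpose, transpose_smul]
      simp only [Matrix.smul_mul, Matrix.mul_smul, smul_smul, haa, Matrix.mul_assoc]
      rw [← Matrix.mul_assoc Xhᵀ, hS, diagonal_mul_diagonal, diagonal_mul_diagonal,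
        ← diagonal_smul]
      congr 1
      ext k
      have := (hs'pos k).ne'
      simp only [Pi.smul_apply, smul_eq_mul]
      field_simp
    rw [frobenius_norm_sq_eq_trace, this, hTd, trace_diagonal]
    calc ∑ k, (n : ℝ) * (s' k)⁻¹ ≤ ∑ _k : Fin d, 2 * C := Finset.sum_le_sum fun k _ => hT' k
      _ = d * (2 * C) := by simp
      _ ≤ (4 * C * (d + 1)) ^ 2 := by nlinarith [sq_nonneg C, mul_nonneg (sq_nonneg C) (Nat.cast_nonneg (α := ℝ) d), mul_nonneg (by linarith : 0 ≤ C) (Nat.cast_nonneg (α := ℝ) d)]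
  have hCK : C ≤ 4 * C * (d + 1) := by nlinarith
  have ha0 : 0 < a := inv_pos.2 hr0
  have har : a * √n = 1 := inv_mul_cancel₀ hr0.ne'
  have hn' : (n : ℝ)⁻¹ * n = 1 := inv_mul_cancel₀ hn0.ne'
  have bd : ∀ {x c y z : ℝ}, 0 ≤ c → 0 ≤ z → x ≤ C * y → c * y = z → c * x ≤ 4 * C * (d + 1) * z := by
    intro x c y z hc hz hx h
    calc c * x ≤ c * (C * y) := mul_le_mul_of_nonneg_left hx hc
      _ = C * z := by rw [← h]; ring
      _ ≤ _ := mul_le_mul_of_nonneg_right hCK hz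
  have hr1 : a * a * √n = a := by rw [mul_assoc, har, mul_one]
  have hn1 : a * a * n = 1 := by rw [haa, hn']
  -- Rescaling with `a = n^{-1/2}` in the role of `ε`. The factor `4 (d + 1)` in the constant
  -- absorbs the Frobenius norms of the `d × d` matrix `T` and of `a Xh T`.
  have main := spectral_embedding_row_expansion (X := a • X) (Xh := a • Xh) (N := (a * a) • N)
    (e := e) (S := (a * a) • diagonal s') (T := T) (G := (n : ℝ) • G) (W := W)
    (C := 4 * C * (d + 1)) (η := η) (ε := a)
    (by rw [transpose_smul, hN])
    (by rw [hT, Matrix.smul_mul, Matrix.mul_smul, smul_smul, hd, hn1, one_smul])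
    (by rw [hTd, diagonal_transpose])
    (by rw [transpose_smul, Matrix.smul_mul, Matrix.mul_smul, smul_smul, hS])
    (by
      simp only [transpose_smul, Matrix.smul_mul, Matrix.mul_smul, smul_smul]
      rw [← smul_add, Matrix.smul_mul, hBX, smul_smul, mul_comm])
    (by
      simp only [transpose_smul, Matrix.smul_mul, Matrix.mul_smul, smul_smul]
      rw [hG, hn1, one_smul])
    (hC.trans hCK) ha0.le (by rw [ha, inv_le_iff_one_le_mul₀ hr0]; exact hηn) hη
    (by
      rw [norm_smul, Real.norm_of_nonneg ha0.le]
      simpa using bd ha0.le zero_le_one hX har)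
    (by
      intro M
      rw [Matrix.smul_mul, norm_smul, Real.norm_of_nonneg (by positivity)]
      calc a * a * ‖N * M‖ ≤ a * a * (η * n * ‖M‖) :=
            mul_le_mul_of_nonneg_left (hNop d M) (by positivity)
        _ = η * ‖M‖ * (a * a * n) := by ring
        _ = η * ‖M‖ := by rw [hn1, mul_one])
    (by
      rw [Matrix.smul_mul, Matrix.mul_smul, smul_smul, norm_smul,
        Real.norm_of_nonneg (by positivity)]
      exact bd (by positivity) ha0.le hNX (by linear_combination a * hn1))
    (by
      simp only [transpose_smul, Matrix.smul_mul, Matrix.mul_smul, smul_smul]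
      rw [norm_smul, Real.norm_of_nonneg (by positivity)]
      exact bd (by positivity) (by positivity) hXNX (by linear_combination a ^ 2 * hn1))
    (by
      rw [Matrix.mul_smul, norm_smul, Real.norm_of_nonneg (by positivity)]
      exact bd ha0.le ha0.le ((mul_one C).symm ▸ heX) (mul_one a))
    (by
      rw [Matrix.mul_smul, norm_smul, Real.norm_of_nonneg (by positivity)]
      exact bd (by positivity) ha0.le heN hr1)
    (by
      simp only [Matrix.smul_mul, Matrix.mul_smul, smul_smul]
      rw [norm_smul, Real.norm_of_nonneg (by positivity)]
      exact bd (by positivity) (by positivity) heNX (by linear_combination a * hr1))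
    (by
      simp only [Matrix.mul_smul, Matrix.smul_mul, smul_smul]
      rw [norm_smul, Real.norm_of_nonneg (by positivity)]
      exact bd (by positivity) (by positivity) heNNX (by linear_combination a ^ 3 * hn1))
    hTn hYn
    (by
      rw [norm_smul, Real.norm_of_nonneg hn0.le]
      refine le_trans ?_ hCK
      calc (n : ℝ) * ‖G‖ ≤ n * (C / n) := mul_le_mul_of_nonneg_left hGn hn0.le
        _ = C := by field_simp)
    (hWn.trans hCK)
    (by
      rw [hQ, sq, haa]
      exact hW)
  have e1 : e * (a • Xh * W - a • X - (a * a) • N * (a • X) * ((n : ℝ) • G))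
      = a • (e * (Xh * W - X - N * X * G)) := by
    simp only [Matrix.smul_mul, Matrix.mul_smul, smul_smul, Matrix.mul_sub, smul_sub]
    congr 2
    linear_combination a * hn1
  rw [e1, norm_smul, Real.norm_of_nonneg ha0.le] at main
  have hfin := mul_le_mul_of_nonneg_left main (show (0 : ℝ) ≤ n by positivity)
  calc √n * ‖e * (Xh * W - X - N * X * G)‖
      = n * (a * ‖e * (Xh * W - X - N * X * G)‖) := by
        linear_combination -(√n * ‖e * (Xh * W - X - N * X * G)‖) * har
          + a * ‖e * (Xh * W - X - N * X * G)‖ * hrr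
    _ ≤ _ := hfin
    _ = _ := by linear_combination (22 * (4 * C * (d + 1)) ^ 11 * η) * hn1

end PolarAndEigen

/-! ### Double centering and the effective noise. -/

section Centering

open Matrix
open scoped Matrix.Norms.Frobenius

/-- The row vector of ones. -/
def onesRow (n : ℕ) : Matrix (Fin 1) (Fin n) ℝ := Matrix.of fun _ _ => 1

/-- The effective noise: `D ∘ E + (E ∘ E - σ²) / 2` off the diagonal. -/
noncomputable def effectiveNoise {n : ℕ} (D E : Matrix (Fin n) (Fin n) ℝ) (σ : ℝ) : Matrix (Fin n) (Fin n) ℝ :=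
  Matrix.of fun i j => if i = j then 0 else D i j * E i j + (E i j ^ 2 - σ ^ 2) / 2

lemma centeringMatrix_eq (n : ℕ) :
    centeringMatrix n = 1 - (n : ℝ)⁻¹ • ((onesRow n)ᵀ * onesRow n) := by
  rw [centeringMatrix]
  congr 2
  ext i j
  simp [onesRow, Matrix.mul_apply]

lemma onesRow_mul_transpose (n : ℕ) : onesRow n * (onesRow n)ᵀ = (n : ℝ) • 1 := by
  ext i j
  rw [Subsingleton.elim i j]
  simp [onesRow, Matrix.mul_apply]

lemma norm_onesRow (n : ℕ) : ‖onesRow n‖ = √n := by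
  rw [← Real.sqrt_sq (norm_nonneg _), frobenius_norm_sq]
  simp [onesRow]

lemma transpose_centeringMatrix (n : ℕ) : (centeringMatrix n)ᵀ = centeringMatrix n := by
  rw [centeringMatrix_eq]
  simp

lemma onesRow_mul_centeringMatrix {n : ℕ} (hn : 0 < n) : onesRow n * centeringMatrix n = 0 := by
  have hn0 : (n : ℝ) ≠ 0 := by positivity
  rw [centeringMatrix_eq, Matrix.mul_sub, Matrix.mul_smul, ← Matrix.mul_assoc,
    onesRow_mul_transpose, Matrix.smul_mul, smul_smul, inv_mul_cancel₀ hn0]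
  simp

lemma centeringMatrix_mul_onesRow_transpose {n : ℕ} (hn : 0 < n) :
    centeringMatrix n * (onesRow n)ᵀ = 0 := by
  rw [← transpose_centeringMatrix, ← transpose_mul, onesRow_mul_centeringMatrix hn, transpose_zero]

lemma centeringMatrix_mul_self {n : ℕ} (hn : 0 < n) :
    centeringMatrix n * centeringMatrix n = centeringMatrix n := by
  conv_lhs =>
    enter [1]
    rw [centeringMatrix_eq]
  rw [Matrix.sub_mul, Matrix.smul_mul, Matrix.mul_assoc, onesRow_mul_centeringMatrix hn]
  simp

lemma norm_centeringMatrix_mul_le {n : ℕ} {m : Type*} [Fintype m] (hn : 0 < n)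
    (M : Matrix (Fin n) m ℝ) : ‖centeringMatrix n * M‖ ≤ 2 * ‖M‖ := by
  have hn0 : (0 : ℝ) < n := by exact_mod_cast hn
  rw [centeringMatrix_eq, Matrix.sub_mul, Matrix.one_mul, Matrix.smul_mul]
  refine (norm_sub_le _ _).trans ?_
  rw [norm_smul, Real.norm_of_nonneg (by positivity)]
  have h : ‖(onesRow n)ᵀ * onesRow n * M‖ ≤ √n * √n * ‖M‖ :=
    frobenius_norm_mul_le_of_le (frobenius_norm_mul_le_of_le
      (by rw [frobenius_norm_transpose, norm_onesRow]) (norm_onesRow n).le) le_rfl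
  rw [Real.mul_self_sqrt hn0.le] at h
  have : (n : ℝ)⁻¹ * ‖(onesRow n)ᵀ * onesRow n * M‖ ≤ ‖M‖ := by
    rwa [inv_mul_le_iff₀ hn0]
  linarith

/-- The doubly centered dissimilarity matrix is a noisy Gram matrix. -/
lemma doubleCentered_distMatrix_add {n d : ℕ} (hn : 0 < n) (x : Fin n → EuclideanSpace ℝ (Fin d))
    (μ : EuclideanSpace ℝ (Fin d)) (E : Matrix (Fin n) (Fin n) ℝ) (hE : ∀ i, E i i = 0) (σ : ℝ) :
    doubleCentered (distMatrix x + E)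
      = (centeringMatrix n * Matrix.of fun i k => x i k - μ k)
          * (centeringMatrix n * Matrix.of fun i k => x i k - μ k)ᵀ
        + ((σ ^ 2 / 2) • centeringMatrix n
          - centeringMatrix n * effectiveNoise (distMatrix x) E σ * centeringMatrix n) := by
  set Y : Matrix (Fin n) (Fin d) ℝ := Matrix.of fun i k => x i k - μ k with hY
  set H := effectiveNoise (distMatrix x) E σ with hH
  set o := onesRow n
  set q : Matrix (Fin n) (Fin 1) ℝ := Matrix.of fun i _ => ∑ k, Y i k ^ 2 with hq
  -- The terms with a factor `o` at an outer end are annihilated by the centering matrix. Of `σ² (oᵀ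
  -- o - 1)` only `-σ²` survives, whence the multiple `σ²/2` of `P`. It is `oᵀ o - 1` and not `oᵀ o`
  -- because the noise vanishes on the diagonal.
  have key : (distMatrix x + E).map (fun x => x ^ 2)
      = q * o + oᵀ * qᵀ + (-2 : ℝ) • (Y * Yᵀ) + (2 : ℝ) • H + (σ ^ 2) • (oᵀ * o - 1) := by
    ext i j
    have hD : ‖x i - x j‖ ^ 2 = ∑ k, Y i k ^ 2 + ∑ k, Y j k ^ 2 - 2 * ∑ k, Y i k * Y j k := by
      rw [EuclideanSpace.norm_sq_eq, Finset.mul_sum, ← Finset.sum_add_distrib,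
        ← Finset.sum_sub_distrib]
      refine Finset.sum_congr rfl fun k _ => ?_
      simp only [hY, Matrix.of_apply, PiLp.sub_apply, Real.norm_eq_abs, sq_abs]
      ring
    by_cases hij : i = j
    · subst hij
      simp [hq, o, onesRow, Matrix.mul_apply, hH, effectiveNoise, distMatrix, hE, ← sq]
      ring
    · have : (distMatrix x i j + E i j) ^ 2 = ‖x i - x j‖ ^ 2 + 2 * H i j + σ ^ 2 := by
        simp only [hH, effectiveNoise, Matrix.of_apply, if_neg hij]
        simp only [distMatrix, Matrix.of_apply]
        ring
      simp only [Matrix.map_apply, Matrix.add_apply, this, hD]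
      simp [hq, o, onesRow, Matrix.mul_apply, hij]
      ring
  have ho := onesRow_mul_centeringMatrix hn
  have ho' := centeringMatrix_mul_onesRow_transpose hn
  rw [doubleCentered, key, transpose_mul, transpose_centeringMatrix]
  simp only [Matrix.mul_add, Matrix.add_mul, Matrix.mul_sub, Matrix.sub_mul, Matrix.mul_smul,
    Matrix.smul_mul, Matrix.mul_assoc, Matrix.mul_one, centeringMatrix_mul_self hn, o, ho]
  rw [← Matrix.mul_assoc _ (onesRow n)ᵀ, ← Matrix.mul_assoc _ (onesRow n)ᵀ, ho']
  simp only [Matrix.mul_zero, Matrix.zero_mul, zero_sub, smul_add, smul_smul, smul_neg]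
  module

/-- One constant that dominates all those arising when `H` is replaced by `τ P - P H P`. -/
lemma expansion_constant_bounds {τ C : ℝ} (hτ : 0 ≤ τ) (hC : 1 ≤ C) :
    2 * C ≤ (2 * τ + 4) ^ 2 * C ^ 2 ∧ 2 * τ * C + 4 * C ≤ (2 * τ + 4) ^ 2 * C ^ 2 ∧
    4 * τ * C ^ 2 + 4 * C ≤ (2 * τ + 4) ^ 2 * C ^ 2 ∧ 2 * τ + 4 * C ≤ (2 * τ + 4) ^ 2 * C ^ 2 ∧
    2 * τ ^ 2 * C + 8 * τ * C + 8 * C ^ 2 ≤ (2 * τ + 4) ^ 2 * C ^ 2 := by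
  have h0 : (2 * τ + 4) ^ 2 * C ^ 2 = 4 * (τ ^ 2 * C ^ 2) + 16 * (τ * C ^ 2) + 16 * C ^ 2 := by ring
  have h1 : C ≤ C ^ 2 := by nlinarith
  have h2 : 0 ≤ τ ^ 2 * C ^ 2 := by positivity
  have h3 : τ * C ≤ τ * C ^ 2 := mul_le_mul_of_nonneg_left h1 hτ
  have h4 : τ ^ 2 * C ≤ τ ^ 2 * C ^ 2 := mul_le_mul_of_nonneg_left h1 (sq_nonneg τ)
  have h5 : τ ≤ τ * C := le_mul_of_one_le_right hτ hC
  rw [h0]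
  refine ⟨?_, ?_, ?_, ?_, ?_⟩ <;> linarith

set_option maxHeartbeats 1000000 in
/-- First order expansion of a row of the classical scaling embedding of a noisy distance matrix,
in terms of the effective noise `H` and the centered configuration `Y`. -/
lemma cmds_row_expansion_of_noise {n d : ℕ} (hn : 0 < n) (hdn : d ≤ n)
    {Δ H : Matrix (Fin n) (Fin n) ℝ} {Y X Xh : Matrix (Fin n) (Fin d) ℝ}
    {G Ψ W : Matrix (Fin d) (Fin d) ℝ} {e : Matrix (Fin 1) (Fin n) ℝ} {C η τ : ℝ}
    (hXh : IsCMDSEmbedding Δ Xh) (hX : X = centeringMatrix n * Y)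
    (hB : doubleCentered Δ = X * Xᵀ
      + (τ • centeringMatrix n - centeringMatrix n * H * centeringMatrix n))
    (hH : Hᵀ = H) (hG : G * (Xᵀ * X) = 1) (heo : e * (onesRow n)ᵀ = 1) (he : ‖e‖ ≤ 1)
    (hτ : 0 ≤ τ) (hC : 1 ≤ C) (hη1 : η ≤ 1) (hηn : 1 ≤ η * √n)
    (hη : 4 * ((2 * τ + 4) ^ 2 * C ^ 2) * (d + 1) * ((2 * τ + 4) * η) ≤ 1 / 2)
    (hY : ‖Y‖ ≤ C * √n) (heY : ‖e * Y‖ ≤ C) (hm : ‖(n : ℝ)⁻¹ • (onesRow n * Y)‖ ≤ η)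
    (hHop : ∀ (m : ℕ) (M : Matrix (Fin n) (Fin m) ℝ), ‖H * M‖ ≤ η * n * ‖M‖)
    (hHY : ‖H * Y‖ ≤ C * n) (hHo : ‖H * (onesRow n)ᵀ‖ ≤ C * n) (hYHY : ‖Yᵀ * H * Y‖ ≤ C * n)
    (hoHY : ‖onesRow n * H * Y‖ ≤ C * n) (hoHo : ‖onesRow n * H * (onesRow n)ᵀ‖ ≤ C * n)
    (heH : ‖e * H‖ ≤ C * √n) (heHY : ‖e * H * Y‖ ≤ C * √n)
    (heHo : ‖e * H * (onesRow n)ᵀ‖ ≤ C * √n) (heHHY : ‖e * H * H * Y‖ ≤ C * n)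
    (heHHo : ‖e * H * H * (onesRow n)ᵀ‖ ≤ C * n) (hΨ : ‖Ψ‖ ≤ C) (hGΨ : ‖(n : ℝ) • G - Ψ‖ ≤ η)
    (hWn : ‖W‖ ≤ C)
    (hW : ‖Xᵀ * Xh * (Xhᵀ * Xh)⁻¹ * W - 1‖
      ≤ ‖(Xᵀ * Xh * (Xhᵀ * Xh)⁻¹)ᵀ * (Xᵀ * Xh * (Xhᵀ * Xh)⁻¹) - 1‖ + (n : ℝ)⁻¹) :
    √n * ‖e * (Xh * W - X) + (n : ℝ)⁻¹ • (e * H * Y * Ψ)‖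
      ≤ (22 * (4 * ((2 * τ + 4) ^ 2 * C ^ 2) * (d + 1)) ^ 11 * (2 * τ + 4)
        + (4 * τ + 7) * C ^ 2) * η := by
  have hn0 : (0 : ℝ) < n := by exact_mod_cast hn
  have hn1 : (1 : ℝ) ≤ n := by exact_mod_cast hn
  set r := √(n : ℝ) with hr
  have hr0 : 0 < r := Real.sqrt_pos.2 hn0
  have hr1 : 1 ≤ r := Real.one_le_sqrt.2 hn1
  have hrr : r * r = n := Real.mul_self_sqrt hn0.le
  have hrn : r ≤ n := by nlinarith
  have hη0 : 0 ≤ η := by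
    by_contra h
    nlinarith
  have hC0 : 0 ≤ C := by linarith
  have hCr : r ≤ C * r := le_mul_of_one_le_left hr0.le hC
  have hCr' : C ≤ C * r := le_mul_of_one_le_right hC0 hr1
  set o := onesRow n with ho
  set P := centeringMatrix n with hP
  set m := (n : ℝ)⁻¹ • (o * Y) with hmdef
  have hon : ‖o‖ = r := norm_onesRow n
  have hotn : ‖oᵀ‖ = r := by rw [frobenius_norm_transpose, hon]
  -- The points centered at the sample mean differ from those centered at `μ` by a small multiple of
  -- the ones vector. So each estimate for `X` reduces to one for `Y` and one for `o`, in which the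
  -- summands depend on single points.
  have hXY : X = Y - oᵀ * m := by
    rw [hX, hP, centeringMatrix_eq, Matrix.sub_mul, Matrix.one_mul, hmdef, Matrix.mul_smul,
      Matrix.smul_mul, Matrix.mul_assoc]
  have hPX : P * X = X := by rw [hX, ← Matrix.mul_assoc, hP, centeringMatrix_mul_self hn]
  have hPt : Pᵀ = P := transpose_centeringMatrix n
  have hPP : P * P = P := centeringMatrix_mul_self hn
  have hPn : ∀ {k : ℕ} (M : Matrix (Fin n) (Fin k) ℝ), ‖P * M‖ ≤ 2 * ‖M‖ :=
    fun M => norm_centeringMatrix_mul_le hn M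
  have hXtP : Xᵀ * P = Xᵀ := by
    rw [← hPt, ← transpose_mul, hPX]
  have bXn : ‖X‖ ≤ 2 * C * r := by
    rw [hXY]
    refine (norm_sub_le _ _).trans ((add_le_add hY
      (frobenius_norm_mul_le_of_le hotn.le (hm.trans hη1))).trans ?_)
    linarith
  have heX : e * X = e * Y - m := by
    rw [hXY, Matrix.mul_sub, ← Matrix.mul_assoc, heo, Matrix.one_mul]
  have beX : ‖e * X‖ ≤ 2 * C := by
    rw [heX]
    exact (norm_sub_le _ _).trans ((add_le_add heY (hm.trans hη1)).trans (by linarith))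
  have subm : ∀ {k : ℕ} {c : ℝ} (A : Matrix (Fin k) (Fin n) ℝ), ‖A * Y‖ ≤ c → ‖A * oᵀ‖ ≤ c →
      ‖A * X‖ ≤ 2 * c := by
    intro k c A h1 h2
    have hc : 0 ≤ c := (norm_nonneg _).trans h1
    rw [hXY, Matrix.mul_sub, ← Matrix.mul_assoc]
    refine (norm_sub_le _ _).trans ((add_le_add h1
      (frobenius_norm_mul_le_of_le h2 (hm.trans hη1))).trans ?_)
    linarith
  have bHX : ‖H * X‖ ≤ 2 * (C * n) := subm H hHY hHo
  have boHX : ‖o * H * X‖ ≤ 2 * (C * n) := subm _ hoHY hoHo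
  have beHX : ‖e * H * X‖ ≤ 2 * (C * r) := subm _ heHY heHo
  have beHHX : ‖e * H * H * X‖ ≤ 2 * (C * n) := subm _ heHHY heHHo
  have hYHo : ‖Yᵀ * H * oᵀ‖ ≤ C * n := by
    rw [← frobenius_norm_transpose]
    simpa only [transpose_mul, transpose_transpose, hH, Matrix.mul_assoc] using hoHY
  have bYHX : ‖Yᵀ * H * X‖ ≤ 2 * (C * n) := subm _ hYHY hYHo
  have hmt : ‖mᵀ‖ ≤ 1 := by rw [frobenius_norm_transpose]; exact hm.trans hη1
  have bXt : ‖Xᵀ‖ ≤ 2 * C * r := by rw [frobenius_norm_transpose]; exact bXn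
  have bXHX : ‖Xᵀ * H * X‖ ≤ 4 * (C * n) := by
    have e1 : Xᵀ * H * X = Yᵀ * H * X - mᵀ * (o * H * X) := by
      conv_lhs =>
        enter [1, 1]
        rw [hXY]
      rw [transpose_sub, transpose_mul, transpose_transpose, Matrix.sub_mul, Matrix.sub_mul]
      simp only [Matrix.mul_assoc]
    rw [e1]
    refine (norm_sub_le _ _).trans ((add_le_add bYHX (frobenius_norm_mul_le_of_le hmt boHX)).trans ?_)
    linarith
  have heP : e * P = e - (n : ℝ)⁻¹ • o := by
    rw [hP, centeringMatrix_eq, Matrix.mul_sub, Matrix.mul_one, Matrix.mul_smul,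
      ← Matrix.mul_assoc, heo, Matrix.one_mul]
  have boH : ‖o * H‖ ≤ C * n := by
    rw [← frobenius_norm_transpose]
    simpa only [transpose_mul, hH] using hHo
  have scal : ∀ {k : ℕ} {c : ℝ} {A : Matrix (Fin 1) (Fin k) ℝ}, ‖A‖ ≤ c * n →
      ‖(n : ℝ)⁻¹ • A‖ ≤ c := by
    intro k c A h
    rw [norm_smul, Real.norm_of_nonneg (by positivity), inv_mul_le_iff₀ hn0]
    linarith
  have hePn : ‖e * P‖ ≤ 2 := by
    rw [heP]
    have h1 : ‖(n : ℝ)⁻¹ • o‖ ≤ 1 := scal (by rw [hon, one_mul]; exact hrn)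
    exact (norm_sub_le _ _).trans ((add_le_add he h1).trans (by norm_num))
  -- A row of `P H` is the row of `H` minus the average of all rows; the average is of smaller order
  -- than the row once multiplied by `X`.
  have hePH : e * P * H = e * H - (n : ℝ)⁻¹ • (o * H) := by
    rw [heP, Matrix.sub_mul, Matrix.smul_mul]
  have bePH : ‖e * P * H‖ ≤ 2 * (C * r) := by
    rw [hePH]
    refine (norm_sub_le _ _).trans ((add_le_add heH (scal boH)).trans ?_)
    linarith
  have hePHX : e * P * H * X = e * H * X - (n : ℝ)⁻¹ • (o * H * X) := by
    rw [hePH, Matrix.sub_mul, Matrix.smul_mul]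
  have bePHX : ‖e * P * H * X‖ ≤ 4 * (C * r) := by
    rw [hePHX]
    have h1 : ‖(n : ℝ)⁻¹ • (o * H * X)‖ ≤ 2 * C := scal (boHX.trans (le_of_eq (by ring)))
    refine (norm_sub_le _ _).trans ((add_le_add beHX h1).trans ?_)
    linarith
  set N := τ • P - P * H * P with hN
  have hNt : Nᵀ = N := by
    rw [hN, transpose_sub, transpose_smul, transpose_mul, transpose_mul, hPt, hH, Matrix.mul_assoc]
  have hNX : N * X = τ • X - P * (H * X) := by
    rw [hN, Matrix.sub_mul, Matrix.smul_mul, hPX, Matrix.mul_assoc, Matrix.mul_assoc, hPX]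
  have heNX : e * N * X = τ • (e * X) - e * P * H * X := by
    rw [Matrix.mul_assoc, hNX, Matrix.mul_sub, Matrix.mul_smul]
    simp only [Matrix.mul_assoc]
  have nτ : ∀ {k l : ℕ} {c : ℝ} {A : Matrix (Fin k) (Fin l) ℝ}, ‖A‖ ≤ c → ‖τ • A‖ ≤ τ * c := by
    intro k l c A h
    rw [norm_smul, Real.norm_of_nonneg hτ]
    exact mul_le_mul_of_nonneg_left h hτ
  have beNX : ‖e * N * X‖ ≤ τ * (2 * C) + 4 * (C * r) := by
    rw [heNX]
    exact (norm_sub_le _ _).trans (add_le_add (nτ beX) bePHX)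
  have bePHPHX : ‖e * P * H * (P * (H * X))‖ ≤ 8 * C ^ 2 * n := by
    have e1 : P * (H * X) = H * X - (n : ℝ)⁻¹ • (oᵀ * (o * H * X)) := by
      rw [hP, centeringMatrix_eq, Matrix.sub_mul, Matrix.one_mul, Matrix.smul_mul]
      simp only [Matrix.mul_assoc, ← ho]
    have e2 : e * P * H * (P * (H * X)) = e * H * H * X
        - (n : ℝ)⁻¹ • (e * H * oᵀ * (o * H * X))
        - (n : ℝ)⁻¹ • (o * H * (H * X) - (n : ℝ)⁻¹ • (o * H * oᵀ * (o * H * X))) := by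
      rw [hePH, e1]
      simp only [Matrix.mul_sub, Matrix.sub_mul, Matrix.mul_smul, Matrix.smul_mul,
        Matrix.mul_assoc, smul_sub]
      abel
    rw [e2]
    have b1 : ‖(n : ℝ)⁻¹ • (e * H * oᵀ * (o * H * X))‖ ≤ C * r * (2 * C) := by
      refine scal ((frobenius_norm_mul_le_of_le heHo boHX).trans (le_of_eq (by ring)))
    have b2 : ‖(n : ℝ)⁻¹ • (o * H * oᵀ * (o * H * X))‖ ≤ C * (2 * C) * n := by
      refine scal ((frobenius_norm_mul_le_of_le hoHo boHX).trans (le_of_eq (by ring)))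
    have b3 : ‖o * H * (H * X)‖ ≤ C * n * (2 * (C * n)) := frobenius_norm_mul_le_of_le boH bHX
    have b4 : ‖(n : ℝ)⁻¹ • (o * H * (H * X) - (n : ℝ)⁻¹ • (o * H * oᵀ * (o * H * X)))‖
        ≤ 2 * C ^ 2 * n + 2 * C ^ 2 := by
      refine scal ((norm_sub_le _ _).trans ((add_le_add b3 b2).trans (le_of_eq (by ring))))
    refine (norm_sub_le _ _).trans ((add_le_add ((norm_sub_le _ _).trans
      (add_le_add beHHX b1)) b4).trans ?_)
    linarith [mul_le_mul_of_nonneg_left hrn (sq_nonneg C),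
      mul_le_mul_of_nonneg_left hn1 (sq_nonneg C),
      mul_le_mul_of_nonneg_right hC (mul_nonneg hC0 hn0.le)]
  have heN : e * N = τ • (e * P) - e * P * H * P := by
    rw [hN, Matrix.mul_sub, Matrix.mul_smul]
    simp only [Matrix.mul_assoc]
  have beNNX : ‖e * N * N * X‖ ≤ τ * (τ * (2 * C) + 4 * (C * r)) + (τ * (4 * (C * r))
      + 8 * C ^ 2 * n) := by
    have e1 : e * N * N * X = τ • (e * N * X) - (τ • (e * P * H * X)
        - e * P * H * (P * (H * X))) := by
      rw [Matrix.mul_assoc (e * N), hNX, Matrix.mul_sub, Matrix.mul_smul]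
      congr 1
      rw [heN, Matrix.sub_mul, Matrix.smul_mul, Matrix.mul_assoc (e * P * H) P, ← Matrix.mul_assoc P P,
        hPP]
      congr 2
      rw [Matrix.mul_assoc e P (P * (H * X)), ← Matrix.mul_assoc P P, hPP]
      simp only [Matrix.mul_assoc]
    rw [e1]
    exact (norm_sub_le _ _).trans (add_le_add (nτ beNX) ((norm_sub_le _ _).trans
      (add_le_add (nτ bePHX) bePHPHX)))
  set K := 2 * τ + 4 with hK
  have hK4 : 4 ≤ K := by linarith
  set C' := K ^ 2 * C ^ 2 with hC'
  have hCC : C ≤ C ^ 2 := by nlinarith only [hC]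
  obtain ⟨k1, k2, k3, k4, k5⟩ := expansion_constant_bounds hτ hC
  rw [← hK, ← hC'] at k1 k2 k3 k4 k5
  have hCC' : C ≤ C' := by linarith
  have hτC0 : 0 ≤ τ * C := mul_nonneg hτ hC0
  have step : ∀ {x y z : ℝ}, x ≤ y * z → 0 ≤ z → y ≤ C' → x ≤ C' * z := fun h hz hy =>
    h.trans (mul_le_mul_of_nonneg_right hy hz)
  have hKη : 1 ≤ K * η * r := by
    linarith [mul_le_mul_of_nonneg_right hK4 (mul_nonneg hη0 hr0.le)]
  have bNop : ∀ (k : ℕ) (M : Matrix (Fin n) (Fin k) ℝ), ‖N * M‖ ≤ K * η * n * ‖M‖ := by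
    intro k M
    rw [hN, Matrix.sub_mul, Matrix.smul_mul, Matrix.mul_assoc, Matrix.mul_assoc]
    have h1 := hHop k (P * M)
    have h2 := hPn M
    have h3 := hPn (H * (P * M))
    have h4 : η * n * ‖P * M‖ ≤ η * n * (2 * ‖M‖) :=
      mul_le_mul_of_nonneg_left h2 (by positivity)
    refine (norm_sub_le _ _).trans ((add_le_add (nτ h2) h3).trans ?_)
    have h5 : τ * (2 * ‖M‖) ≤ τ * (2 * ‖M‖) * (η * n) := by
      have : 1 ≤ η * n := hηn.trans (mul_le_mul_of_nonneg_left hrn hη0)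
      exact le_mul_of_one_le_right (by positivity) this
    rw [hK]
    linarith
  have bNX : ‖N * X‖ ≤ C' * n := by
    rw [hNX]
    refine step (y := 2 * τ * C + 4 * C) ((norm_sub_le _ _).trans
      ((add_le_add (nτ bXn) ((hPn _).trans (mul_le_mul_of_nonneg_left bHX zero_le_two))).trans
        ?_)) hn0.le k2
    linarith [mul_le_mul_of_nonneg_left hrn hτC0]
  have bXNX : ‖Xᵀ * N * X‖ ≤ C' * n := by
    have e1 : Xᵀ * N * X = τ • (Xᵀ * X) - Xᵀ * H * X := by
      rw [Matrix.mul_assoc, hNX, Matrix.mul_sub, Matrix.mul_smul, ← Matrix.mul_assoc Xᵀ P, hXtP,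
        Matrix.mul_assoc]
    rw [e1]
    refine step (y := 4 * τ * C ^ 2 + 4 * C) ((norm_sub_le _ _).trans
      ((add_le_add (nτ (frobenius_norm_mul_le_of_le bXt bXn)) bXHX).trans ?_)) hn0.le k3
    refine le_of_eq ?_
    linear_combination 4 * τ * C ^ 2 * hrr
  have beN : ‖e * N‖ ≤ C' * r := by
    rw [heN]
    have h1 : ‖e * P * H * P‖ ≤ 2 * (2 * (C * r)) := by
      rw [← frobenius_norm_transpose, transpose_mul, hPt]
      refine (norm_centeringMatrix_mul_le hn _).trans ?_
      rw [frobenius_norm_transpose]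
      exact mul_le_mul_of_nonneg_left bePH zero_le_two
    refine step (y := 2 * τ + 4 * C) ((norm_sub_le _ _).trans
      ((add_le_add (nτ hePn) h1).trans ?_)) hr0.le k4
    linarith [mul_le_mul_of_nonneg_left hr1 hτ]
  have beNX' : ‖e * N * X‖ ≤ C' * r := by
    refine step (y := 2 * τ * C + 4 * C) (beNX.trans ?_) hr0.le k2
    linarith [mul_le_mul_of_nonneg_left hr1 hτC0]
  have beNNX' : ‖e * N * N * X‖ ≤ C' * n := by
    refine step (y := 2 * τ ^ 2 * C + 8 * τ * C + 8 * C ^ 2) (beNNX.trans ?_) hn0.le k5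
    linarith [mul_le_mul_of_nonneg_left hrn hτC0,
      mul_le_mul_of_nonneg_left hn1 (mul_nonneg (sq_nonneg τ) hC0)]
  have bnG : ‖(n : ℝ) • G‖ ≤ 2 * C := by
    have : (n : ℝ) • G = ((n : ℝ) • G - Ψ) + Ψ := by abel
    rw [this]
    exact (norm_add_le _ _).trans ((add_le_add hGΨ hΨ).trans (by linarith))
  rw [norm_smul, Real.norm_of_nonneg hn0.le] at bnG
  have bG : ‖G‖ ≤ C' / n := by
    rw [le_div_iff₀ hn0]
    linarith
  have hmain := cmds_row_expansion (e := e) (C := C') (η := K * η) hn hdn hXh hB hNt hG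
    (hC.trans hCC') hη hKη (step bXn hr0.le k1) bNop bNX bXNX (beX.trans k1) beN beNX' beNNX' bG
    (hWn.trans hCC') hW
  have hGn : ‖G‖ ≤ 2 * C * (n : ℝ)⁻¹ := by
    rw [← div_eq_mul_inv, le_div_iff₀ hn0]
    linarith
  have heHX : e * H * X = e * H * Y - e * H * oᵀ * m := by
    rw [hXY, Matrix.mul_sub]
    simp only [Matrix.mul_assoc]
  -- Passing from the row of `N X G` to `-n⁻¹ e H Y Ψ` leaves four errors: the `τ P` part of `N`,
  -- the row average, the replacement of `n G` by `Ψ`, and that of `X` by `Y`. After multiplication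
  -- by `√n` each is a constant times `η`.
  have split : e * (Xh * W - X) + (n : ℝ)⁻¹ • (e * H * Y * Ψ) = e * (Xh * W - X - N * X * G)
      + τ • (e * X * G) + (n : ℝ)⁻¹ • (o * H * X * G) - (n : ℝ)⁻¹ • (e * H * X * ((n : ℝ) • G - Ψ))
      + (n : ℝ)⁻¹ • (e * H * oᵀ * m * Ψ) := by
    have e1 : e * (N * X * G) = τ • (e * X * G) - e * H * X * G + (n : ℝ)⁻¹ • (o * H * X * G) := by
      rw [← Matrix.mul_assoc, ← Matrix.mul_assoc, heNX, hePHX]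
      simp only [Matrix.sub_mul, Matrix.smul_mul]
      abel
    have e2 : e * (Xh * W - X - N * X * G) = e * (Xh * W - X) - e * (N * X * G) := by
      rw [← Matrix.mul_sub]
    have e3 : (n : ℝ)⁻¹ • (e * H * X * ((n : ℝ) • G - Ψ))
        = e * H * X * G - (n : ℝ)⁻¹ • (e * H * X * Ψ) := by
      rw [Matrix.mul_sub, Matrix.mul_smul, smul_sub, smul_smul, inv_mul_cancel₀ hn0.ne', one_smul]
    have e4 : e * H * X * Ψ = e * H * Y * Ψ - e * H * oᵀ * m * Ψ := by
      rw [heHX, Matrix.sub_mul]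
    rw [e2, e1, e3, e4, smul_sub]
    abel
  have q1 : ‖τ • (e * X * G)‖ ≤ τ * (2 * C * (2 * C * (n : ℝ)⁻¹)) :=
    nτ (frobenius_norm_mul_le_of_le beX hGn)
  have q2 : ‖(n : ℝ)⁻¹ • (o * H * X * G)‖ ≤ (n : ℝ)⁻¹ * (2 * (C * n) * (2 * C * (n : ℝ)⁻¹)) := by
    rw [norm_smul, Real.norm_of_nonneg (by positivity)]
    exact mul_le_mul_of_nonneg_left (frobenius_norm_mul_le_of_le boHX hGn) (by positivity)
  have q3 : ‖(n : ℝ)⁻¹ • (e * H * X * ((n : ℝ) • G - Ψ))‖ ≤ (n : ℝ)⁻¹ * (2 * (C * r) * η) := by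
    rw [norm_smul, Real.norm_of_nonneg (by positivity)]
    exact mul_le_mul_of_nonneg_left (frobenius_norm_mul_le_of_le beHX hGΨ) (by positivity)
  have q4 : ‖(n : ℝ)⁻¹ • (e * H * oᵀ * m * Ψ)‖ ≤ (n : ℝ)⁻¹ * (C * r * η * C) := by
    rw [norm_smul, Real.norm_of_nonneg (by positivity)]
    exact mul_le_mul_of_nonneg_left (frobenius_norm_mul_le_of_le
      (frobenius_norm_mul_le_of_le heHo hm) hΨ) (by positivity)
  rw [split]
  have hsum := (norm_add_le _ _).trans (add_le_add ((norm_sub_le _ _).trans (add_le_add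
    ((norm_add_le _ _).trans (add_le_add ((norm_add_le
      (e * (Xh * W - X - N * X * G)) (τ • (e * X * G))).trans (add_le_add le_rfl q1)) q2)) q3)) q4)
  have hrn' : r * (n : ℝ)⁻¹ ≤ η := by
    rw [← div_eq_mul_inv, div_le_iff₀ hn0, ← hrr]
    linarith [mul_le_mul_of_nonneg_right hηn hr0.le]
  have hrn2 : r * (n : ℝ)⁻¹ * r = 1 := by
    rw [mul_right_comm, hrr, mul_inv_cancel₀ hn0.ne']
  have hnn : (n : ℝ) * (n : ℝ)⁻¹ = 1 := mul_inv_cancel₀ hn0.ne'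
  refine (mul_le_mul_of_nonneg_left hsum hr0.le).trans ?_
  have p1 : r * (τ * (2 * C * (2 * C * (n : ℝ)⁻¹))) ≤ 4 * τ * C ^ 2 * η := by
    calc _ = 4 * τ * C ^ 2 * (r * (n : ℝ)⁻¹) := by ring
      _ ≤ _ := mul_le_mul_of_nonneg_left hrn' (by positivity)
  have p2 : r * ((n : ℝ)⁻¹ * (2 * (C * n) * (2 * C * (n : ℝ)⁻¹))) ≤ 4 * C ^ 2 * η := by
    calc _ = 4 * C ^ 2 * (r * (n : ℝ)⁻¹) * (n * (n : ℝ)⁻¹) := by ring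
      _ = 4 * C ^ 2 * (r * (n : ℝ)⁻¹) := by rw [hnn, mul_one]
      _ ≤ _ := mul_le_mul_of_nonneg_left hrn' (by positivity)
  have p3 : r * ((n : ℝ)⁻¹ * (2 * (C * r) * η)) = 2 * C * η := by
    linear_combination 2 * C * η * hrn2
  have p4 : r * ((n : ℝ)⁻¹ * (C * r * η * C)) = C ^ 2 * η := by
    linear_combination C ^ 2 * η * hrn2
  have p5 : C * η ≤ C ^ 2 * η := mul_le_mul_of_nonneg_right hCC hη0
  rw [mul_add, mul_add, mul_add, mul_add]
  refine (add_le_add (add_le_add (add_le_add (add_le_add hmain p1) p2) p3.le) p4.le).trans ?_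
  linarith

end Centering

/-! ### Second moments of forms in a symmetric array with independent entries. -/

section WignerArray

variable {Ω : Type*} [MeasurableSpace Ω]

/-- A symmetric hollow array of centered random variables with fourth moments, independent above
the diagonal. -/
structure IsWignerArray {n : ℕ} (P : Measure Ω) (h : Fin n → Fin n → Ω → ℝ) : Prop where
  symm : ∀ i j, h i j = h j i
  hollow : ∀ i ω, h i i ω = 0
  indep : iIndepFun (fun p : {p : Fin n × Fin n // p.1 < p.2} => h p.1.1 p.1.2) P
  meas : ∀ i j, Measurable (h i j)
  memLp : ∀ i j, MemLp (h i j) 4 P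
  mean : ∀ i j, ∫ ω, h i j ω ∂P = 0

lemma memLp_two_mul {P : Measure Ω} {f g : Ω → ℝ} (hf : MemLp f 4 P) (hg : MemLp g 4 P) :
    MemLp (fun ω => f ω * g ω) 2 P := by
  haveI : ENNReal.HolderTriple 4 4 2 := ⟨by
    rw [← two_mul, show (4 : ENNReal) = 2 * 2 by norm_num, ENNReal.mul_inv (by simp) (by simp),
      ← mul_assoc, ENNReal.mul_inv_cancel (by simp) (by simp), one_mul]⟩
  exact hg.mul' hf

lemma integrable_mul_four {P : Measure Ω} {f g h k : Ω → ℝ} (hf : MemLp f 4 P) (hg : MemLp g 4 P)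
    (hh : MemLp h 4 P) (hk : MemLp k 4 P) : Integrable (fun ω => f ω * g ω * (h ω * k ω)) P :=
  (memLp_two_mul hf hg).integrable_mul (memLp_two_mul hh hk)

namespace IsWignerArray

variable {n : ℕ} {P : Measure Ω} {h : Fin n → Fin n → Ω → ℝ}

/-- Independence is assumed for ordered pairs `i < j` only; unordered pairs `s(i, j)` let the later
arguments ignore which entry of a symmetric pair is named. -/
lemma exists_edge (hw : IsWignerArray P h) {i j : Fin n} (hij : i ≠ j) :
    ∃ p : {p : Fin n × Fin n // p.1 < p.2}, s(p.1.1, p.1.2) = s(i, j) ∧ h i j = h p.1.1 p.1.2 := by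
  rcases lt_or_gt_of_ne hij with hlt | hlt
  · exact ⟨⟨(i, j), hlt⟩, rfl, rfl⟩
  · exact ⟨⟨(j, i), hlt⟩, Sym2.eq_swap, hw.symm i j⟩

/-- All the other entries, jointly, are functions of one variable independent of `h i j`. A lone
factor `h i j` can thus be split off from any product of the others. -/
lemma exists_indepFun_others (hw : IsWignerArray P h) {i j : Fin n} (hij : i ≠ j) :
    ∃ (T : Type) (_ : MeasurableSpace T) (O : Ω → T), Measurable O ∧ IndepFun (h i j) O P ∧
      ∀ k l, s(k, l) ≠ s(i, j) → ∃ ψ : T → ℝ, Measurable ψ ∧ h k l = ψ ∘ O := by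
  obtain ⟨e, he, hhe⟩ := hw.exists_edge hij
  refine ⟨({e}ᶜ : Finset {p : Fin n × Fin n // p.1 < p.2}) → ℝ, inferInstance,
    fun ω p => h p.1.1.1 p.1.1.2 ω, measurable_pi_lambda _ fun p => hw.meas _ _, ?_, ?_⟩
  · have := hw.indep.indepFun_finset {e} {e}ᶜ disjoint_compl_right fun p => hw.meas _ _
    rw [hhe]
    exact this.comp (φ := fun f : ({e} : Finset _) → ℝ => f ⟨e, Finset.mem_singleton_self e⟩)
      (measurable_pi_apply (⟨e, Finset.mem_singleton_self e⟩ : ({e} : Finset _))) measurable_id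
  · intro k l hkl
    by_cases hk : k = l
    · subst hk
      exact ⟨fun _ => 0, measurable_const, funext fun ω => hw.hollow k ω⟩
    · obtain ⟨e', he', hhe'⟩ := hw.exists_edge hk
      have hne : e' ≠ e := by
        rintro rfl
        exact hkl (he'.symm.trans he)
      exact ⟨fun f => f ⟨e', by simpa using hne⟩, measurable_pi_apply _, hhe'⟩

/-- An edge that occurs exactly once in a product contributes its mean, which is zero. The
combinatorics below consists in finding such an edge. -/
lemma integral_mul_eq_zero (hw : IsWignerArray P h) {i j k l p q r t : Fin n}
    (h1 : s(k, l) ≠ s(i, j)) (h2 : s(p, q) ≠ s(i, j)) (h3 : s(r, t) ≠ s(i, j)) :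
    ∫ ω, h i j ω * h k l ω * (h p q ω * h r t ω) ∂P = 0 := by
  by_cases hij : i = j
  · subst hij; simp [hw.hollow]
  obtain ⟨T, _, O, hO, hind, hψ⟩ := hw.exists_indepFun_others hij
  obtain ⟨ψ1, hm1, e1⟩ := hψ k l h1
  obtain ⟨ψ2, hm2, e2⟩ := hψ p q h2
  obtain ⟨ψ3, hm3, e3⟩ := hψ r t h3
  have := (hind.comp (φ := id) (ψ := fun x => ψ1 x * (ψ2 x * ψ3 x)) measurable_id
    (by fun_prop)).integral_fun_mul_eq_mul_integral
      (by simpa using (hw.meas i j).aestronglyMeasurable)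
      (Measurable.aestronglyMeasurable (by fun_prop))
  rw [e1, e2, e3]
  simp only [Function.comp_def, id, hw.mean i j, zero_mul] at this
  rw [← this]
  exact integral_congr_ae (.of_forall fun ω => by simp only [Function.comp_def]; ring)

lemma integral_mul_eq_zero_two (hw : IsWignerArray P h) {i j k l : Fin n}
    (h1 : s(k, l) ≠ s(i, j)) : ∫ ω, h i j ω * h k l ω ∂P = 0 := by
  by_cases hij : i = j
  · subst hij; simp [hw.hollow]
  obtain ⟨T, _, O, hO, hind, hψ⟩ := hw.exists_indepFun_others hij
  obtain ⟨ψ1, hm1, e1⟩ := hψ k l h1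
  have := (hind.comp (φ := id) (ψ := ψ1) measurable_id hm1).integral_fun_mul_eq_mul_integral
      (by simpa using (hw.meas i j).aestronglyMeasurable)
      (Measurable.aestronglyMeasurable (by fun_prop))
  rw [e1]
  simpa only [Function.comp_def, id, hw.mean i j, zero_mul] using this

lemma integral_sq_mul_sq (hw : IsWignerArray P h) {i j k l : Fin n} (h1 : s(k, l) ≠ s(i, j)) :
    ∫ ω, h i j ω * h k l ω * (h i j ω * h k l ω) ∂P
      = (∫ ω, h i j ω ^ 2 ∂P) * ∫ ω, h k l ω ^ 2 ∂P := by
  by_cases hij : i = j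
  · subst hij; simp [hw.hollow]
  obtain ⟨T, _, O, hO, hind, hψ⟩ := hw.exists_indepFun_others hij
  obtain ⟨ψ1, hm1, e1⟩ := hψ k l h1
  have := (hind.comp (φ := fun x => x ^ 2) (ψ := fun x => ψ1 x ^ 2) (by fun_prop)
    (by fun_prop)).integral_fun_mul_eq_mul_integral
      ((hw.meas i j).pow_const 2).aestronglyMeasurable
      (Measurable.aestronglyMeasurable (by fun_prop))
  rw [e1]
  simp only [Function.comp_def] at this ⊢
  rw [← this]
  exact integral_congr_ae (.of_forall fun ω => by ring)

variable [IsProbabilityMeasure P]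

lemma memLp_two (hw : IsWignerArray P h) (i j : Fin n) : MemLp (h i j) 2 P :=
  (hw.memLp i j).mono_exponent (by norm_num)

/-- The second moment of a linear form in the array. -/
lemma integral_sum_sq_le (hw : IsWignerArray P h) (c : Fin n → Fin n → ℝ) :
    ∫ ω, (∑ i, ∑ j, c i j * h i j ω) ^ 2 ∂P
      ≤ 2 * ∑ i, ∑ j, c i j ^ 2 * ∫ ω, h i j ω ^ 2 ∂P := by
  set v : Fin n → Fin n → ℝ := fun i j => ∫ ω, h i j ω ^ 2 ∂P with hv
  have hvs : ∀ i j, v i j = v j i := fun i j => by simp only [hv, hw.symm i j]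
  have hv0 : ∀ i j, 0 ≤ v i j := fun i j => integral_nonneg fun ω => sq_nonneg _
  have hexp : ∀ ω, (∑ i, ∑ j, c i j * h i j ω) ^ 2
      = ∑ i, ∑ j, ∑ k, ∑ l, c i j * c k l * (h i j ω * h k l ω) := by
    intro ω
    rw [sq, Finset.sum_mul]
    refine Finset.sum_congr rfl fun i _ => ?_
    rw [Finset.sum_mul]
    refine Finset.sum_congr rfl fun j _ => ?_
    rw [Finset.mul_sum]
    refine Finset.sum_congr rfl fun k _ => ?_
    rw [Finset.mul_sum]
    exact Finset.sum_congr rfl fun l _ => by ring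
  have hint : ∀ i j k l, Integrable (fun ω => c i j * c k l * (h i j ω * h k l ω)) P :=
    fun i j k l => ((hw.memLp_two i j).integrable_mul (hw.memLp_two k l)).const_mul _
  have hterm : ∀ i j, ∑ k, ∑ l, c i j * c k l * ∫ ω, h i j ω * h k l ω ∂P
      ≤ (c i j ^ 2 + |c i j * c j i|) * v i j := by
    intro i j
    by_cases hij : i = j
    · subst hij; simp [hw.hollow, hv]
    -- Only `(k, l) = (i, j)` and its transpose correlate with `h i j`; the transpose is what costs
    -- the factor `2` in the final bound.
    have h0 : ∀ k l, c i j * c k l * ∫ ω, h i j ω * h k l ω ∂P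
        = (if k = i then if l = j then c i j ^ 2 * v i j else 0 else 0)
          + if k = j then if l = i then c i j * c j i * v i j else 0 else 0 := by
      intro k l
      by_cases h1 : s(k, l) = s(i, j)
      · rcases Sym2.eq_iff.1 h1 with ⟨rfl, rfl⟩ | ⟨rfl, rfl⟩
        · simp [hij, hv, sq]
        · simp [hij, hv, sq, hw.symm l k]
      · rw [hw.integral_mul_eq_zero_two h1, mul_zero]
        have h2 : ¬ (k = i ∧ l = j) := fun h => h1 (by rw [h.1, h.2])
        have h3 : ¬ (k = j ∧ l = i) := fun h => h1 (by rw [h.1, h.2, Sym2.eq_swap])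
        rw [← ite_and, ← ite_and, if_neg h2, if_neg h3, add_zero]
    simp only [h0, Finset.sum_add_distrib]
    simp only [Finset.sum_ite_irrel, Finset.sum_const_zero, Finset.sum_ite_eq', Finset.mem_univ,
      if_true]
    rw [add_mul]
    exact add_le_add le_rfl (mul_le_mul_of_nonneg_right (le_abs_self _) (hv0 i j))
  have hI : ∫ ω, (∑ i, ∑ j, c i j * h i j ω) ^ 2 ∂P
      = ∑ i, ∑ j, ∑ k, ∑ l, c i j * c k l * ∫ ω, h i j ω * h k l ω ∂P := by
    simp only [hexp]
    rw [integral_finsetSum _ fun i _ => integrable_finsetSum _ fun j _ =>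
      integrable_finsetSum _ fun k _ => integrable_finsetSum _ fun l _ => hint i j k l]
    refine Finset.sum_congr rfl fun i _ => ?_
    rw [integral_finsetSum _ fun j _ =>
      integrable_finsetSum _ fun k _ => integrable_finsetSum _ fun l _ => hint i j k l]
    refine Finset.sum_congr rfl fun j _ => ?_
    rw [integral_finsetSum _ fun k _ => integrable_finsetSum _ fun l _ => hint i j k l]
    refine Finset.sum_congr rfl fun k _ => ?_
    rw [integral_finsetSum _ fun l _ => hint i j k l]
    exact Finset.sum_congr rfl fun l _ => integral_const_mul _ _
  rw [hI]
  calc ∑ i, ∑ j, ∑ k, ∑ l, c i j * c k l * ∫ ω, h i j ω * h k l ω ∂P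
      ≤ ∑ i, ∑ j, (c i j ^ 2 + |c i j * c j i|) * v i j :=
        Finset.sum_le_sum fun i _ => Finset.sum_le_sum fun j _ => hterm i j
    _ ≤ ∑ i, ∑ j, (3 / 2 * (c i j ^ 2 * v i j) + 1 / 2 * (c j i ^ 2 * v j i)) := by
        refine Finset.sum_le_sum fun i _ => Finset.sum_le_sum fun j _ => ?_
        have : |c i j * c j i| ≤ (c i j ^ 2 + c j i ^ 2) / 2 := by
          rw [abs_mul]
          nlinarith [sq_nonneg (|c i j| - |c j i|), sq_abs (c i j), sq_abs (c j i)]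
        rw [hvs j i]
        nlinarith [mul_le_mul_of_nonneg_right this (hv0 i j)]
    _ = 2 * ∑ i, ∑ j, c i j ^ 2 * v i j := by
        simp only [Finset.sum_add_distrib, ← Finset.mul_sum]
        rw [Finset.sum_comm (f := fun i j => c j i ^ 2 * v j i)]
        ring

/-- Off-diagonal entries in a row of the square of the array are uncorrelated. -/
lemma integral_sq_entry_mul (hw : IsWignerArray P h) {i k l : Fin n} (hk : k ≠ i) (hl : l ≠ i) :
    ∫ ω, (∑ j, h i j ω * h j k ω) * (∑ j, h i j ω * h j l ω) ∂P
      = if k = l then ∑ j, (∫ ω, h i j ω ^ 2 ∂P) * ∫ ω, h j k ω ^ 2 ∂P else 0 := by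
  have hterm : ∀ j j', ∫ ω, h i j ω * h j k ω * (h i j' ω * h j' l ω) ∂P
      = if j = j' then if k = l then (∫ ω, h i j ω ^ 2 ∂P) * ∫ ω, h j k ω ^ 2 ∂P else 0 else 0 := by
    intro j j'
    by_cases hji : j = i
    · subst hji; simp [hw.hollow]
    by_cases hji' : j' = i
    · subst hji'; simp [hw.hollow, hji]
    by_cases hjk : j = k
    · subst hjk; simp [hw.hollow]
    by_cases hjj : j = j'
    · subst hjj
      by_cases hkl : k = l
      · subst hkl
        simp only [if_true]
        refine hw.integral_sq_mul_sq ?_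
        rw [Ne, Sym2.eq_iff]; tauto
      -- With `j = j'` and `k ≠ l` the lone edge is `{j, k}`; in the remaining case `j ≠ j'` it is
      -- `{i, j}`. Both need `k` and `l` to differ from `i`.
      · rw [if_pos rfl, if_neg hkl, ← hw.integral_mul_eq_zero (i := j) (j := k) (k := i) (l := j)
          (p := i) (q := j) (r := j) (t := l)]
        · exact integral_congr_ae (.of_forall fun ω => by ring)
        · rw [Ne, Sym2.eq_iff]; tauto
        · rw [Ne, Sym2.eq_iff]; tauto
        · rw [Ne, Sym2.eq_iff]
          rintro (⟨-, h⟩ | ⟨h, -⟩)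
          · exact hkl h.symm
          · exact hjk h
    · rw [if_neg hjj]
      refine hw.integral_mul_eq_zero ?_ ?_ ?_
      · rw [Ne, Sym2.eq_iff]; tauto
      · rw [Ne, Sym2.eq_iff]
        rintro (⟨-, h⟩ | ⟨h, -⟩)
        · exact hjj h.symm
        · exact hji h.symm
      · rw [Ne, Sym2.eq_iff]; tauto
  simp only [Finset.sum_mul_sum]
  rw [integral_finsetSum _ fun j _ => integrable_finsetSum _ fun j' _ =>
    integrable_mul_four (hw.memLp _ _) (hw.memLp _ _) (hw.memLp _ _) (hw.memLp _ _)]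
  have : ∀ j, ∫ ω, ∑ j', h i j ω * h j k ω * (h i j' ω * h j' l ω) ∂P
      = if k = l then (∫ ω, h i j ω ^ 2 ∂P) * ∫ ω, h j k ω ^ 2 ∂P else 0 := by
    intro j
    rw [integral_finsetSum _ fun j' _ =>
      integrable_mul_four (hw.memLp _ _) (hw.memLp _ _) (hw.memLp _ _) (hw.memLp _ _)]
    simp [hterm]
  simp only [this]
  split_ifs <;> simp

lemma memLp_two_sq_entry (hw : IsWignerArray P h) (i k : Fin n) :
    MemLp (fun ω => ∑ j, h i j ω * h j k ω) 2 P :=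
  memLp_finsetSum _ fun j _ => memLp_two_mul (hw.memLp i j) (hw.memLp j k)

/-- Second moment of a linear form in the off-diagonal part of a row of the squared array. -/
lemma integral_sum_sq_entry_sq (hw : IsWignerArray P h) (i : Fin n) (a : Fin n → ℝ)
    (ha : a i = 0) :
    ∫ ω, (∑ k, (∑ j, h i j ω * h j k ω) * a k) ^ 2 ∂P
      = ∑ k, ∑ j, a k ^ 2 * ((∫ ω, h i j ω ^ 2 ∂P) * ∫ ω, h j k ω ^ 2 ∂P) := by
  have hexp : ∀ ω, (∑ k, (∑ j, h i j ω * h j k ω) * a k) ^ 2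
      = ∑ k, ∑ l, a k * a l * ((∑ j, h i j ω * h j k ω) * ∑ j, h i j ω * h j l ω) := by
    intro ω
    rw [sq, Finset.sum_mul_sum]
    exact Finset.sum_congr rfl fun k _ => Finset.sum_congr rfl fun l _ => by ring
  have hint : ∀ k l, Integrable
      (fun ω => a k * a l * ((∑ j, h i j ω * h j k ω) * ∑ j, h i j ω * h j l ω)) P :=
    fun k l => ((hw.memLp_two_sq_entry i k).integrable_mul (hw.memLp_two_sq_entry i l)).const_mul _
  simp only [hexp]
  rw [integral_finsetSum _ fun k _ => integrable_finsetSum _ fun l _ => hint k l]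
  refine Finset.sum_congr rfl fun k _ => ?_
  rw [integral_finsetSum _ fun l _ => hint k l]
  simp only [integral_const_mul]
  by_cases hk : k = i
  · subst hk; simp [ha]
  rw [← Finset.mul_sum, Finset.sum_eq_single k]
  · rw [hw.integral_sq_entry_mul hk hk, if_pos rfl]
    ring
  · intro l _ hl
    by_cases hli : l = i
    · subst hli; simp [ha]
    · rw [hw.integral_sq_entry_mul hk hli, if_neg (Ne.symm hl), mul_zero]
  · simp

lemma integral_sq_entry_sq (hw : IsWignerArray P h) {i k : Fin n} (hk : k ≠ i) :
    ∫ ω, (∑ j, h i j ω * h j k ω) ^ 2 ∂P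
      = ∑ j, (∫ ω, h i j ω ^ 2 ∂P) * ∫ ω, h j k ω ^ 2 ∂P := by
  have := hw.integral_sq_entry_mul hk hk
  rw [if_pos rfl] at this
  simpa only [sq] using this

/-- A diagonal entry of the squared array is a sum of squares and is not centered, so Cauchy–Schwarz
with fourth moments is used in place of cancellation. -/
lemma integral_sq_diag_sq_le (hw : IsWignerArray P h) (i : Fin n) :
    ∫ ω, (∑ j, h i j ω * h j i ω) ^ 2 ∂P ≤ n * ∑ j, ∫ ω, h i j ω ^ 4 ∂P := by
  have hint : ∀ j, Integrable (fun ω => h i j ω ^ 4) P := fun j => by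
    have := integrable_mul_four (hw.memLp i j) (hw.memLp i j) (hw.memLp i j) (hw.memLp i j)
    exact this.congr (.of_forall fun ω => by ring)
  rw [← integral_finsetSum _ fun j _ => hint j, ← integral_const_mul]
  refine integral_mono (hw.memLp_two_sq_entry i i).integrable_sq
    ((integrable_finsetSum _ fun j _ => hint j).const_mul _) fun ω => ?_
  have := sq_sum_le_card_mul_sum_sq (s := Finset.univ) (f := fun j => h i j ω * h j i ω)
  refine this.trans (le_of_eq ?_)
  simp only [Finset.card_univ, Fintype.card_fin]
  congr 1
  refine Finset.sum_congr rfl fun j _ => ?_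
  rw [hw.symm j i]
  ring

end IsWignerArray

end WignerArray

/-! ### Gaussian approximation of characteristic functions. -/

section CharacteristicFunctionEstimate

open Complex in
lemma norm_exp_mul_I_sub_le (x : ℝ) :
    ‖exp (x * I) - (1 + x * I - x ^ 2 / 2)‖ ≤ |x| ^ 3 := by
  have e : (1 + x * I - x ^ 2 / 2 : ℂ) = ∑ m ∈ Finset.range 3, (x * I) ^ m / m.factorial := by
    simp [Finset.sum_range_succ, Nat.factorial, mul_pow]
    ring
  have hn : ‖(x * I : ℂ)‖ = |x| := by simp
  rcases le_or_gt |x| 2 with hx | hx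
  -- The exponential series bound of order three applies up to `|x| = 2`, as it needs `|x| / 4 ≤
  -- 1/2`. Beyond that the trivial bound `2 + |x| + x²/2` is below `|x|³`.
  · rw [e]
    refine (exp_bound' (x := x * I) (n := 3) (by rw [hn]; push_cast; linarith)).trans ?_
    rw [hn]
    have : 0 ≤ |x| ^ 3 := by positivity
    norm_num [Nat.factorial]
    linarith
  · refine (norm_sub_le _ _).trans ?_
    have h1 : ‖exp (x * I)‖ = 1 := norm_exp_ofReal_mul_I x
    have h2 : ‖(1 + x * I - x ^ 2 / 2 : ℂ)‖ ≤ 1 + |x| + |x| ^ 2 / 2 := by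
      refine (norm_sub_le _ _).trans (add_le_add ((norm_add_le _ _).trans ?_) ?_)
      · simp
      · simp
    rw [h1]
    have : 0 ≤ |x| := abs_nonneg x
    nlinarith [mul_pos (sub_pos.2 hx) (sub_pos.2 hx), mul_nonneg this this]

lemma abs_exp_neg_sub_le {y : ℝ} (hy : 0 ≤ y) : |Real.exp (-y) - (1 - y)| ≤ y ^ 2 := by
  rcases le_or_gt y 1 with h | h
  · have := Real.norm_exp_sub_one_sub_id_le (x := -y) (by rwa [norm_neg, Real.norm_of_nonneg hy])
    simp only [Real.norm_eq_abs, abs_neg, sq_abs] at this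
    convert this using 2
    ring
  · have h1 := Real.add_one_le_exp (-y)
    have h2 : Real.exp (-y) ≤ 1 := Real.exp_le_one_iff.2 (by linarith)
    rw [abs_le]
    constructor <;> nlinarith

/-- Exchanging the factors one at a time costs `‖a i - b i‖` each, because the untouched factors
have norm at most one. -/
lemma norm_prod_sub_prod_le {ι : Type*} (s : Finset ι) (a b : ι → ℂ)
    (ha : ∀ i ∈ s, ‖a i‖ ≤ 1) (hb : ∀ i ∈ s, ‖b i‖ ≤ 1) :
    ‖∏ i ∈ s, a i - ∏ i ∈ s, b i‖ ≤ ∑ i ∈ s, ‖a i - b i‖ := by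
  classical
  induction s using Finset.induction_on with
  | empty => simp
  | insert i s hi ih =>
    rw [Finset.prod_insert hi, Finset.prod_insert hi, Finset.sum_insert hi]
    have hs := ih (fun j hj => ha j (Finset.mem_insert_of_mem hj))
      fun j hj => hb j (Finset.mem_insert_of_mem hj)
    have e : a i * ∏ j ∈ s, a j - b i * ∏ j ∈ s, b j
        = (a i - b i) * ∏ j ∈ s, a j + b i * (∏ j ∈ s, a j - ∏ j ∈ s, b j) := by ring
    have h1 : ‖∏ j ∈ s, a j‖ ≤ 1 := by
      rw [norm_prod]
      exact Finset.prod_le_one (fun _ _ => norm_nonneg _)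
        fun j hj => ha j (Finset.mem_insert_of_mem hj)
    rw [e]
    refine (norm_add_le _ _).trans ?_
    rw [norm_mul, norm_mul]
    refine add_le_add (mul_le_of_le_one_right (norm_nonneg _) h1)
      ((mul_le_of_le_one_left (norm_nonneg _) (hb i (Finset.mem_insert_self i s))).trans hs)

variable {Ω : Type*} [MeasurableSpace Ω] {P : Measure Ω} [IsProbabilityMeasure P]

/-- Both exponentials are compared with the quadratic `1 - s² v / 2`: the first by Taylor expansion
with vanishing mean, the second by the expansion of `exp (-y)`. -/
lemma norm_integral_exp_sub_gaussian_le {X : Ω → ℝ} (hX : MemLp X 4 P) (hX0 : ∫ ω, X ω ∂P = 0)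
    (s : ℝ) :
    ‖∫ ω, Complex.exp ((s * X ω : ℝ) * Complex.I) ∂P
        - Complex.exp ((-(s ^ 2 * ∫ ω, X ω ^ 2 ∂P) / 2 : ℝ))‖
      ≤ |s| ^ 3 * ∫ ω, |X ω| ^ 3 ∂P + s ^ 4 * (∫ ω, X ω ^ 2 ∂P) ^ 2 := by
  set v := ∫ ω, X ω ^ 2 ∂P with hv
  have hv0 : 0 ≤ v := integral_nonneg fun ω => sq_nonneg _
  have hX1 : Integrable X P := hX.integrable (by norm_num)
  have hX2 : Integrable (fun ω => X ω ^ 2) P :=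
    (hX.mono_exponent (by norm_num : (2 : ENNReal) ≤ 4)).integrable_sq
  have hX3 : Integrable (fun ω => |X ω| ^ 3) P :=
    (hX.mono_exponent (by norm_num : ((3 : ℕ) : ENNReal) ≤ 4)).integrable_norm_pow (by norm_num)
  have hexp : Integrable (fun ω => Complex.exp ((s * X ω : ℝ) * Complex.I)) P := by
    refine Integrable.of_bound (C := 1) ?_ (.of_forall fun ω => ?_)
    · have := hX.aestronglyMeasurable
      have h2 : Continuous fun x : ℝ => Complex.exp ((s * x : ℝ) * Complex.I) := by fun_prop
      exact h2.comp_aestronglyMeasurable this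
    · rw [Complex.norm_exp_ofReal_mul_I]
  have hpoly : Integrable (fun ω => (1 + (s * X ω : ℝ) * Complex.I - ((s * X ω : ℝ) : ℂ) ^ 2 / 2)) P := by
    have a1 : Integrable (fun ω => ((s * X ω : ℝ) : ℂ) * Complex.I) P :=
      ((hX1.const_mul s).ofReal).mul_const _
    have a2 : Integrable (fun ω => ((s * X ω : ℝ) : ℂ) ^ 2 / 2) P := by
      have := ((hX2.const_mul (s ^ 2)).ofReal (𝕜 := ℂ)).div_const 2
      refine this.congr (.of_forall fun ω => ?_)
      simp [mul_pow]
    exact ((integrable_const _).add a1).sub a2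
  have hpi : ∫ ω, (1 + (s * X ω : ℝ) * Complex.I - ((s * X ω : ℝ) : ℂ) ^ 2 / 2) ∂P
      = ((1 - s ^ 2 * v / 2 : ℝ) : ℂ) := by
    have a1 : Integrable (fun ω => ((s * X ω : ℝ) : ℂ) * Complex.I) P :=
      ((hX1.const_mul s).ofReal).mul_const _
    have a2 : Integrable (fun ω => ((s ^ 2 * X ω ^ 2 / 2 : ℝ) : ℂ)) P :=
      ((hX2.const_mul (s ^ 2)).div_const 2).ofReal
    have e : ∀ ω, (1 + (s * X ω : ℝ) * Complex.I - ((s * X ω : ℝ) : ℂ) ^ 2 / 2)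
        = (1 + (s * X ω : ℝ) * Complex.I) - ((s ^ 2 * X ω ^ 2 / 2 : ℝ) : ℂ) := by
      intro ω; push_cast; ring
    simp only [e]
    rw [integral_sub (by exact (integrable_const _).add a1) a2,
      integral_add (integrable_const _) a1, integral_mul_const, integral_complex_ofReal,
      integral_complex_ofReal, integral_const_mul, hX0, integral_div, integral_const_mul, ← hv]
    simp
  have h1 : ‖∫ ω, Complex.exp ((s * X ω : ℝ) * Complex.I) ∂P - ((1 - s ^ 2 * v / 2 : ℝ) : ℂ)‖
      ≤ |s| ^ 3 * ∫ ω, |X ω| ^ 3 ∂P := by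
    rw [← hpi, ← integral_sub hexp hpoly, ← integral_const_mul]
    refine norm_integral_le_of_norm_le (hX3.const_mul _) (.of_forall fun ω => ?_)
    refine (norm_exp_mul_I_sub_le _).trans (le_of_eq ?_)
    rw [abs_mul, mul_pow]
  have h2 : ‖((1 - s ^ 2 * v / 2 : ℝ) : ℂ) - Complex.exp ((-(s ^ 2 * v) / 2 : ℝ))‖
      ≤ s ^ 4 * v ^ 2 := by
    have := abs_exp_neg_sub_le (y := s ^ 2 * v / 2) (by positivity)
    rw [← Complex.ofReal_exp, ← Complex.ofReal_sub, Complex.norm_real, Real.norm_eq_abs,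
      abs_sub_comm, neg_div]
    refine this.trans ?_
    have : 0 ≤ s ^ 4 * v ^ 2 := by positivity
    nlinarith
  calc _ ≤ _ := norm_sub_le_norm_sub_add_norm_sub _ ((1 - s ^ 2 * v / 2 : ℝ) : ℂ) _
    _ ≤ _ := add_le_add h1 h2

/-- Independence factorizes the characteristic function, and telescoping the two products adds up
the errors of the single factors. -/
lemma norm_integral_exp_sum_sub_gaussian_le {ι : Type*} [Fintype ι] {X : ι → Ω → ℝ}
    (hind : iIndepFun X P) (hm : ∀ j, Measurable (X j)) (hX : ∀ j, MemLp (X j) 4 P)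
    (hX0 : ∀ j, ∫ ω, X j ω ∂P = 0) (s : ι → ℝ) :
    ‖∫ ω, Complex.exp ((∑ j, s j * X j ω : ℝ) * Complex.I) ∂P
        - Complex.exp ((-(∑ j, s j ^ 2 * ∫ ω, X j ω ^ 2 ∂P) / 2 : ℝ))‖
      ≤ ∑ j, (|s j| ^ 3 * ∫ ω, |X j ω| ^ 3 ∂P + s j ^ 4 * (∫ ω, X j ω ^ 2 ∂P) ^ 2) := by
  have e1 : ∫ ω, Complex.exp ((∑ j, s j * X j ω : ℝ) * Complex.I) ∂P
      = ∏ j, ∫ ω, Complex.exp ((s j * X j ω : ℝ) * Complex.I) ∂P := by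
    rw [← hind.integral_fun_prod_comp (f := fun j x => Complex.exp ((s j * x : ℝ) * Complex.I))
      (fun j => (hm j).aemeasurable)
      (fun j => (Continuous.measurable (by fun_prop)).aestronglyMeasurable)]
    refine integral_congr_ae (.of_forall fun ω => ?_)
    simp only
    rw [← Complex.exp_sum, Complex.ofReal_sum, Finset.sum_mul]
  have e2 : Complex.exp ((-(∑ j, s j ^ 2 * ∫ ω, X j ω ^ 2 ∂P) / 2 : ℝ))
      = ∏ j, Complex.exp ((-(s j ^ 2 * ∫ ω, X j ω ^ 2 ∂P) / 2 : ℝ)) := by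
    rw [← Complex.exp_sum, ← Complex.ofReal_sum, ← Finset.sum_div, Finset.sum_neg_distrib]
  rw [e1, e2]
  refine (norm_prod_sub_prod_le _ _ _ (fun j _ => ?_) fun j _ => ?_).trans
    (Finset.sum_le_sum fun j _ => norm_integral_exp_sub_gaussian_le (hX j) (hX0 j) (s j))
  · refine (norm_integral_le_of_norm_le (integrable_const (1 : ℝ)) (.of_forall fun ω => ?_)).trans ?_
    · rw [Complex.norm_exp_ofReal_mul_I]
    · simp
  · rw [← Complex.ofReal_exp, Complex.norm_real, Real.norm_of_nonneg (Real.exp_nonneg _),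
      Real.exp_le_one_iff]
    have : 0 ≤ s j ^ 2 * ∫ ω, X j ω ^ 2 ∂P :=
      mul_nonneg (sq_nonneg _) (integral_nonneg fun ω => sq_nonneg _)
    linarith

/-- Quantitative central limit theorem for a row of a Wigner array. -/
lemma IsWignerArray.norm_integral_exp_row_sub_gaussian_le {n : ℕ} {h : Fin n → Fin n → Ω → ℝ}
    (hw : IsWignerArray P h) (i : Fin n) (s : Fin n → ℝ) :
    ‖∫ ω, Complex.exp ((∑ j, s j * h i j ω : ℝ) * Complex.I) ∂P
        - Complex.exp ((-(∑ j, s j ^ 2 * ∫ ω, h i j ω ^ 2 ∂P) / 2 : ℝ))‖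
      ≤ ∑ j, (|s j| ^ 3 * ∫ ω, |h i j ω| ^ 3 ∂P + s j ^ 4 * (∫ ω, h i j ω ^ 2 ∂P) ^ 2) := by
  have hsub : ∀ f : Fin n → ℝ, f i = 0 → ∑ j, f j = ∑ j : {j // j ≠ i}, f j := by
    intro f hf
    rw [← Finset.sum_erase Finset.univ hf]
    exact Finset.sum_subtype _ (by simp) f
  -- Distinct `j ≠ i` give distinct edges `{i, j}`, so the entries of one row form an independent
  -- family; the diagonal entry is zero and drops out of all sums.
  choose g hg1 hg2 using fun j : {j // j ≠ i} => hw.exists_edge j.2.symm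
  have hginj : Function.Injective g := by
    intro j j' hjj
    have h1 := (hg1 j).symm.trans ((congrArg (fun e => s(e.1.1, e.1.2)) hjj).trans (hg1 j'))
    rcases Sym2.eq_iff.1 h1 with ⟨-, h⟩ | ⟨h, -⟩
    · exact Subtype.ext h
    · exact absurd h.symm j'.2
  have hind : iIndepFun (fun j : {j // j ≠ i} => h i j) P := by
    have := hw.indep.precomp hginj
    convert this using 2 with j
    exact hg2 j
  have := norm_integral_exp_sum_sub_gaussian_le hind (fun j => hw.meas i j)
    (fun j => hw.memLp i j) (fun j => hw.mean i j) fun j => s j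
  rw [hsub (fun j => s j ^ 2 * ∫ ω, h i j ω ^ 2 ∂P) (by simp [hw.hollow]),
    hsub (fun j => |s j| ^ 3 * ∫ ω, |h i j ω| ^ 3 ∂P + s j ^ 4 * (∫ ω, h i j ω ^ 2 ∂P) ^ 2)
      (by simp [hw.hollow])]
  simpa only [hsub (fun j => s j * h i j _) (by simp [hw.hollow])] using this

end CharacteristicFunctionEstimate

/-! ### Moments from sub-Gaussian tails. -/

section TailMoments

lemma memLp_natCast_of_integrable_norm_pow {Ω : Type*} [MeasurableSpace Ω] {P : Measure Ω}
    {f : Ω → ℝ} (hf : AEStronglyMeasurable f P) {p : ℕ} (hp : p ≠ 0)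
    (h : Integrable (fun ω => ‖f ω‖ ^ p) P) : MemLp f p P := by
  refine (integrable_norm_rpow_iff hf (by exact_mod_cast hp) (by simp)).1 ?_
  simpa using h

/-- A bound for the `p`-th absolute moment of a variable with sub-Gaussian tails. -/
noncomputable def subGaussianMoment (K : ℝ) (p : ℕ) : ℝ :=
  p * ∫ t in Set.Ioi (0 : ℝ), 2 * (t ^ ((p : ℝ) - 1) * Real.exp (-(K ^ 2)⁻¹ * t ^ 2))

variable {Ω : Type*} [MeasurableSpace Ω] {P : Measure Ω} [IsProbabilityMeasure P]

lemma subGaussianMoment_nonneg (K : ℝ) (p : ℕ) : 0 ≤ subGaussianMoment K p :=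
  mul_nonneg (Nat.cast_nonneg p) (setIntegral_nonneg measurableSet_Ioi fun t ht =>
    mul_nonneg zero_le_two (mul_nonneg (Real.rpow_nonneg (le_of_lt ht) _) (Real.exp_nonneg _)))

/-- The layer cake formula with the tail bound inserted. Working with `lintegral` first yields
integrability and the bound at once. -/
lemma lintegral_abs_pow_le_subGaussianMoment {Y : Ω → ℝ} {K : ℝ} (hY : Measurable Y)
    (hK : HasSubGaussianTail P Y K) {p : ℕ} (hp : p ≠ 0) :
    ∫⁻ ω, ENNReal.ofReal (|Y ω| ^ p) ∂P ≤ ENNReal.ofReal (subGaussianMoment K p) := by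
  have hp0 : (0 : ℝ) < p := by positivity
  have h := lintegral_rpow_eq_lintegral_meas_lt_mul P (f := fun ω => |Y ω|)
    (.of_forall fun ω => abs_nonneg _) hY.abs.aemeasurable hp0
  simp only [Real.rpow_natCast] at h
  have hint : IntegrableOn
      (fun t : ℝ => 2 * (t ^ ((p : ℝ) - 1) * Real.exp (-(K ^ 2)⁻¹ * t ^ 2))) (Set.Ioi 0) :=
    ((integrable_rpow_mul_exp_neg_mul_sq (inv_pos.2 (pow_pos hK.1 2))
      (by linarith)).const_mul 2).integrableOn
  rw [h, subGaussianMoment, ENNReal.ofReal_mul hp0.le, ofReal_integral_eq_lintegral_ofReal hint]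
  · refine mul_le_mul_right (setLIntegral_mono_ae' measurableSet_Ioi (.of_forall fun t ht => ?_)) _
    have ht0 : (0 : ℝ) < t := ht
    have h1 := hK.2 t ht0.le
    have h2 : P {ω | t < |Y ω|} ≤ ENNReal.ofReal (2 * Real.exp (-t ^ 2 / K ^ 2)) := by
      rw [ENNReal.le_ofReal_iff_toReal_le (measure_ne_top _ _) (by positivity)]
      exact h1
    refine (mul_le_mul_left h2 _).trans ?_
    rw [← ENNReal.ofReal_mul (by positivity)]
    refine ENNReal.ofReal_le_ofReal (le_of_eq ?_)
    rw [show -t ^ 2 / K ^ 2 = -(K ^ 2)⁻¹ * t ^ 2 by ring]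
    ring
  · refine (ae_restrict_iff' measurableSet_Ioi).2 (.of_forall fun t ht => ?_)
    exact mul_nonneg zero_le_two (mul_nonneg (Real.rpow_nonneg (le_of_lt ht) _) (Real.exp_nonneg _))

lemma integrable_abs_pow_of_hasSubGaussianTail {Y : Ω → ℝ} {K : ℝ} (hY : Measurable Y)
    (hK : HasSubGaussianTail P Y K) (p : ℕ) : Integrable (fun ω => |Y ω| ^ p) P := by
  by_cases hp : p = 0
  · subst hp; simp
  refine ⟨(hY.abs.pow_const p).aestronglyMeasurable, ?_⟩
  rw [hasFiniteIntegral_iff_ofReal (.of_forall fun ω => by positivity)]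
  exact (lintegral_abs_pow_le_subGaussianMoment hY hK hp).trans_lt ENNReal.ofReal_lt_top

lemma memLp_of_hasSubGaussianTail {Y : Ω → ℝ} {K : ℝ} (hY : Measurable Y)
    (hK : HasSubGaussianTail P Y K) (p : ℕ) : MemLp Y p P := by
  by_cases hp : p = 0
  · subst hp; simpa using hY.aestronglyMeasurable
  · exact memLp_natCast_of_integrable_norm_pow hY.aestronglyMeasurable hp
      (integrable_abs_pow_of_hasSubGaussianTail hY hK p)

lemma integral_abs_pow_le_subGaussianMoment {Y : Ω → ℝ} {K : ℝ} (hY : Measurable Y)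
    (hK : HasSubGaussianTail P Y K) {p : ℕ} (hp : p ≠ 0) :
    ∫ ω, |Y ω| ^ p ∂P ≤ subGaussianMoment K p := by
  rw [integral_eq_lintegral_of_nonneg_ae (.of_forall fun ω => by positivity)
    (hY.abs.pow_const p).aestronglyMeasurable]
  exact ENNReal.toReal_le_of_le_ofReal (subGaussianMoment_nonneg K p)
    (lintegral_abs_pow_le_subGaussianMoment hY hK hp)

lemma integrable_pow_of_hasSubGaussianTail {Y : Ω → ℝ} {K : ℝ} (hY : Measurable Y)
    (hK : HasSubGaussianTail P Y K) (p : ℕ) : Integrable (fun ω => Y ω ^ p) P :=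
  (integrable_abs_pow_of_hasSubGaussianTail hY hK p).mono'
    (hY.pow_const p).aestronglyMeasurable (.of_forall fun ω => by simp)

end TailMoments

/-! ### Moments of one entry of the effective noise at a fixed distance. -/

section ScalarNoise

variable {Ω : Type*} [MeasurableSpace Ω] {P : Measure Ω} [IsProbabilityMeasure P]

/-- The conditional variance of an entry of the effective noise, given the distance `a`. -/
noncomputable def noiseVariance (σ γ ξ a : ℝ) : ℝ := σ ^ 2 * a ^ 2 + γ * a + ξ / 4 - σ ^ 4 / 4

/-- The fourth moment constant of the effective noise. -/
noncomputable def noiseFourthMoment (σ K : ℝ) : ℝ :=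
  8 * subGaussianMoment K 4 + 4 * subGaussianMoment K 8 + 4 * σ ^ 8

lemma noiseFourthMoment_nonneg (σ K : ℝ) : 0 ≤ noiseFourthMoment σ K := by
  have := subGaussianMoment_nonneg K 4
  have := subGaussianMoment_nonneg K 8
  unfold noiseFourthMoment
  positivity

variable {e : Ω → ℝ} {σ γ ξ K : ℝ}

lemma integral_sq_of_variance_eq (he : Measurable e) (hK : HasSubGaussianTail P e K)
    (h1 : ∫ ω, e ω ∂P = 0) (h2 : variance e P = σ ^ 2) : ∫ ω, e ω ^ 2 ∂P = σ ^ 2 := by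
  have hL : MemLp e 2 P := by exact_mod_cast memLp_of_hasSubGaussianTail he hK 2
  rw [variance_eq_sub hL, h1] at h2
  simpa using h2

lemma integral_noise (he : Measurable e) (hK : HasSubGaussianTail P e K)
    (h1 : ∫ ω, e ω ∂P = 0) (h2 : variance e P = σ ^ 2) (a : ℝ) :
    ∫ ω, (a * e ω + (e ω ^ 2 - σ ^ 2) / 2) ∂P = 0 := by
  have i1 : Integrable e P := by simpa using integrable_pow_of_hasSubGaussianTail he hK 1
  have i2 := integrable_pow_of_hasSubGaussianTail he hK 2
  rw [integral_add (i1.const_mul a) (by fun_prop), integral_const_mul, integral_div,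
    integral_sub i2 (integrable_const _), h1, integral_sq_of_variance_eq he hK h1 h2]
  simp

lemma integral_noise_sq (he : Measurable e) (hK : HasSubGaussianTail P e K)
    (h1 : ∫ ω, e ω ∂P = 0) (h2 : variance e P = σ ^ 2) (h3 : ∫ ω, e ω ^ 3 ∂P = γ)
    (h4 : ∫ ω, e ω ^ 4 ∂P = ξ) (a : ℝ) :
    ∫ ω, (a * e ω + (e ω ^ 2 - σ ^ 2) / 2) ^ 2 ∂P = noiseVariance σ γ ξ a := by
  have i1 : Integrable e P := by simpa using integrable_pow_of_hasSubGaussianTail he hK 1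
  have i2 := integrable_pow_of_hasSubGaussianTail he hK 2
  have i3 := integrable_pow_of_hasSubGaussianTail he hK 3
  have i4 := integrable_pow_of_hasSubGaussianTail he hK 4
  have hsq := integral_sq_of_variance_eq he hK h1 h2
  -- In this expansion the third moment enters through the cross term `a e (e² - σ²)`, and the part
  -- linear in `e` integrates to zero.
  have e1 : ∀ ω, (a * e ω + (e ω ^ 2 - σ ^ 2) / 2) ^ 2
      = (a ^ 2 - σ ^ 2 / 2) * e ω ^ 2 + a * e ω ^ 3 + 1 / 4 * e ω ^ 4 + (-(a * σ ^ 2)) * e ω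
        + σ ^ 4 / 4 := fun ω => by ring
  simp only [e1]
  rw [integral_add (by fun_prop) (integrable_const _), integral_add (by fun_prop) (by fun_prop),
    integral_add (by fun_prop) (by fun_prop), integral_add (by fun_prop) (by fun_prop)]
  simp only [integral_const_mul, h1, hsq, h3, h4, noiseVariance]
  simp
  ring

lemma noise_pow_four_le (a x : ℝ) : (a * x + (x ^ 2 - σ ^ 2) / 2) ^ 4
    ≤ 8 * a ^ 4 * |x| ^ 4 + 4 * |x| ^ 8 + 4 * σ ^ 8 := by
  have h : ∀ u v : ℝ, (u + v) ^ 4 ≤ 8 * (u ^ 4 + v ^ 4) := by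
    intro u v
    nlinarith [sq_nonneg (u - v), sq_nonneg (u + v), sq_nonneg (u ^ 2 - v ^ 2),
      mul_nonneg (sq_nonneg (u - v)) (sq_nonneg (u + v)), sq_nonneg ((u - v) ^ 2)]
  have h1 := h (a * x) ((x ^ 2 - σ ^ 2) / 2)
  have h2 := h (x ^ 2) (-σ ^ 2)
  have e4 : |x| ^ 4 = x ^ 4 := by rw [show (4 : ℕ) = 2 * 2 by norm_num, pow_mul, sq_abs, pow_mul]
  have e8 : |x| ^ 8 = x ^ 8 := by rw [show (8 : ℕ) = 2 * 4 by norm_num, pow_mul, sq_abs, pow_mul]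
  rw [e4, e8]
  have e5 : ((x ^ 2 - σ ^ 2) / 2) ^ 4 = (x ^ 2 + -σ ^ 2) ^ 4 / 16 := by ring
  rw [e5] at h1
  calc _ ≤ _ := h1
    _ ≤ 8 * ((a * x) ^ 4 + (8 * ((x ^ 2) ^ 4 + (-σ ^ 2) ^ 4)) / 16) := by linarith
    _ = _ := by ring

lemma integrable_noise_pow_four (he : Measurable e) (hK : HasSubGaussianTail P e K) (a : ℝ) :
    Integrable (fun ω => (a * e ω + (e ω ^ 2 - σ ^ 2) / 2) ^ 4) P := by
  have i4 := integrable_abs_pow_of_hasSubGaussianTail he hK 4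
  have i8 := integrable_abs_pow_of_hasSubGaussianTail he hK 8
  refine (((i4.const_mul (8 * a ^ 4)).add (i8.const_mul 4)).add
    (integrable_const (4 * σ ^ 8))).mono' (by fun_prop) (.of_forall fun ω => ?_)
  rw [Real.norm_of_nonneg (by positivity)]
  exact noise_pow_four_le a (e ω)

lemma memLp_noise (he : Measurable e) (hK : HasSubGaussianTail P e K) (a : ℝ) :
    MemLp (fun ω => a * e ω + (e ω ^ 2 - σ ^ 2) / 2) 4 P := by
  have h := memLp_natCast_of_integrable_norm_pow
    (f := fun ω => a * e ω + (e ω ^ 2 - σ ^ 2) / 2) (P := P) (by fun_prop) (p := 4) (by norm_num)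
    ((integrable_noise_pow_four (σ := σ) he hK a).congr (.of_forall fun ω => by
      simp [Even.pow_abs (show Even 4 by decide)]))
  exact_mod_cast h

lemma integral_noise_pow_four_le (he : Measurable e) (hK : HasSubGaussianTail P e K) (a : ℝ) :
    ∫ ω, (a * e ω + (e ω ^ 2 - σ ^ 2) / 2) ^ 4 ∂P ≤ noiseFourthMoment σ K * (1 + a ^ 2) ^ 2 := by
  have i4 := integrable_abs_pow_of_hasSubGaussianTail he hK 4
  have i8 := integrable_abs_pow_of_hasSubGaussianTail he hK 8
  refine (integral_mono (integrable_noise_pow_four he hK a) (((i4.const_mul (8 * a ^ 4)).add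
    (i8.const_mul 4)).add (integrable_const (4 * σ ^ 8))) fun ω => noise_pow_four_le a (e ω)).trans ?_
  simp only [Pi.add_apply]
  rw [integral_add (by fun_prop) (integrable_const _), integral_add (by fun_prop) (by fun_prop)]
  simp only [integral_const_mul, integral_const, probReal_univ, smul_eq_mul, one_mul]
  have b4 := integral_abs_pow_le_subGaussianMoment he hK (p := 4) (by norm_num)
  have b8 := integral_abs_pow_le_subGaussianMoment he hK (p := 8) (by norm_num)
  have m4 := subGaussianMoment_nonneg K 4
  have m8 := subGaussianMoment_nonneg K 8
  have a4 : a ^ 4 ≤ (1 + a ^ 2) ^ 2 := by nlinarith [sq_nonneg a]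
  have a0 : 1 ≤ (1 + a ^ 2) ^ 2 := by nlinarith [sq_nonneg a, sq_nonneg (a ^ 2)]
  have c1 : a ^ 4 * ∫ ω, |e ω| ^ 4 ∂P ≤ (1 + a ^ 2) ^ 2 * subGaussianMoment K 4 :=
    mul_le_mul a4 b4 (integral_nonneg fun ω => by positivity) (by positivity)
  have c2 : subGaussianMoment K 8 ≤ (1 + a ^ 2) ^ 2 * subGaussianMoment K 8 :=
    le_mul_of_one_le_left m8 a0
  have c3 : σ ^ 8 ≤ (1 + a ^ 2) ^ 2 * σ ^ 8 := le_mul_of_one_le_left (by positivity) a0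
  unfold noiseFourthMoment
  linarith

end ScalarNoise

/-! ### The probabilistic model, polynomial weights, and conditioning on the points. -/

section Model

variable {Ω : Type*} [MeasurableSpace Ω]

/-- Points `Z` sampled from `F` together with noise matrices `E` of increasing size. -/
structure IsNoisyDistanceModel {d : ℕ} (P : Measure Ω) (F : Measure (EuclideanSpace ℝ (Fin d)))
    (Z : ℕ → Ω → EuclideanSpace ℝ (Fin d)) (E : (n : ℕ) → Ω → Matrix (Fin n) (Fin n) ℝ)
    (σ γ ξ K : ℝ) : Prop where
  subG : IsSubGaussianLaw F
  Z_meas : ∀ k, Measurable (Z k)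
  Z_law : ∀ k, P.map (Z k) = F
  Z_indep : iIndepFun Z P
  E_meas : ∀ n i j, Measurable fun ω => E n ω i j
  E_symm : ∀ n ω i j, E n ω i j = E n ω j i
  E_hollow : ∀ n ω i, E n ω i i = 0
  E_indep : ∀ n, iIndepFun
    (fun (p : {p : Fin n × Fin n // p.1 < p.2}) ω => E n ω p.1.1 p.1.2) P
  E_indep_Z : ∀ n, IndepFun (fun ω (p : Fin n × Fin n) => E n ω p.1 p.2)
    (fun ω (k : Fin n) => Z k ω) P
  E_subG : ∀ n i j, HasSubGaussianTail P (fun ω => E n ω i j) K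
  E_mean : ∀ n i j, ∫ ω, E n ω i j ∂P = 0
  E_var : ∀ n i j, i ≠ j → variance (fun ω => E n ω i j) P = σ ^ 2
  E_third : ∀ n i j, i ≠ j → ∫ ω, E n ω i j ^ 3 ∂P = γ
  E_fourth : ∀ n i j, i ≠ j → ∫ ω, E n ω i j ^ 4 ∂P = ξ

/-- The weight `1 + ‖z‖²`. -/
noncomputable def weight {d : ℕ} (z : EuclideanSpace ℝ (Fin d)) : ℝ := 1 + ‖z‖ ^ 2

lemma one_le_weight {d : ℕ} (z : EuclideanSpace ℝ (Fin d)) : 1 ≤ weight z := by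
  unfold weight; nlinarith [sq_nonneg ‖z‖]

lemma weight_pos {d : ℕ} (z : EuclideanSpace ℝ (Fin d)) : 0 < weight z :=
  zero_lt_one.trans_le (one_le_weight z)

lemma measurable_weight {d : ℕ} : Measurable (weight (d := d)) := by
  unfold weight; fun_prop

/-- Distances are dominated by products of weights of single points, so conditional moments become
polynomials in weights that can be integrated point by point. -/
lemma one_add_norm_sub_sq_le {d : ℕ} (z w : EuclideanSpace ℝ (Fin d)) :
    1 + ‖z - w‖ ^ 2 ≤ 2 * (weight z * weight w) := by
  have h : ‖z - w‖ ^ 2 ≤ (‖z‖ + ‖w‖) ^ 2 := pow_le_pow_left₀ (norm_nonneg _) (norm_sub_le z w) 2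
  unfold weight
  nlinarith [sq_nonneg (‖z‖ - ‖w‖), mul_nonneg (sq_nonneg ‖z‖) (sq_nonneg ‖w‖)]

/-- Bounding every factor by the largest weight makes repeated indices harmless: no distinction
between equal and different points is needed. Degree six is attained in the Gaussian approximation
`norm_integral_exp_row_sub_le`. -/
lemma weight_mul_le {d : ℕ} (x y z : EuclideanSpace ℝ (Fin d)) {p q r : ℕ} (h : p + q + r ≤ 6) :
    weight x ^ p * weight y ^ q * weight z ^ r ≤ weight x ^ 6 + weight y ^ 6 + weight z ^ 6 := by
  set m := max (weight x) (max (weight y) (weight z)) with hm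
  have hx := weight_pos x
  have hy := weight_pos y
  have hz := weight_pos z
  have hxm : weight x ≤ m := le_max_left _ _
  have hym : weight y ≤ m := (le_max_left _ _).trans (le_max_right _ _)
  have hzm : weight z ≤ m := (le_max_right _ _).trans (le_max_right _ _)
  have hm1 : 1 ≤ m := (one_le_weight x).trans hxm
  calc weight x ^ p * weight y ^ q * weight z ^ r ≤ m ^ p * m ^ q * m ^ r := by gcongr
    _ = m ^ (p + q + r) := by rw [pow_add, pow_add]
    _ ≤ m ^ 6 := pow_le_pow_right₀ hm1 h
    _ ≤ _ := by
      have hx6 : 0 < weight x ^ 6 := by positivity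
      have hy6 : 0 < weight y ^ 6 := by positivity
      have hz6 : 0 < weight z ^ 6 := by positivity
      rcases max_choice (weight x) (max (weight y) (weight z)) with h | h
      · rw [hm, h]; linarith
      · rw [hm, h]
        rcases max_choice (weight y) (weight z) with h | h <;> rw [h] <;> linarith

/-- A constant bounding the conditional moments of the effective noise. -/
noncomputable def noiseBound (σ γ ξ K : ℝ) : ℝ :=
  2 * (σ ^ 2 + |γ| + |ξ|) + 4 * noiseFourthMoment σ K

lemma noiseBound_nonneg (σ γ ξ K : ℝ) : 0 ≤ noiseBound σ γ ξ K := by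
  have := noiseFourthMoment_nonneg σ K
  unfold noiseBound
  positivity

namespace IsNoisyDistanceModel

variable {d : ℕ} {P : Measure Ω} [IsProbabilityMeasure P]
  {F : Measure (EuclideanSpace ℝ (Fin d))}
  {Z : ℕ → Ω → EuclideanSpace ℝ (Fin d)} {E : (n : ℕ) → Ω → Matrix (Fin n) (Fin n) ℝ}
  {σ γ ξ K : ℝ}

lemma isProbabilityMeasure (hM : IsNoisyDistanceModel P F Z E σ γ ξ K) :
    IsProbabilityMeasure F := by
  rw [← hM.Z_law 0]
  exact Measure.isProbabilityMeasure_map (hM.Z_meas 0).aemeasurable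

/-- With the points frozen, each entry of the effective noise is a function of the single entry of
`E` in that position, so independence is inherited. -/
lemma isWignerArray (hM : IsNoisyDistanceModel P F Z E σ γ ξ K) {n : ℕ}
    (z : Fin n → EuclideanSpace ℝ (Fin d)) :
    IsWignerArray P fun i j ω => effectiveNoise (distMatrix z) (E n ω) σ i j where
  symm i j := by
    funext ω
    simp only [effectiveNoise, distMatrix, Matrix.of_apply, norm_sub_rev (z i), hM.E_symm n ω i j,
      eq_comm (a := i)]
  hollow i ω := by simp [effectiveNoise]
  indep := by
    have := (hM.E_indep n).comp
      (fun p x => ‖z p.1.1 - z p.1.2‖ * x + (x ^ 2 - σ ^ 2) / 2) (fun p => by fun_prop)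
    convert this using 2 with p
    funext ω
    simp [effectiveNoise, distMatrix, p.2.ne]
  meas i j := by
    have := hM.E_meas n i j
    simp only [effectiveNoise, Matrix.of_apply]
    split_ifs
    · exact measurable_const
    · fun_prop
  memLp i j := by
    simp only [effectiveNoise, Matrix.of_apply]
    split_ifs
    · exact MemLp.zero
    · exact memLp_noise (hM.E_meas n i j) (hM.E_subG n i j) _
  mean i j := by
    simp only [effectiveNoise, Matrix.of_apply]
    split_ifs with h
    · simp
    · exact integral_noise (hM.E_meas n i j) (hM.E_subG n i j) (hM.E_mean n i j) (hM.E_var n i j h) _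

lemma integral_effectiveNoise_sq (hM : IsNoisyDistanceModel P F Z E σ γ ξ K) {n : ℕ}
    (z : Fin n → EuclideanSpace ℝ (Fin d)) {i j : Fin n} (hij : i ≠ j) :
    ∫ ω, effectiveNoise (distMatrix z) (E n ω) σ i j ^ 2 ∂P
      = noiseVariance σ γ ξ ‖z i - z j‖ := by
  simp only [effectiveNoise, Matrix.of_apply, if_neg hij]
  exact integral_noise_sq (hM.E_meas n i j) (hM.E_subG n i j) (hM.E_mean n i j)
    (hM.E_var n i j hij) (hM.E_third n i j hij) (hM.E_fourth n i j hij) _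

/-- For every `a` the formula is a true second moment, realized with the entry `(0, 1)` of the `2 ×
2` noise matrix. From it comes the positive semidefiniteness of `Σ(z)`. -/
lemma noiseVariance_nonneg (hM : IsNoisyDistanceModel P F Z E σ γ ξ K) (a : ℝ) :
    0 ≤ noiseVariance σ γ ξ a := by
  have h01 : (0 : Fin 2) ≠ 1 := by decide
  rw [← integral_noise_sq (hM.E_meas 2 0 1) (hM.E_subG 2 0 1) (hM.E_mean 2 0 1)
    (hM.E_var 2 0 1 h01) (hM.E_third 2 0 1 h01) (hM.E_fourth 2 0 1 h01) a]
  exact integral_nonneg fun ω => sq_nonneg _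

end IsNoisyDistanceModel

lemma noiseVariance_le {d : ℕ} (σ γ ξ K : ℝ) (z w : EuclideanSpace ℝ (Fin d)) :
    noiseVariance σ γ ξ ‖z - w‖ ≤ noiseBound σ γ ξ K * (weight z * weight w) := by
  have h1 := one_add_norm_sub_sq_le z w
  have h2 := noiseFourthMoment_nonneg σ K
  have h3 := mul_nonneg (weight_pos z).le (weight_pos w).le
  have h4 : ‖z - w‖ ≤ 1 + ‖z - w‖ ^ 2 := by nlinarith [sq_nonneg (‖z - w‖ - 1)]
  have h5 : γ * ‖z - w‖ ≤ |γ| * (1 + ‖z - w‖ ^ 2) :=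
    mul_le_mul (le_abs_self γ) h4 (norm_nonneg _) (abs_nonneg _)
  have h6 : ξ / 4 ≤ |ξ| * (1 + ‖z - w‖ ^ 2) := by
    nlinarith [le_abs_self ξ, abs_nonneg ξ, mul_nonneg (abs_nonneg ξ) (sq_nonneg ‖z - w‖)]
  have h7 : 0 ≤ σ ^ 4 := by positivity
  unfold noiseVariance noiseBound
  calc σ ^ 2 * ‖z - w‖ ^ 2 + γ * ‖z - w‖ + ξ / 4 - σ ^ 4 / 4
      ≤ (σ ^ 2 + |γ| + |ξ|) * (1 + ‖z - w‖ ^ 2) := by nlinarith [sq_nonneg σ]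
    _ ≤ (σ ^ 2 + |γ| + |ξ|) * (2 * (weight z * weight w)) :=
        mul_le_mul_of_nonneg_left h1 (by positivity)
    _ ≤ _ := by nlinarith [mul_nonneg h2 h3]

namespace IsNoisyDistanceModel

variable {d : ℕ} {P : Measure Ω} [IsProbabilityMeasure P]
  {F : Measure (EuclideanSpace ℝ (Fin d))}
  {Z : ℕ → Ω → EuclideanSpace ℝ (Fin d)} {E : (n : ℕ) → Ω → Matrix (Fin n) (Fin n) ℝ}
  {σ γ ξ K : ℝ}

lemma integral_effectiveNoise_sq_le (hM : IsNoisyDistanceModel P F Z E σ γ ξ K) {n : ℕ}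
    (z : Fin n → EuclideanSpace ℝ (Fin d)) (i j : Fin n) :
    ∫ ω, effectiveNoise (distMatrix z) (E n ω) σ i j ^ 2 ∂P
      ≤ noiseBound σ γ ξ K * (weight (z i) * weight (z j)) := by
  by_cases hij : i = j
  · have := mul_nonneg (noiseBound_nonneg σ γ ξ K)
      (mul_nonneg (weight_pos (z i)).le (weight_pos (z j)).le)
    simpa [effectiveNoise, hij] using this
  · rw [hM.integral_effectiveNoise_sq z hij]
    exact noiseVariance_le _ _ _ _ _ _

lemma integral_effectiveNoise_pow_four_le (hM : IsNoisyDistanceModel P F Z E σ γ ξ K) {n : ℕ}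
    (z : Fin n → EuclideanSpace ℝ (Fin d)) (i j : Fin n) :
    ∫ ω, effectiveNoise (distMatrix z) (E n ω) σ i j ^ 4 ∂P
      ≤ noiseBound σ γ ξ K * (weight (z i) ^ 2 * weight (z j) ^ 2) := by
  by_cases hij : i = j
  · have := mul_nonneg (noiseBound_nonneg σ γ ξ K)
      (mul_nonneg (sq_nonneg (weight (z i))) (sq_nonneg (weight (z j))))
    simpa [effectiveNoise, hij] using this
  · simp only [effectiveNoise, Matrix.of_apply, if_neg hij]
    refine (integral_noise_pow_four_le (hM.E_meas n i j) (hM.E_subG n i j) _).trans ?_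
    have h0 := noiseFourthMoment_nonneg σ K
    have h1 : (1 + ‖z i - z j‖ ^ 2) ^ 2 ≤ (2 * (weight (z i) * weight (z j))) ^ 2 :=
      pow_le_pow_left₀ (by positivity) (one_add_norm_sub_sq_le _ _) 2
    have h2 := mul_le_mul_of_nonneg_left h1 h0
    have h3 : 0 ≤ (σ ^ 2 + |γ| + |ξ|) * (weight (z i) ^ 2 * weight (z j) ^ 2) := by positivity
    simp only [distMatrix, Matrix.of_apply]
    unfold noiseBound
    nlinarith

/-- Integrating the noise out first. -/
lemma lintegral_noise_config (hM : IsNoisyDistanceModel P F Z E σ γ ξ K) {n : ℕ}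
    {f : (Fin n × Fin n → ℝ) × (Fin n → EuclideanSpace ℝ (Fin d)) → ENNReal} (hf : Measurable f) :
    ∫⁻ ω, f (fun p => E n ω p.1 p.2, fun k => Z k ω) ∂P
      = ∫⁻ ω', ∫⁻ ω, f (fun p => E n ω p.1 p.2, fun k => Z k ω') ∂P ∂P := by
  have hE : Measurable fun ω (p : Fin n × Fin n) => E n ω p.1 p.2 :=
    measurable_pi_lambda _ fun p => hM.E_meas n _ _
  have hZ : Measurable fun ω (k : Fin n) => Z k ω := measurable_pi_lambda _ fun k => hM.Z_meas k
  have hmap := (indepFun_iff_map_prod_eq_prod_map_map hE.aemeasurable hZ.aemeasurable).1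
    (hM.E_indep_Z n)
  have h1 : ∫⁻ ω, f (fun p => E n ω p.1 p.2, fun k => Z k ω) ∂P
      = ∫⁻ x, f x ∂(P.map fun ω => ((fun p : Fin n × Fin n => E n ω p.1 p.2),
          (fun k : Fin n => Z k ω))) := by
    rw [lintegral_map hf (hE.prodMk hZ)]
  have : IsProbabilityMeasure (P.map fun ω (p : Fin n × Fin n) => E n ω p.1 p.2) :=
    Measure.isProbabilityMeasure_map hE.aemeasurable
  have : IsProbabilityMeasure (P.map fun ω (k : Fin n) => Z k ω) :=
    Measure.isProbabilityMeasure_map hZ.aemeasurable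
  rw [h1, hmap, lintegral_prod_symm _ hf.aemeasurable, lintegral_map hf.lintegral_prod_left' hZ]
  refine lintegral_congr fun ω' => ?_
  rw [lintegral_map (by fun_prop) hE]

end IsNoisyDistanceModel

end Model

/-! ### Unconditional second moments of forms in the noise. -/

section NoiseMoments

open scoped Matrix.Norms.Frobenius

variable {Ω : Type*} [MeasurableSpace Ω]

lemma measurable_effectiveNoise {d n : ℕ} (σ : ℝ) (i j : Fin n) :
    Measurable fun p : (Fin n × Fin n → ℝ) × (Fin n → EuclideanSpace ℝ (Fin d)) =>
      effectiveNoise (distMatrix p.2) (Matrix.of fun i j => p.1 (i, j)) σ i j := by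
  simp only [effectiveNoise, distMatrix, Matrix.of_apply]
  split_ifs
  · exact measurable_const
  · fun_prop

namespace IsNoisyDistanceModel

variable {d : ℕ} {P : Measure Ω} [IsProbabilityMeasure P]
  {F : Measure (EuclideanSpace ℝ (Fin d))}
  {Z : ℕ → Ω → EuclideanSpace ℝ (Fin d)} {E : (n : ℕ) → Ω → Matrix (Fin n) (Fin n) ℝ}
  {σ γ ξ K : ℝ}

lemma integrable_norm_coord_pow (hM : IsNoisyDistanceModel P F Z E σ γ ξ K) (k : Fin d) (p : ℕ) :
    MemLp (fun z : EuclideanSpace ℝ (Fin d) => z k) p F := by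
  have := hM.isProbabilityMeasure
  obtain ⟨L, hL⟩ := hM.subG (EuclideanSpace.single k 1)
  have h : (fun z : EuclideanSpace ℝ (Fin d) => inner ℝ z (EuclideanSpace.single k (1 : ℝ)))
      = fun z => z k := by
    funext z; simp [EuclideanSpace.inner_single_right]
  rw [h] at hL
  exact memLp_of_hasSubGaussianTail (by fun_prop) hL p

lemma integrable_weight_pow (hM : IsNoisyDistanceModel P F Z E σ γ ξ K) :
    Integrable (fun z : EuclideanSpace ℝ (Fin d) => weight z ^ 6) F := by
  have := hM.isProbabilityMeasure
  have h1 : ∀ k : Fin d, MemLp (fun z : EuclideanSpace ℝ (Fin d) => z k ^ 2) 6 F := by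
    intro k
    have := (hM.integrable_norm_coord_pow k 12)
    -- The sixth power of the weight needs twelfth moments of the coordinates.
    have h := this.norm_rpow_div (2 : ENNReal)
    have e : ((12 : ℕ) : ENNReal) / 2 = 6 := by
      refine (ENNReal.eq_div_iff (by norm_num) (by norm_num)).2 ?_ |>.symm
      norm_num
    rw [e] at h
    simpa [sq_abs] using h
  have h2 : MemLp (fun z : EuclideanSpace ℝ (Fin d) => weight z) 6 F := by
    have : (fun z : EuclideanSpace ℝ (Fin d) => weight z) = fun z => 1 + ∑ k, z k ^ 2 := by
      funext z; simp [weight, EuclideanSpace.norm_sq_eq]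
    rw [this]
    have h4 : MemLp (fun z : EuclideanSpace ℝ (Fin d) => ∑ k, z k ^ 2) 6 F :=
      memLp_finsetSum (Finset.univ : Finset (Fin d)) fun k _ => h1 k
    exact (memLp_const (1 : ℝ)).add h4
  have h3 := h2.integrable_norm_pow (p := 6) (by norm_num)
  refine h3.congr (.of_forall fun z => ?_)
  simp [abs_of_pos (weight_pos z)]

/-- Second moments, given a bound for the conditional second moments given the points. -/
lemma lintegral_sq_le (hM : IsNoisyDistanceModel P F Z E σ γ ξ K) {n : ℕ}
    {φ : Matrix (Fin n) (Fin n) ℝ → (Fin n → EuclideanSpace ℝ (Fin d)) → ℝ}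
    (hφ : Measurable fun p : (Fin n × Fin n → ℝ) × (Fin n → EuclideanSpace ℝ (Fin d)) =>
      φ (Matrix.of fun i j => p.1 (i, j)) p.2)
    {ι : Type*} [Fintype ι] {p q r : ι → Fin n} {C : ℝ} (hC : 0 ≤ C)
    (hint : ∀ z, Integrable (fun ω => φ (E n ω) z ^ 2) P)
    (hle : ∀ z, ∫ ω, φ (E n ω) z ^ 2 ∂P
      ≤ C * ∑ x, (weight (z (p x)) ^ 6 + weight (z (q x)) ^ 6 + weight (z (r x)) ^ 6)) :
    ∫⁻ ω, ENNReal.ofReal (φ (E n ω) (fun k => Z k ω) ^ 2) ∂P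
      ≤ ENNReal.ofReal (C * (Fintype.card ι * (3 * ∫ z, weight z ^ 6 ∂F))) := by
  have hw : ∀ k, Integrable (fun ω => weight (Z k ω) ^ 6) P := fun k => by
    have := hM.integrable_weight_pow
    rw [← hM.Z_law k] at this
    exact this.comp_measurable (hM.Z_meas k)
  have hw' : ∀ k, ∫ ω, weight (Z k ω) ^ 6 ∂P = ∫ z, weight z ^ 6 ∂F := fun k => by
    rw [← hM.Z_law k, integral_map (hM.Z_meas k).aemeasurable]
    exact (measurable_weight.pow_const 6).aestronglyMeasurable
  have hf : Measurable fun p : (Fin n × Fin n → ℝ) × (Fin n → EuclideanSpace ℝ (Fin d)) =>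
      ENNReal.ofReal (φ (Matrix.of fun i j => p.1 (i, j)) p.2 ^ 2) :=
    (hφ.pow_const 2).ennreal_ofReal
  -- The noise is integrated out with the points frozen; afterwards every summand of the conditional
  -- bound contributes the same moment of `F`, whatever the indices are.
  have key := hM.lintegral_noise_config (n := n) hf
  have hE : ∀ ω, (Matrix.of fun i j => E n ω i j) = E n ω := fun ω => rfl
  simp only [hE] at key
  rw [key]
  have hb : Integrable (fun ω => C * ∑ x, (weight (Z (p x) ω) ^ 6 + weight (Z (q x) ω) ^ 6
      + weight (Z (r x) ω) ^ 6)) P :=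
    (integrable_finsetSum _ fun x _ => ((hw _).add (hw _)).add (hw _)).const_mul C
  calc ∫⁻ ω', ∫⁻ ω, ENNReal.ofReal (φ (E n ω) (fun k => Z k ω') ^ 2) ∂P ∂P
      ≤ ∫⁻ ω', ENNReal.ofReal (C * ∑ x, (weight (Z (p x) ω') ^ 6 + weight (Z (q x) ω') ^ 6
        + weight (Z (r x) ω') ^ 6)) ∂P := by
        refine lintegral_mono fun ω' => ?_
        rw [← ofReal_integral_eq_lintegral_ofReal (hint _) (.of_forall fun ω => sq_nonneg _)]
        exact ENNReal.ofReal_le_ofReal (hle _)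
    _ = ENNReal.ofReal (∫ ω', C * ∑ x, (weight (Z (p x) ω') ^ 6 + weight (Z (q x) ω') ^ 6
        + weight (Z (r x) ω') ^ 6) ∂P) := by
        rw [ofReal_integral_eq_lintegral_ofReal hb (.of_forall fun ω => ?_)]
        exact mul_nonneg hC (Finset.sum_nonneg fun x _ => by positivity)
    _ ≤ _ := by
        refine ENNReal.ofReal_le_ofReal (le_of_eq ?_)
        have hi : ∀ x, Integrable (fun ω => weight (Z (p x) ω) ^ 6 + weight (Z (q x) ω) ^ 6
            + weight (Z (r x) ω) ^ 6) P := fun x => ((hw _).add (hw _)).add (hw _)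
        rw [integral_const_mul, integral_finsetSum _ fun x _ => hi x]
        congr 1
        have : ∀ x, ∫ ω, (weight (Z (p x) ω) ^ 6 + weight (Z (q x) ω) ^ 6
            + weight (Z (r x) ω) ^ 6) ∂P = 3 * ∫ z, weight z ^ 6 ∂F := by
          intro x
          have hpq : Integrable
              (fun ω => weight (Z (p x) ω) ^ 6 + weight (Z (q x) ω) ^ 6) P := (hw _).add (hw _)
          rw [integral_add hpq (hw _), integral_add (hw _) (hw _), hw', hw', hw']
          ring
        simp [this]

lemma integrable_linear_sq (hM : IsNoisyDistanceModel P F Z E σ γ ξ K) {n : ℕ}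
    (z : Fin n → EuclideanSpace ℝ (Fin d)) (c : Fin n → Fin n → ℝ) :
    Integrable (fun ω => (∑ i, ∑ j, c i j * effectiveNoise (distMatrix z) (E n ω) σ i j) ^ 2) P :=
  (memLp_finsetSum (Finset.univ : Finset (Fin n)) fun i _ =>
    memLp_finsetSum (Finset.univ : Finset (Fin n)) fun j _ =>
      ((hM.isWignerArray z).memLp_two i j).const_mul (c i j)).integrable_sq

lemma integral_linear_sq_le (hM : IsNoisyDistanceModel P F Z E σ γ ξ K) {n : ℕ}
    (z : Fin n → EuclideanSpace ℝ (Fin d)) (c : Fin n → Fin n → ℝ) :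
    ∫ ω, (∑ i, ∑ j, c i j * effectiveNoise (distMatrix z) (E n ω) σ i j) ^ 2 ∂P
      ≤ 2 * noiseBound σ γ ξ K * ∑ i, ∑ j, c i j ^ 2 * (weight (z i) * weight (z j)) := by
  refine ((hM.isWignerArray z).integral_sum_sq_le c).trans ?_
  rw [mul_assoc, Finset.mul_sum Finset.univ _ (noiseBound σ γ ξ K)]
  refine mul_le_mul_of_nonneg_left (Finset.sum_le_sum fun i _ => ?_) (by norm_num)
  rw [Finset.mul_sum]
  refine Finset.sum_le_sum fun j _ => ?_
  calc _ ≤ c i j ^ 2 * (noiseBound σ γ ξ K * (weight (z i) * weight (z j))) :=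
        mul_le_mul_of_nonneg_left (hM.integral_effectiveNoise_sq_le z i j) (sq_nonneg _)
    _ = _ := by ring

/-- Bilinear forms in the noise. -/
lemma lintegral_bilinear_sq_le (hM : IsNoisyDistanceModel P F Z E σ γ ξ K) (n : ℕ) {A : ℝ}
    {g g' : EuclideanSpace ℝ (Fin d) → ℝ} (hg : Measurable g) (hg' : Measurable g') (hA : 0 ≤ A)
    (hgA : ∀ z, g z ^ 2 ≤ A * weight z) (hgA' : ∀ z, g' z ^ 2 ≤ A * weight z) :
    ∫⁻ ω, ENNReal.ofReal ((∑ i : Fin n, ∑ j : Fin n, g (Z i ω) * g' (Z j ω) *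
        effectiveNoise (distMatrix fun k : Fin n => Z k ω) (E n ω) σ i j) ^ 2) ∂P
      ≤ ENNReal.ofReal (2 * noiseBound σ γ ξ K * A ^ 2 * 3 * (∫ z, weight z ^ 6 ∂F) * n ^ 2) := by
  have hnb := noiseBound_nonneg σ γ ξ K
  have := hM.lintegral_sq_le (n := n) (ι := Fin n × Fin n)
    (φ := fun e z => ∑ i : Fin n, ∑ j : Fin n, g (z i) * g' (z j) *
        effectiveNoise (distMatrix z) e σ i j)
    (p := fun x => x.1) (q := fun x => x.2) (r := fun x => x.2)
    (C := 2 * noiseBound σ γ ξ K * A ^ 2) ?_ (by positivity)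
    (fun z => hM.integrable_linear_sq z _) ?_
  · refine this.trans (ENNReal.ofReal_le_ofReal (le_of_eq ?_))
    simp only [Fintype.card_prod, Fintype.card_fin]
    push_cast
    ring
  · refine Finset.measurable_sum _ fun i _ => Finset.measurable_sum _ fun j _ => ?_
    exact ((hg.comp (by fun_prop)).mul (hg'.comp (by fun_prop))).mul
      (measurable_effectiveNoise σ i j)
  · intro z
    refine (hM.integral_linear_sq_le z _).trans ?_
    rw [mul_assoc]
    rw [mul_assoc]
    rw [mul_assoc]
    refine mul_le_mul_of_nonneg_left (mul_le_mul_of_nonneg_left ?_ hnb) (by norm_num)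
    rw [Finset.mul_sum, Fintype.sum_prod_type]
    refine Finset.sum_le_sum fun i _ => Finset.sum_le_sum fun j _ => ?_
    have hwi := (weight_pos (z i)).le
    have hwj := (weight_pos (z j)).le
    calc (g (z i) * g' (z j)) ^ 2 * (weight (z i) * weight (z j))
        = g (z i) ^ 2 * g' (z j) ^ 2 * (weight (z i) * weight (z j)) := by ring
      _ ≤ (A * weight (z i)) * (A * weight (z j)) * (weight (z i) * weight (z j)) := by
          gcongr
          · exact hgA _
          · exact hgA' _
      _ = A ^ 2 * (weight (z i) ^ 2 * weight (z j) ^ 2 * weight (z j) ^ 0) := by ring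
      _ ≤ _ := mul_le_mul_of_nonneg_left (weight_mul_le _ _ _ (by norm_num)) (by positivity)

/-- Linear forms in a row of the noise. -/
lemma lintegral_row_sq_le (hM : IsNoisyDistanceModel P F Z E σ γ ξ K) {n : ℕ} (i : Fin n) {A : ℝ}
    {g : EuclideanSpace ℝ (Fin d) → ℝ} (hg : Measurable g) (hA : 0 ≤ A)
    (hgA : ∀ z, g z ^ 2 ≤ A * weight z) :
    ∫⁻ ω, ENNReal.ofReal ((∑ j : Fin n,
        effectiveNoise (distMatrix fun k : Fin n => Z k ω) (E n ω) σ i j * g (Z j ω)) ^ 2) ∂P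
      ≤ ENNReal.ofReal (2 * noiseBound σ γ ξ K * A * 3 * (∫ z, weight z ^ 6 ∂F) * n) := by
  have hnb := noiseBound_nonneg σ γ ξ K
  have hrw : ∀ (z : Fin n → EuclideanSpace ℝ (Fin d)) (e : Matrix (Fin n) (Fin n) ℝ),
      ∑ j, effectiveNoise (distMatrix z) e σ i j * g (z j)
        = ∑ i', ∑ j, (if i' = i then g (z j) else 0) * effectiveNoise (distMatrix z) e σ i' j := by
    intro z e
    rw [Finset.sum_comm]
    refine Finset.sum_congr rfl fun j _ => ?_
    simp [mul_comm]
  have := hM.lintegral_sq_le (n := n) (ι := Fin n)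
    (φ := fun e z => ∑ j : Fin n, effectiveNoise (distMatrix z) e σ i j * g (z j))
    (p := fun x => i) (q := fun x => x) (r := fun x => x)
    (C := 2 * noiseBound σ γ ξ K * A) ?_ (by positivity)
    (fun z => by simp only [hrw]; exact hM.integrable_linear_sq z _) ?_
  · refine this.trans (ENNReal.ofReal_le_ofReal (le_of_eq ?_))
    simp only [Fintype.card_fin]
    ring
  · refine Finset.measurable_sum _ fun j _ => ?_
    exact (measurable_effectiveNoise σ i j).mul (hg.comp (by fun_prop))
  · intro z
    simp only [hrw]
    refine (hM.integral_linear_sq_le z _).trans ?_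
    rw [mul_assoc, mul_assoc, mul_assoc]
    refine mul_le_mul_of_nonneg_left (mul_le_mul_of_nonneg_left ?_ hnb) (by norm_num)
    rw [Finset.mul_sum, Finset.sum_eq_single i (fun b _ hb => by simp [hb]) (by simp)]
    refine Finset.sum_le_sum fun j _ => ?_
    have hwi := (weight_pos (z i)).le
    have hwj := (weight_pos (z j)).le
    rw [if_pos rfl]
    calc g (z j) ^ 2 * (weight (z i) * weight (z j))
        ≤ (A * weight (z j)) * (weight (z i) * weight (z j)) := by
          gcongr
          exact hgA _
      _ = A * (weight (z i) ^ 1 * weight (z j) ^ 2 * weight (z j) ^ 0) := by ring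
      _ ≤ _ := mul_le_mul_of_nonneg_left (weight_mul_le _ _ _ (by norm_num)) hA

lemma lintegral_entry_sq_le (hM : IsNoisyDistanceModel P F Z E σ γ ξ K) {n : ℕ} (i j : Fin n) :
    ∫⁻ ω, ENNReal.ofReal
        (effectiveNoise (distMatrix fun k : Fin n => Z k ω) (E n ω) σ i j ^ 2) ∂P
      ≤ ENNReal.ofReal (noiseBound σ γ ξ K * 3 * (∫ z, weight z ^ 6 ∂F)) := by
  have hnb := noiseBound_nonneg σ γ ξ K
  have := hM.lintegral_sq_le (n := n) (ι := Unit)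
    (φ := fun e z => effectiveNoise (distMatrix z) e σ i j)
    (p := fun _ => i) (q := fun _ => j) (r := fun _ => j)
    (C := noiseBound σ γ ξ K) (measurable_effectiveNoise σ i j) hnb
    (fun z => ((hM.isWignerArray z).memLp_two i j).integrable_sq) ?_
  · refine this.trans (ENNReal.ofReal_le_ofReal (le_of_eq ?_))
    simp; ring
  · intro z
    refine (hM.integral_effectiveNoise_sq_le z i j).trans ?_
    simp only [Finset.univ_unique, Finset.sum_singleton]
    refine mul_le_mul_of_nonneg_left ?_ hnb
    refine le_trans (le_of_eq ?_) (weight_mul_le (z i) (z j) (z j) (p := 1) (q := 1) (r := 0)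
      (by norm_num))
    ring

/-- Off-diagonal entries of the squared noise. -/
lemma integral_sq_offDiag_le (hM : IsNoisyDistanceModel P F Z E σ γ ξ K) {n : ℕ}
    (z : Fin n → EuclideanSpace ℝ (Fin d)) (i k j : Fin n) :
    (∫ ω, effectiveNoise (distMatrix z) (E n ω) σ i j ^ 2 ∂P) *
      ∫ ω, effectiveNoise (distMatrix z) (E n ω) σ j k ^ 2 ∂P
      ≤ noiseBound σ γ ξ K ^ 2 * (weight (z i) * weight (z j) ^ 2 * weight (z k)) := by
  have hnb := noiseBound_nonneg σ γ ξ K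
  have hwi := (weight_pos (z i)).le
  have hwj := (weight_pos (z j)).le
  refine (mul_le_mul (hM.integral_effectiveNoise_sq_le z i j)
    (hM.integral_effectiveNoise_sq_le z j k) (integral_nonneg fun ω => sq_nonneg _)
    (by positivity)).trans (le_of_eq (by ring))

lemma integral_sq_diag_le (hM : IsNoisyDistanceModel P F Z E σ γ ξ K) {n : ℕ}
    (z : Fin n → EuclideanSpace ℝ (Fin d)) (i : Fin n) :
    ∫ ω, (∑ j, effectiveNoise (distMatrix z) (E n ω) σ i j *
        effectiveNoise (distMatrix z) (E n ω) σ j i) ^ 2 ∂P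
      ≤ n * ∑ j, noiseBound σ γ ξ K * (weight (z i) ^ 2 * weight (z j) ^ 2) :=
  ((hM.isWignerArray z).integral_sq_diag_sq_le i).trans
    (mul_le_mul_of_nonneg_left (Finset.sum_le_sum fun j _ =>
      hM.integral_effectiveNoise_pow_four_le z i j) (Nat.cast_nonneg n))

/-- Linear forms in a row of the squared noise. -/
lemma lintegral_sq_row_sq_le (hM : IsNoisyDistanceModel P F Z E σ γ ξ K) {n : ℕ} (i : Fin n)
    {A : ℝ} {g : EuclideanSpace ℝ (Fin d) → ℝ} (hg : Measurable g) (hA : 0 ≤ A)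
    (hgA : ∀ z, g z ^ 2 ≤ A * weight z) :
    ∫⁻ ω, ENNReal.ofReal ((∑ k : Fin n, (∑ j : Fin n,
        effectiveNoise (distMatrix fun k : Fin n => Z k ω) (E n ω) σ i j *
        effectiveNoise (distMatrix fun k : Fin n => Z k ω) (E n ω) σ j k) * g (Z k ω)) ^ 2) ∂P
      ≤ ENNReal.ofReal (2 * (noiseBound σ γ ξ K ^ 2 + noiseBound σ γ ξ K) * A * 3 *
          (∫ z, weight z ^ 6 ∂F) * n ^ 2) := by
  have hnb := noiseBound_nonneg σ γ ξ K
  -- The off-diagonal entries of a row of `H²` are uncorrelated given the points. The diagonal entry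
  -- has mean of order `n` and is split off; in the end both parts have second moment of order `n²`.
  have hsplit : ∀ (z : Fin n → EuclideanSpace ℝ (Fin d)) (e : Matrix (Fin n) (Fin n) ℝ),
      ∑ k, (∑ j, effectiveNoise (distMatrix z) e σ i j * effectiveNoise (distMatrix z) e σ j k)
          * g (z k)
        = ∑ k, (∑ j, effectiveNoise (distMatrix z) e σ i j * effectiveNoise (distMatrix z) e σ j k)
          * (if k = i then 0 else g (z k))
        + (∑ j, effectiveNoise (distMatrix z) e σ i j * effectiveNoise (distMatrix z) e σ j i)
          * g (z i) := by
    intro z e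
    rw [← Finset.add_sum_erase _ _ (Finset.mem_univ i), add_comm,
      ← Finset.add_sum_erase Finset.univ (fun k => _ * (if k = i then (0 : ℝ) else g (z k)))
        (Finset.mem_univ i), if_pos rfl, mul_zero, zero_add]
    congr 1
    exact Finset.sum_congr rfl fun k hk => by rw [if_neg (Finset.ne_of_mem_erase hk)]
  have hm1 : ∀ (z : Fin n → EuclideanSpace ℝ (Fin d)) (a : Fin n → ℝ), MemLp (fun ω =>
      ∑ k, (∑ j, effectiveNoise (distMatrix z) (E n ω) σ i j *
        effectiveNoise (distMatrix z) (E n ω) σ j k) * a k) 2 P := fun z a =>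
    memLp_finsetSum (Finset.univ : Finset (Fin n)) fun k _ =>
      ((hM.isWignerArray z).memLp_two_sq_entry i k).mul_const (a k)
  have hm2 : ∀ z : Fin n → EuclideanSpace ℝ (Fin d), MemLp (fun ω =>
      (∑ j, effectiveNoise (distMatrix z) (E n ω) σ i j *
        effectiveNoise (distMatrix z) (E n ω) σ j i) * g (z i)) 2 P := fun z =>
    ((hM.isWignerArray z).memLp_two_sq_entry i i).mul_const (g (z i))
  have := hM.lintegral_sq_le (n := n) (ι := Fin n × Fin n)
    (φ := fun e z => ∑ k : Fin n, (∑ j : Fin n, effectiveNoise (distMatrix z) e σ i j *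
      effectiveNoise (distMatrix z) e σ j k) * g (z k))
    (p := fun _ => i) (q := fun x => x.1) (r := fun x => x.2)
    (C := 2 * (noiseBound σ γ ξ K ^ 2 + noiseBound σ γ ξ K) * A) ?_ (by positivity)
    (fun z => (hm1 z fun k => g (z k)).integrable_sq) ?_
  · refine this.trans (ENNReal.ofReal_le_ofReal (le_of_eq ?_))
    simp only [Fintype.card_prod, Fintype.card_fin]
    push_cast
    ring
  · refine Finset.measurable_sum _ fun k _ => ?_
    refine Measurable.mul (Finset.measurable_sum _ fun j _ => ?_) (hg.comp (by fun_prop))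
    exact (measurable_effectiveNoise σ i j).mul (measurable_effectiveNoise σ j k)
  · intro z
    have hw := fun k => (weight_pos (z k)).le
    calc ∫ ω, (∑ k : Fin n, (∑ j : Fin n, effectiveNoise (distMatrix z) (E n ω) σ i j *
          effectiveNoise (distMatrix z) (E n ω) σ j k) * g (z k)) ^ 2 ∂P
        ≤ ∫ ω, (2 * (∑ k, (∑ j, effectiveNoise (distMatrix z) (E n ω) σ i j *
            effectiveNoise (distMatrix z) (E n ω) σ j k) * (if k = i then 0 else g (z k))) ^ 2
          + 2 * ((∑ j, effectiveNoise (distMatrix z) (E n ω) σ i j *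
            effectiveNoise (distMatrix z) (E n ω) σ j i) * g (z i)) ^ 2) ∂P := by
          refine integral_mono (hm1 z fun k => g (z k)).integrable_sq
            (((hm1 z _).integrable_sq.const_mul 2).add ((hm2 z).integrable_sq.const_mul 2))
            fun ω => ?_
          simp only [hsplit]
          exact (add_sq_le).trans (le_of_eq (by ring))
      _ = 2 * ∑ k, ∑ j, (if k = i then 0 else g (z k)) ^ 2 *
            ((∫ ω, effectiveNoise (distMatrix z) (E n ω) σ i j ^ 2 ∂P) *
              ∫ ω, effectiveNoise (distMatrix z) (E n ω) σ j k ^ 2 ∂P)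
          + 2 * ((∫ ω, (∑ j, effectiveNoise (distMatrix z) (E n ω) σ i j *
            effectiveNoise (distMatrix z) (E n ω) σ j i) ^ 2 ∂P) * g (z i) ^ 2) := by
          rw [integral_add ((hm1 z _).integrable_sq.const_mul 2)
            ((hm2 z).integrable_sq.const_mul 2), integral_const_mul, integral_const_mul,
            (hM.isWignerArray z).integral_sum_sq_entry_sq i _ (if_pos rfl)]
          simp only [mul_pow, integral_mul_const]
      _ ≤ 2 * ∑ k, ∑ j, (A * weight (z k)) *
            (noiseBound σ γ ξ K ^ 2 * (weight (z i) * weight (z j) ^ 2 * weight (z k)))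
          + 2 * ((n * ∑ j, noiseBound σ γ ξ K * (weight (z i) ^ 2 * weight (z j) ^ 2))
            * (A * weight (z i))) := by
          refine add_le_add (mul_le_mul_of_nonneg_left (Finset.sum_le_sum fun k _ =>
            Finset.sum_le_sum fun j _ => ?_) zero_le_two)
            (mul_le_mul_of_nonneg_left ?_ zero_le_two)
          · refine mul_le_mul ?_ (hM.integral_sq_offDiag_le z i k j)
              (mul_nonneg (integral_nonneg fun ω => sq_nonneg _)
                (integral_nonneg fun ω => sq_nonneg _)) (mul_nonneg hA (hw k))
            split_ifs
            · simpa using mul_nonneg hA (hw k)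
            · exact hgA _
          · refine mul_le_mul (hM.integral_sq_diag_le z i) (hgA _) (sq_nonneg _)
              (mul_nonneg (Nat.cast_nonneg n) (Finset.sum_nonneg fun j _ => by positivity))
      _ = 2 * (noiseBound σ γ ξ K ^ 2 * A * ∑ k, ∑ j,
            weight (z i) ^ 1 * weight (z k) ^ 2 * weight (z j) ^ 2)
          + 2 * (noiseBound σ γ ξ K * A * ∑ _k : Fin n, ∑ j,
            weight (z i) ^ 3 * weight (z _k) ^ 0 * weight (z j) ^ 2) := by
          have e1 : ∑ k, ∑ j, (A * weight (z k)) *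
            (noiseBound σ γ ξ K ^ 2 * (weight (z i) * weight (z j) ^ 2 * weight (z k)))
            = noiseBound σ γ ξ K ^ 2 * A * ∑ k, ∑ j,
            weight (z i) ^ 1 * weight (z k) ^ 2 * weight (z j) ^ 2 := by
            simp only [Finset.mul_sum]
            exact Finset.sum_congr rfl fun k _ => Finset.sum_congr rfl fun j _ => by ring
          have e2 : (n * ∑ j, noiseBound σ γ ξ K * (weight (z i) ^ 2 * weight (z j) ^ 2))
            * (A * weight (z i)) = noiseBound σ γ ξ K * A * ∑ _k : Fin n, ∑ j,
            weight (z i) ^ 3 * weight (z _k) ^ 0 * weight (z j) ^ 2 := by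
            simp only [pow_zero, mul_one, Finset.sum_const, Finset.card_univ, Fintype.card_fin,
              nsmul_eq_mul]
            rw [← Finset.mul_sum, ← Finset.mul_sum, ← Finset.mul_sum]
            ring
          rw [e1, e2]
      _ ≤ 2 * (noiseBound σ γ ξ K ^ 2 * A * ∑ k, ∑ j,
            (weight (z i) ^ 6 + weight (z k) ^ 6 + weight (z j) ^ 6))
          + 2 * (noiseBound σ γ ξ K * A * ∑ k, ∑ j,
            (weight (z i) ^ 6 + weight (z k) ^ 6 + weight (z j) ^ 6)) := by
          gcongr <;> exact weight_mul_le _ _ _ (by norm_num)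
      _ = _ := by
          rw [Fintype.sum_prod_type]
          ring

/-- Off the diagonal the `n` summands are uncorrelated and give order `n`; on the diagonal they are
squares and give order `n²`. -/
lemma lintegral_sq_entry_sq_le (hM : IsNoisyDistanceModel P F Z E σ γ ξ K) {n : ℕ} (i k : Fin n) :
    ∫⁻ ω, ENNReal.ofReal ((∑ j : Fin n,
        effectiveNoise (distMatrix fun k : Fin n => Z k ω) (E n ω) σ i j *
        effectiveNoise (distMatrix fun k : Fin n => Z k ω) (E n ω) σ j k) ^ 2) ∂P
      ≤ ENNReal.ofReal ((noiseBound σ γ ξ K ^ 2 + noiseBound σ γ ξ K) * 3 *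
          (∫ z, weight z ^ 6 ∂F) * (if k = i then n ^ 2 else n)) := by
  have hnb := noiseBound_nonneg σ γ ξ K
  have hmeas : Measurable fun p : (Fin n × Fin n → ℝ) × (Fin n → EuclideanSpace ℝ (Fin d)) =>
      ∑ j, effectiveNoise (distMatrix p.2) (Matrix.of fun i j => p.1 (i, j)) σ i j
        * effectiveNoise (distMatrix p.2) (Matrix.of fun i j => p.1 (i, j)) σ j k :=
    Finset.measurable_sum _ fun j _ =>
      (measurable_effectiveNoise σ i j).mul (measurable_effectiveNoise σ j k)
  by_cases hki : k = i
  · subst hki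
    have := hM.lintegral_sq_le (n := n) (ι := Fin n × Fin n)
      (φ := fun e z => ∑ j : Fin n, effectiveNoise (distMatrix z) e σ k j *
        effectiveNoise (distMatrix z) e σ j k)
      (p := fun _ => k) (q := fun x => x.2) (r := fun x => x.2)
      (C := noiseBound σ γ ξ K ^ 2 + noiseBound σ γ ξ K) hmeas (by positivity)
      (fun z => ((hM.isWignerArray z).memLp_two_sq_entry k k).integrable_sq) ?_
    · refine this.trans (ENNReal.ofReal_le_ofReal (le_of_eq ?_))
      simp only [Fintype.card_prod, Fintype.card_fin, if_pos]
      push_cast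
      ring
    · intro z
      refine (hM.integral_sq_diag_le z k).trans ?_
      rw [Fintype.sum_prod_type, ← Finset.mul_sum]
      simp only [Finset.sum_const, Finset.card_univ, Fintype.card_fin, nsmul_eq_mul]
      rw [mul_left_comm]
      refine mul_le_mul (by nlinarith only [sq_nonneg (noiseBound σ γ ξ K)]) ?_ ?_ (by positivity)
      · refine mul_le_mul_of_nonneg_left (Finset.sum_le_sum fun j _ => ?_) (Nat.cast_nonneg n)
        refine le_trans (le_of_eq ?_) (weight_mul_le (z k) (z j) (z j) (p := 2) (q := 2) (r := 0)
          (by norm_num))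
        ring
      · exact mul_nonneg (Nat.cast_nonneg n) (Finset.sum_nonneg fun j _ => by positivity)
  · have := hM.lintegral_sq_le (n := n) (ι := Fin n)
      (φ := fun e z => ∑ j : Fin n, effectiveNoise (distMatrix z) e σ i j *
        effectiveNoise (distMatrix z) e σ j k)
      (p := fun _ => i) (q := fun x => x) (r := fun x => k)
      (C := noiseBound σ γ ξ K ^ 2 + noiseBound σ γ ξ K) hmeas (by positivity)
      (fun z => ((hM.isWignerArray z).memLp_two_sq_entry i k).integrable_sq) ?_
    · refine this.trans (ENNReal.ofReal_le_ofReal (le_of_eq ?_))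
      simp only [Fintype.card_fin, if_neg hki]
      ring
    · intro z
      rw [(hM.isWignerArray z).integral_sq_entry_sq hki, Finset.mul_sum]
      refine Finset.sum_le_sum fun j _ => ?_
      refine (hM.integral_sq_offDiag_le z i k j).trans ?_
      have hwi := (weight_pos (z i)).le
      have hwk := (weight_pos (z k)).le
      refine mul_le_mul (by linarith) ?_ (by positivity) (by positivity)
      refine le_trans (le_of_eq ?_) (weight_mul_le (z i) (z j) (z k) (p := 1) (q := 2) (r := 1)
          (by norm_num))
      ring

end IsNoisyDistanceModel

end NoiseMoments

/-! ### Boundedness and convergence in probability. -/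

section InProbability

variable {Ω : Type*} [MeasurableSpace Ω] {P : Measure Ω}

/-- The sequence `f` is bounded in probability. -/
def BddInProb (P : Measure Ω) (f : ℕ → Ω → ℝ) : Prop :=
  ∀ ε : ℝ, 0 < ε → ∃ C : ℝ, ∀ᶠ n in atTop, P.real {ω | C < |f n ω|} ≤ ε

/-- The sequence `f` tends to zero in probability. -/
def NullInProb (P : Measure Ω) (f : ℕ → Ω → ℝ) : Prop :=
  ∀ ε : ℝ, 0 < ε → Tendsto (fun n => P.real {ω | ε < |f n ω|}) atTop (𝓝 0)

lemma tendsto_measureReal_zero_of_le [IsFiniteMeasure P] {s t : ℕ → Set Ω}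
    (ht : Tendsto (fun n => P.real (t n)) atTop (𝓝 0)) (hst : ∀ᶠ n in atTop, s n ⊆ t n) :
    Tendsto (fun n => P.real (s n)) atTop (𝓝 0) := by
  refine tendsto_of_tendsto_of_tendsto_of_le_of_le' tendsto_const_nhds ht
    (.of_forall fun n => measureReal_nonneg) ?_
  filter_upwards [hst] with n hn using measureReal_mono hn

lemma tendsto_measureReal_zero_union [IsFiniteMeasure P] {s t : ℕ → Set Ω}
    (hs : Tendsto (fun n => P.real (s n)) atTop (𝓝 0))
    (ht : Tendsto (fun n => P.real (t n)) atTop (𝓝 0)) :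
    Tendsto (fun n => P.real (s n ∪ t n)) atTop (𝓝 0) := by
  refine tendsto_of_tendsto_of_tendsto_of_le_of_le tendsto_const_nhds
    (by simpa using hs.add ht) (fun n => measureReal_nonneg) fun n => measureReal_union_le _ _

lemma BddInProb.add [IsFiniteMeasure P] {f g : ℕ → Ω → ℝ} (hf : BddInProb P f)
    (hg : BddInProb P g) : BddInProb P fun n ω => f n ω + g n ω := by
  intro ε hε
  obtain ⟨C, hC⟩ := hf (ε / 2) (half_pos hε)
  obtain ⟨D, hD⟩ := hg (ε / 2) (half_pos hε)
  refine ⟨C + D, ?_⟩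
  filter_upwards [hC, hD] with n h1 h2
  have : {ω | C + D < |f n ω + g n ω|} ⊆ {ω | C < |f n ω|} ∪ {ω | D < |g n ω|} := by
    intro ω hω
    by_contra hcon
    simp only [Set.mem_union, Set.mem_ofPred_eq, not_or, not_lt] at hcon hω
    linarith [abs_add_le (f n ω) (g n ω)]
  linarith [(measureReal_mono this).trans (measureReal_union_le (μ := P) _ _)]

lemma BddInProb.nullInProb_const_mul [IsFiniteMeasure P] {f : ℕ → Ω → ℝ} (hf : BddInProb P f)
    {c : ℕ → ℝ} (hc : Tendsto c atTop (𝓝 0)) : NullInProb P fun n ω => c n * f n ω := by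
  intro ε hε
  rw [Metric.tendsto_atTop]
  intro δ hδ
  obtain ⟨C, hC⟩ := hf (δ / 2) (half_pos hδ)
  have h0 : Tendsto (fun n => |c n| * |C|) atTop (𝓝 0) := by simpa using hc.abs.mul_const |C|
  obtain ⟨N, hN⟩ := eventually_atTop.1 (hC.and (h0.eventually_lt_const hε))
  refine ⟨N, fun n hn => ?_⟩
  obtain ⟨h1, h2⟩ := hN n hn
  rw [Real.dist_eq, sub_zero, abs_of_nonneg measureReal_nonneg]
  refine lt_of_le_of_lt (measureReal_mono (s₂ := {ω | C < |f n ω|}) fun ω hω => ?_)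
    (h1.trans_lt (half_lt_self hδ))
  by_contra hcon
  simp only [Set.mem_ofPred_eq, not_lt, abs_mul] at hcon hω
  have := mul_le_mul_of_nonneg_left (hcon.trans (le_abs_self C)) (abs_nonneg (c n))
  linarith

lemma NullInProb.of_ae_tendsto [IsFiniteMeasure P] {f : ℕ → Ω → ℝ} (hm : ∀ n, Measurable (f n))
    (h : ∀ᵐ ω ∂P, Tendsto (fun n => f n ω) atTop (𝓝 0)) : NullInProb P f := by
  intro ε hε
  have := tendstoInMeasure_of_tendsto_ae (fun n => (hm n).aestronglyMeasurable) h
  rw [tendstoInMeasure_iff_measureReal_norm] at this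
  refine tendsto_measureReal_zero_of_le (this ε hε) (.of_forall fun n ω hω => ?_)
  simpa using (le_of_lt hω)

/-- A quantity controlled on events of high probability tends to zero in probability. -/
lemma nullInProb_of_control [IsFiniteMeasure P] {B R : ℕ → Ω → ℝ} {S : ℝ → ℕ → Ω → Prop}
    (hB : BddInProb P B)
    (hS : ∀ η : ℝ, 0 < η → Tendsto (fun n => P.real {ω | ¬ S η n ω}) atTop (𝓝 0))
    (hR : ∀ C : ℝ, 1 ≤ C → ∃ c : ℝ, 0 ≤ c ∧ ∃ η₀ : ℝ, 0 < η₀ ∧ ∀ η : ℝ, 0 < η → η ≤ η₀ →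
      ∀ᶠ n in atTop, ∀ ω, |B n ω| ≤ C → S η n ω → |R n ω| ≤ c * η) :
    NullInProb P R := by
  intro ε hε
  rw [Metric.tendsto_atTop]
  intro δ hδ
  obtain ⟨C, hC⟩ := hB (δ / 2) (half_pos hδ)
  obtain ⟨c, hc, η₀, hη₀, hctl⟩ := hR (max C 1) (le_max_right _ _)
  -- The order of choices matters: `C` comes from tightness, `c` and `η₀` may depend on `C`, and `η`
  -- is taken last, so that the bound `c η` falls below `ε`.
  set η := min η₀ (ε / (c + 1)) with hη
  have hη0 : 0 < η := lt_min hη₀ (by positivity)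
  have hcη : c * η ≤ ε := by
    have h1 : η ≤ ε / (c + 1) := min_le_right _ _
    calc c * η ≤ (c + 1) * (ε / (c + 1)) :=
          mul_le_mul (by linarith) h1 hη0.le (by linarith)
      _ = ε := by field_simp
  obtain ⟨N, hN⟩ := eventually_atTop.1 ((hC.and (hctl η hη0 (min_le_left _ _))).and
    ((hS η hη0).eventually_lt_const (half_pos hδ)))
  refine ⟨N, fun n hn => ?_⟩
  obtain ⟨⟨h1, h2⟩, h3⟩ := hN n hn
  rw [Real.dist_eq, sub_zero, abs_of_nonneg measureReal_nonneg]
  have : {ω | ε < |R n ω|} ⊆ {ω | C < |B n ω|} ∪ {ω | ¬ S η n ω} := by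
    intro ω hω
    by_contra hcon
    simp only [Set.mem_union, Set.mem_ofPred_eq, not_or, not_lt, not_not] at hcon hω
    linarith [h2 ω (hcon.1.trans (le_max_left _ _)) hcon.2]
  linarith [(measureReal_mono this).trans (measureReal_union_le (μ := P) _ _)]

lemma ofReal_sum_sum {κ ι : Type*} [Fintype κ] [Fintype ι] {a : κ → ι → ℝ} (ha : ∀ i j, 0 ≤ a i j) :
    ENNReal.ofReal (∑ i, ∑ j, a i j) = ∑ i, ∑ j, ENNReal.ofReal (a i j) := by
  rw [ENNReal.ofReal_sum_of_nonneg fun i _ => Finset.sum_nonneg fun j _ => ha i j]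
  exact Finset.sum_congr rfl fun i _ => ENNReal.ofReal_sum_of_nonneg fun j _ => ha i j

-- Chebyshev's inequality for the Frobenius norm, whose square has expectation the sum of the
-- entrywise second moments. Each stochastic bound below is thereby reduced to counting entries and
-- their sizes.
open scoped Matrix.Norms.Frobenius in
lemma bddInProb_norm_of_lintegral [IsFiniteMeasure P] {κ ι : ℕ → Type*} [∀ n, Fintype (κ n)]
    [∀ n, Fintype (ι n)] {M : ∀ n, Ω → Matrix (κ n) (ι n) ℝ} {a : ℕ → ℝ}
    (b : ∀ n, κ n → ι n → ℝ) {B : ℝ} (hM : ∀ᶠ n in atTop, ∀ i j, Measurable fun ω => M n ω i j)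
    (hb : ∀ n i j, 0 ≤ b n i j)
    (hMb : ∀ᶠ n in atTop, ∀ i j,
      ∫⁻ ω, ENNReal.ofReal (M n ω i j ^ 2) ∂P ≤ ENNReal.ofReal (b n i j))
    (ha : ∀ᶠ n in atTop, 0 < a n) (hB : ∀ᶠ n in atTop, ∑ i, ∑ j, b n i j ≤ B * a n ^ 2) :
    BddInProb P fun n ω => ‖M n ω‖ / a n := by
  intro ε hε
  -- The maximum with `1` keeps the level in Chebyshev's inequality positive even if `B` is not.
  set B' := max B 1 with hB'
  have hB1 : 0 < B' := lt_of_lt_of_le one_pos (le_max_right _ _)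
  refine ⟨√(B' / ε), ?_⟩
  filter_upwards [hM, hMb, ha, hB] with n hM hMb ha hB
  have hmeas : Measurable fun ω => ENNReal.ofReal (‖M n ω‖ ^ 2) := by
    simp only [frobenius_norm_sq]
    exact (Finset.measurable_sum _ fun i _ => Finset.measurable_sum _ fun j _ =>
      (hM i j).pow_const 2).ennreal_ofReal
  have hint : ∫⁻ ω, ENNReal.ofReal (‖M n ω‖ ^ 2) ∂P ≤ ENNReal.ofReal (B' * a n ^ 2) := by
    calc ∫⁻ ω, ENNReal.ofReal (‖M n ω‖ ^ 2) ∂P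
        = ∑ i, ∑ j, ∫⁻ ω, ENNReal.ofReal (M n ω i j ^ 2) ∂P := by
          have h1 : ∀ ω, ENNReal.ofReal (‖M n ω‖ ^ 2) = ∑ i, ∑ j, ENNReal.ofReal (M n ω i j ^ 2) := by
            intro ω
            rw [frobenius_norm_sq]
            exact ofReal_sum_sum fun i j => sq_nonneg _
          have h2 : ∀ i j, Measurable fun ω => ENNReal.ofReal (M n ω i j ^ 2) := fun i j =>
            ((hM i j).pow_const 2).ennreal_ofReal
          simp only [h1]
          rw [lintegral_finsetSum _ fun i _ => Finset.measurable_sum _ fun j _ => h2 i j]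
          exact Finset.sum_congr rfl fun i _ => lintegral_finsetSum _ fun j _ => h2 i j
      _ ≤ ∑ i, ∑ j, ENNReal.ofReal (b n i j) :=
          Finset.sum_le_sum fun i _ => Finset.sum_le_sum fun j _ => hMb i j
      _ = ENNReal.ofReal (∑ i, ∑ j, b n i j) := by
          exact (ofReal_sum_sum fun i j => hb n i j).symm
      _ ≤ _ := ENNReal.ofReal_le_ofReal (hB.trans
          (mul_le_mul_of_nonneg_right (le_max_left _ _) (sq_nonneg _)))
  have hsub : {ω | √(B' / ε) < |‖M n ω‖ / a n|}
      ⊆ {ω | ENNReal.ofReal (B' / ε * a n ^ 2) ≤ ENNReal.ofReal (‖M n ω‖ ^ 2)} := by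
    intro ω hω
    simp only [Set.mem_ofPred_eq] at hω ⊢
    refine ENNReal.ofReal_le_ofReal ?_
    rw [abs_of_nonneg (by positivity), lt_div_iff₀ ha] at hω
    have := pow_le_pow_left₀ (by positivity) hω.le 2
    rwa [mul_pow, Real.sq_sqrt (by positivity)] at this
  have hpos : 0 < B' / ε * a n ^ 2 := by positivity
  have hcheb := meas_ge_le_lintegral_div (μ := P) hmeas.aemeasurable
    (ε := ENNReal.ofReal (B' / ε * a n ^ 2)) (by simpa using hpos) ENNReal.ofReal_ne_top
  have hfin : P {ω | √(B' / ε) < |‖M n ω‖ / a n|} ≤ ENNReal.ofReal ε := by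
    refine (measure_mono hsub).trans (hcheb.trans ?_)
    rw [ENNReal.div_le_iff (by simpa using hpos) ENNReal.ofReal_ne_top,
      ← ENNReal.ofReal_mul hε.le]
    refine hint.trans (ENNReal.ofReal_le_ofReal (le_of_eq ?_))
    field_simp
  exact ENNReal.toReal_le_of_le_ofReal hε.le hfin

end InProbability

/-! ### Orders of magnitude of the products of noise and features. -/

section StochasticBounds

open Matrix
open scoped Matrix.Norms.Frobenius

/-- The row vector selecting the `i`-th row. -/
def rowSelector (n i : ℕ) : Matrix (Fin 1) (Fin n) ℝ :=
  Matrix.of fun _ j => if (j : ℕ) = i then 1 else 0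

lemma rowSelector_mul_apply {n i : ℕ} (h : i < n) {κ : Type*} (M : Matrix (Fin n) κ ℝ) (a : Fin 1)
    (l : κ) : (rowSelector n i * M) a l = M ⟨i, h⟩ l := by
  have : ∀ j : Fin n, (j : ℕ) = i ↔ j = ⟨i, h⟩ := fun j => by simp [Fin.ext_iff]
  simp [rowSelector, Matrix.mul_apply, this]

/-- The matrix whose `i`-th row consists of the features `g l` of the `i`-th point. -/
def featureMatrix {Ω κ V : Type*} (Z : ℕ → Ω → V) (g : κ → V → ℝ) (n : ℕ) (ω : Ω) :
    Matrix (Fin n) κ ℝ :=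
  Matrix.of fun i l => g l (Z i ω)

/-- The effective noise of the model. -/
noncomputable def modelNoise {Ω : Type*} {d : ℕ} (Z : ℕ → Ω → EuclideanSpace ℝ (Fin d))
    (E : (n : ℕ) → Ω → Matrix (Fin n) (Fin n) ℝ) (σ : ℝ) (n : ℕ) (ω : Ω) :
    Matrix (Fin n) (Fin n) ℝ :=
  effectiveNoise (distMatrix fun k : Fin n => Z k ω) (E n ω) σ

variable {Ω : Type*} [MeasurableSpace Ω]

namespace IsNoisyDistanceModel

variable {d : ℕ} {P : Measure Ω} [IsProbabilityMeasure P]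
  {F : Measure (EuclideanSpace ℝ (Fin d))}
  {Z : ℕ → Ω → EuclideanSpace ℝ (Fin d)} {E : (n : ℕ) → Ω → Matrix (Fin n) (Fin n) ℝ}
  {σ γ ξ K : ℝ} {κ κ' : Type*} [Fintype κ] [Fintype κ'] {A : ℝ}
  {g : κ → EuclideanSpace ℝ (Fin d) → ℝ} {g' : κ' → EuclideanSpace ℝ (Fin d) → ℝ}

lemma measurable_modelNoise (hM : IsNoisyDistanceModel P F Z E σ γ ξ K) (n : ℕ) (i j : Fin n) :
    Measurable fun ω => modelNoise Z E σ n ω i j := by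
  have h1 := hM.E_meas n i j
  have h2 := hM.Z_meas i
  have h3 := hM.Z_meas j
  simp only [modelNoise, effectiveNoise, distMatrix, Matrix.of_apply]
  split_ifs
  · exact measurable_const
  · fun_prop

lemma weightMoment_nonneg : 0 ≤ ∫ z, weight (d := d) z ^ 6 ∂F :=
  integral_nonneg fun z => by have := weight_pos z; positivity

lemma lintegral_feature_sq_le (hM : IsNoisyDistanceModel P F Z E σ γ ξ K) (i : ℕ)
    {g : EuclideanSpace ℝ (Fin d) → ℝ} (hg : Measurable g) (hA : 0 ≤ A)
    (hgA : ∀ z, g z ^ 2 ≤ A * weight z) :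
    ∫⁻ ω, ENNReal.ofReal (g (Z i ω) ^ 2) ∂P
      ≤ ENNReal.ofReal (A * 3 * ∫ z, weight z ^ 6 ∂F) := by
  -- The smallest sample containing the point `i` is used, with a functional that ignores the noise.
  have := hM.lintegral_sq_le (n := i + 1) (ι := Unit) (φ := fun e z => g (z (Fin.last i)))
    (p := fun _ => Fin.last i) (q := fun _ => Fin.last i) (r := fun _ => Fin.last i) (C := A)
    (hg.comp (by fun_prop)) hA (fun z => integrable_const _) ?_
  · refine this.trans (ENNReal.ofReal_le_ofReal (le_of_eq ?_))
    simp; ring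
  · intro z
    simp only [integral_const, probReal_univ, one_smul, Finset.univ_unique, Finset.sum_singleton]
    refine (hgA _).trans (mul_le_mul_of_nonneg_left ?_ hA)
    refine le_trans (le_of_eq ?_) (weight_mul_le (z (Fin.last i)) (z (Fin.last i))
      (z (Fin.last i)) (p := 1) (q := 0) (r := 0) (by norm_num))
    ring

lemma bddInProb_feature (hM : IsNoisyDistanceModel P F Z E σ γ ξ K) (hg : ∀ l, Measurable (g l))
    (hA : 0 ≤ A) (hgA : ∀ l z, g l z ^ 2 ≤ A * weight z) :
    BddInProb P fun n ω => ‖featureMatrix Z g n ω‖ / √n := by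
  have hw := weightMoment_nonneg (F := F)
  refine bddInProb_norm_of_lintegral (M := fun n ω => featureMatrix Z g n ω)
    (fun _ _ _ => A * 3 * ∫ z, weight z ^ 6 ∂F)
    (B := Fintype.card κ * (A * 3 * ∫ z, weight z ^ 6 ∂F))
    (.of_forall fun n i l => (hg l).comp (hM.Z_meas i)) (fun _ _ _ => by positivity)
    (.of_forall fun n i l => hM.lintegral_feature_sq_le i (hg l) hA (hgA l)) ?_ ?_
  · filter_upwards [eventually_gt_atTop 0] with n hn
    exact Real.sqrt_pos.2 (by exact_mod_cast hn)
  · refine .of_forall fun n => le_of_eq ?_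
    rw [Real.sq_sqrt (Nat.cast_nonneg n)]
    simp
    ring

lemma bddInProb_row_feature (hM : IsNoisyDistanceModel P F Z E σ γ ξ K)
    (hg : ∀ l, Measurable (g l)) (hA : 0 ≤ A) (hgA : ∀ l z, g l z ^ 2 ≤ A * weight z) (i : ℕ) :
    BddInProb P fun n ω => ‖rowSelector n i * featureMatrix Z g n ω‖ / 1 := by
  have hw := weightMoment_nonneg (F := F)
  refine bddInProb_norm_of_lintegral (M := fun n ω => rowSelector n i * featureMatrix Z g n ω)
    (a := fun _ => 1) (fun _ _ _ => A * 3 * ∫ z, weight z ^ 6 ∂F)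
    (B := Fintype.card κ * (A * 3 * ∫ z, weight z ^ 6 ∂F))
    ?_ (fun _ _ _ => by positivity) ?_ (.of_forall fun n => one_pos) ?_
  · filter_upwards [eventually_gt_atTop i] with n hn a l
    simp only [rowSelector_mul_apply hn]
    exact (hg l).comp (hM.Z_meas i)
  · filter_upwards [eventually_gt_atTop i] with n hn a l
    simp only [rowSelector_mul_apply hn]
    exact hM.lintegral_feature_sq_le i (hg l) hA (hgA l)
  · refine .of_forall fun n => le_of_eq ?_
    simp

/-- There are `n` rows, each a centered sum of `n` terms with second moment of order `n`;
cancellation thus gives order `n`. -/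
lemma bddInProb_noise_mul_feature (hM : IsNoisyDistanceModel P F Z E σ γ ξ K)
    (hg : ∀ l, Measurable (g l)) (hA : 0 ≤ A) (hgA : ∀ l z, g l z ^ 2 ≤ A * weight z) :
    BddInProb P fun n ω => ‖modelNoise Z E σ n ω * featureMatrix Z g n ω‖ / n := by
  have hw := weightMoment_nonneg (F := F)
  have hnb := noiseBound_nonneg σ γ ξ K
  refine bddInProb_norm_of_lintegral
    (M := fun n ω => modelNoise Z E σ n ω * featureMatrix Z g n ω)
    (fun n _ _ => 2 * noiseBound σ γ ξ K * A * 3 * (∫ z, weight z ^ 6 ∂F) * n)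
    (B := Fintype.card κ * (2 * noiseBound σ γ ξ K * A * 3 * (∫ z, weight z ^ 6 ∂F)))
    (.of_forall fun n i l => ?_) (fun _ _ _ => by positivity)
    (.of_forall fun n i l => ?_) ?_ ?_
  · simp only [Matrix.mul_apply]
    exact Finset.measurable_sum _ fun j _ =>
      (hM.measurable_modelNoise n i j).mul ((hg l).comp (hM.Z_meas j))
  · exact hM.lintegral_row_sq_le i (hg l) hA (hgA l)
  · filter_upwards [eventually_gt_atTop 0] with n hn
    exact_mod_cast hn
  · refine .of_forall fun n => le_of_eq ?_
    simp
    ring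

/-- A bilinear form is a sum of `n²` essentially uncorrelated terms, hence again of order `n`. This
extra cancellation over the trivial bound is what makes `Qᵀ Q - 1` of second order. -/
lemma bddInProb_feature_mul_noise_mul_feature (hM : IsNoisyDistanceModel P F Z E σ γ ξ K)
    (hg : ∀ l, Measurable (g l)) (hg' : ∀ l, Measurable (g' l)) (hA : 0 ≤ A)
    (hgA : ∀ l z, g l z ^ 2 ≤ A * weight z) (hgA' : ∀ l z, g' l z ^ 2 ≤ A * weight z) :
    BddInProb P fun n ω =>
      ‖(featureMatrix Z g n ω)ᵀ * modelNoise Z E σ n ω * featureMatrix Z g' n ω‖ / n := by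
  have hw := weightMoment_nonneg (F := F)
  have hnb := noiseBound_nonneg σ γ ξ K
  have happ : ∀ n ω k l,
      ((featureMatrix Z g n ω)ᵀ * modelNoise Z E σ n ω * featureMatrix Z g' n ω) k l
        = ∑ i : Fin n, ∑ j : Fin n, g k (Z i ω) * g' l (Z j ω) *
          effectiveNoise (distMatrix fun k : Fin n => Z k ω) (E n ω) σ i j := by
    intro n ω k l
    simp only [Matrix.mul_apply, Finset.sum_mul, Matrix.transpose_apply, featureMatrix,
      Matrix.of_apply, modelNoise]
    rw [Finset.sum_comm]
    exact Finset.sum_congr rfl fun i _ => Finset.sum_congr rfl fun j _ => by ring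
  refine bddInProb_norm_of_lintegral
    (M := fun n ω => (featureMatrix Z g n ω)ᵀ * modelNoise Z E σ n ω * featureMatrix Z g' n ω)
    (fun n _ _ => 2 * noiseBound σ γ ξ K * A ^ 2 * 3 * (∫ z, weight z ^ 6 ∂F) * n ^ 2)
    (B := Fintype.card κ * (Fintype.card κ' *
      (2 * noiseBound σ γ ξ K * A ^ 2 * 3 * (∫ z, weight z ^ 6 ∂F))))
    (.of_forall fun n k l => ?_) (fun _ _ _ => by positivity)
    (.of_forall fun n k l => ?_) ?_ ?_
  · simp only [happ]
    exact Finset.measurable_sum _ fun i _ => Finset.measurable_sum _ fun j _ =>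
      (((hg k).comp (hM.Z_meas i)).mul ((hg' l).comp (hM.Z_meas j))).mul
        (hM.measurable_modelNoise n i j)
  · simp only [happ]
    exact hM.lintegral_bilinear_sq_le n (hg k) (hg' l) hA (hgA k) (hgA' l)
  · filter_upwards [eventually_gt_atTop 0] with n hn
    exact_mod_cast hn
  · refine .of_forall fun n => le_of_eq ?_
    simp
    ring

lemma bddInProb_row_noise (hM : IsNoisyDistanceModel P F Z E σ γ ξ K) (i : ℕ) :
    BddInProb P fun n ω => ‖rowSelector n i * modelNoise Z E σ n ω‖ / √n := by
  have hw := weightMoment_nonneg (F := F)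
  have hnb := noiseBound_nonneg σ γ ξ K
  refine bddInProb_norm_of_lintegral (M := fun n ω => rowSelector n i * modelNoise Z E σ n ω)
    (fun _ _ _ => noiseBound σ γ ξ K * 3 * ∫ z, weight z ^ 6 ∂F)
    (B := noiseBound σ γ ξ K * 3 * ∫ z, weight z ^ 6 ∂F)
    ?_ (fun _ _ _ => by positivity) ?_ ?_ ?_
  · filter_upwards [eventually_gt_atTop i] with n hn a l
    simp only [rowSelector_mul_apply hn]
    exact hM.measurable_modelNoise n _ l
  · filter_upwards [eventually_gt_atTop i] with n hn a l
    simp only [rowSelector_mul_apply hn]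
    exact hM.lintegral_entry_sq_le _ l
  · filter_upwards [eventually_gt_atTop 0] with n hn
    exact Real.sqrt_pos.2 (by exact_mod_cast hn)
  · refine .of_forall fun n => le_of_eq ?_
    rw [Real.sq_sqrt (Nat.cast_nonneg n)]
    simp
    ring

lemma bddInProb_row_noise_mul_feature (hM : IsNoisyDistanceModel P F Z E σ γ ξ K)
    (hg : ∀ l, Measurable (g l)) (hA : 0 ≤ A) (hgA : ∀ l z, g l z ^ 2 ≤ A * weight z) (i : ℕ) :
    BddInProb P fun n ω =>
      ‖rowSelector n i * modelNoise Z E σ n ω * featureMatrix Z g n ω‖ / √n := by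
  have hw := weightMoment_nonneg (F := F)
  have hnb := noiseBound_nonneg σ γ ξ K
  refine bddInProb_norm_of_lintegral
    (M := fun n ω => rowSelector n i * modelNoise Z E σ n ω * featureMatrix Z g n ω)
    (fun n _ _ => 2 * noiseBound σ γ ξ K * A * 3 * (∫ z, weight z ^ 6 ∂F) * n)
    (B := Fintype.card κ * (2 * noiseBound σ γ ξ K * A * 3 * (∫ z, weight z ^ 6 ∂F)))
    ?_ (fun _ _ _ => by positivity) ?_ ?_ ?_
  · filter_upwards [eventually_gt_atTop i] with n hn a l
    simp only [Matrix.mul_assoc, rowSelector_mul_apply hn]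
    simp only [Matrix.mul_apply]
    exact Finset.measurable_sum _ fun j _ =>
      (hM.measurable_modelNoise n _ j).mul ((hg l).comp (hM.Z_meas j))
  · filter_upwards [eventually_gt_atTop i] with n hn a l
    simp only [Matrix.mul_assoc, rowSelector_mul_apply hn]
    exact hM.lintegral_row_sq_le _ (hg l) hA (hgA l)
  · filter_upwards [eventually_gt_atTop 0] with n hn
    exact Real.sqrt_pos.2 (by exact_mod_cast hn)
  · refine .of_forall fun n => le_of_eq ?_
    rw [Real.sq_sqrt (Nat.cast_nonneg n)]
    simp
    ring

lemma bddInProb_row_noise_mul_noise_mul_feature (hM : IsNoisyDistanceModel P F Z E σ γ ξ K)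
    (hg : ∀ l, Measurable (g l)) (hA : 0 ≤ A) (hgA : ∀ l z, g l z ^ 2 ≤ A * weight z) (i : ℕ) :
    BddInProb P fun n ω => ‖rowSelector n i * modelNoise Z E σ n ω * modelNoise Z E σ n ω
      * featureMatrix Z g n ω‖ / n := by
  have hw := weightMoment_nonneg (F := F)
  have hnb := noiseBound_nonneg σ γ ξ K
  have happ : ∀ n (hn : i < n) ω a l, (rowSelector n i * modelNoise Z E σ n ω *
      modelNoise Z E σ n ω * featureMatrix Z g n ω) a l
        = ∑ k : Fin n, (∑ j : Fin n, modelNoise Z E σ n ω ⟨i, hn⟩ j * modelNoise Z E σ n ω j k)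
          * g l (Z k ω) := by
    intro n hn ω a l
    rw [Matrix.mul_assoc (rowSelector n i), Matrix.mul_assoc (rowSelector n i),
      rowSelector_mul_apply hn]
    simp only [Matrix.mul_apply, featureMatrix, Matrix.of_apply]
  refine bddInProb_norm_of_lintegral
    (M := fun n ω => rowSelector n i * modelNoise Z E σ n ω * modelNoise Z E σ n ω
      * featureMatrix Z g n ω)
    (fun n _ _ => 2 * (noiseBound σ γ ξ K ^ 2 + noiseBound σ γ ξ K) * A * 3 *
      (∫ z, weight z ^ 6 ∂F) * n ^ 2)
    (B := Fintype.card κ * (2 * (noiseBound σ γ ξ K ^ 2 + noiseBound σ γ ξ K) * A * 3 *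
      (∫ z, weight z ^ 6 ∂F)))
    ?_ (fun _ _ _ => by positivity) ?_ ?_ ?_
  · filter_upwards [eventually_gt_atTop i] with n hn a l
    simp only [happ n hn]
    exact Finset.measurable_sum _ fun k _ => (Finset.measurable_sum _ fun j _ =>
      (hM.measurable_modelNoise n _ j).mul (hM.measurable_modelNoise n _ k)).mul
        ((hg l).comp (hM.Z_meas k))
  · filter_upwards [eventually_gt_atTop i] with n hn a l
    simp only [happ n hn]
    exact hM.lintegral_sq_row_sq_le _ (hg l) hA (hgA l)
  · filter_upwards [eventually_gt_atTop 0] with n hn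
    exact_mod_cast hn
  · refine .of_forall fun n => le_of_eq ?_
    simp
    ring

/-- The `n` diagonal entries of order `n` and the `n²` off-diagonal entries of order `√n` both
contribute `n³` to the squared norm. Through `frobenius_norm_mul_sq_le` this bounds the operator
norm of `H` by order `n^{3/4}`. -/
lemma bddInProb_noise_mul_noise (hM : IsNoisyDistanceModel P F Z E σ γ ξ K) :
    BddInProb P fun n ω => ‖modelNoise Z E σ n ω * modelNoise Z E σ n ω‖ / (√n * n) := by
  have hw := weightMoment_nonneg (F := F)
  have hnb := noiseBound_nonneg σ γ ξ K
  refine bddInProb_norm_of_lintegral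
    (M := fun n ω => modelNoise Z E σ n ω * modelNoise Z E σ n ω)
    (fun n i k => (noiseBound σ γ ξ K ^ 2 + noiseBound σ γ ξ K) * 3 *
          (∫ z, weight z ^ 6 ∂F) * (if k = i then (n : ℝ) ^ 2 else n))
    (B := (noiseBound σ γ ξ K ^ 2 + noiseBound σ γ ξ K) * 3 * (∫ z, weight z ^ 6 ∂F) * 2)
    (.of_forall fun n i k => ?_) (fun n i k => ?_)
    (.of_forall fun n i k => ?_) ?_ ?_
  · simp only [Matrix.mul_apply]
    exact Finset.measurable_sum _ fun j _ =>
      (hM.measurable_modelNoise n i j).mul (hM.measurable_modelNoise n j k)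
  · split_ifs <;> positivity
  · simp only [Matrix.mul_apply]
    refine (hM.lintegral_sq_entry_sq_le i k).trans (le_of_eq ?_)
    push_cast
    rfl
  · filter_upwards [eventually_gt_atTop 0] with n hn
    have : (0 : ℝ) < n := by exact_mod_cast hn
    positivity
  · refine .of_forall fun n => ?_
    simp only [← Finset.mul_sum]
    have h1 : ∀ i : Fin n, ∑ k : Fin n, (if k = i then (n : ℝ) ^ 2 else n) ≤ 2 * (n : ℝ) ^ 2 := by
      intro i
      calc ∑ k : Fin n, (if k = i then (n : ℝ) ^ 2 else n)
          ≤ ∑ k : Fin n, ((if k = i then (n : ℝ) ^ 2 else (0 : ℝ)) + (n : ℝ)) := by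
            refine Finset.sum_le_sum fun k _ => ?_
            split_ifs <;> simp
        _ = 2 * (n : ℝ) ^ 2 := by
            simp [Finset.sum_add_distrib]
            ring
    refine (mul_le_mul_of_nonneg_left (Finset.sum_le_sum fun i _ => h1 i)
      (by positivity)).trans (le_of_eq ?_)
    rw [mul_pow, Real.sq_sqrt (Nat.cast_nonneg n)]
    simp
    ring

end IsNoisyDistanceModel

end StochasticBounds

/-! ### Measurability, limits and norm inequalities for matrices. -/

section MatrixFunctions

open Matrix

variable {κ : Type*} [Fintype κ] [DecidableEq κ] {Ω : Type*} [MeasurableSpace Ω]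

lemma measurable_matrix_det {A : Ω → Matrix κ κ ℝ} (hA : ∀ i j, Measurable fun ω => A ω i j) :
    Measurable fun ω => (A ω).det := by
  simp only [Matrix.det_apply]
  refine Finset.measurable_sum _ fun s _ => Measurable.const_smul ?_ _
  exact Finset.measurable_prod _ fun i _ => hA _ _

lemma measurable_matrix_inv_apply {A : Ω → Matrix κ κ ℝ} (hA : ∀ i j, Measurable fun ω => A ω i j)
    (i j : κ) : Measurable fun ω => (A ω)⁻¹ i j := by
  simp only [Matrix.inv_def, Matrix.smul_apply, Ring.inverse_eq_inv', smul_eq_mul,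
    Matrix.adjugate_apply]
  refine (measurable_matrix_det hA).inv.mul (measurable_matrix_det fun k l => ?_)
  simp only [Matrix.updateRow_apply]
  split_ifs
  · exact measurable_const
  · exact hA k l

lemma measurable_matrix_mul_apply {ι ι' ι'' : Type*} [Fintype ι'] {A : Ω → Matrix ι ι' ℝ}
    {B : Ω → Matrix ι' ι'' ℝ} (hA : ∀ i j, Measurable fun ω => A ω i j)
    (hB : ∀ i j, Measurable fun ω => B ω i j) (i : ι) (j : ι'') :
    Measurable fun ω => (A ω * B ω) i j := by
  simp only [Matrix.mul_apply]
  exact Finset.measurable_sum _ fun k _ => (hA i k).mul (hB k j)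

open scoped Matrix.Norms.Frobenius in
lemma measurable_frobenius_norm {ι ι' : Type*} [Fintype ι] [Fintype ι'] {A : Ω → Matrix ι ι' ℝ}
    (hA : ∀ i j, Measurable fun ω => A ω i j) : Measurable fun ω => ‖A ω‖ := by
  have : ∀ ω, ‖A ω‖ = √(∑ i, ∑ j, A ω i j ^ 2) := fun ω => by
    rw [← frobenius_norm_sq, Real.sqrt_sq (norm_nonneg _)]
  simp only [this]
  exact (Finset.measurable_sum _ fun i _ => Finset.measurable_sum _ fun j _ =>
    (hA i j).pow_const 2).sqrt

lemma tendsto_matrix_inv_apply {ι : Type*} {l : Filter ι} {A : ι → Matrix κ κ ℝ} {B : Matrix κ κ ℝ}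
    (hA : ∀ i j, Tendsto (fun n => A n i j) l (𝓝 (B i j))) (hB : B.det ≠ 0) (i j : κ) :
    Tendsto (fun n => (A n)⁻¹ i j) l (𝓝 (B⁻¹ i j)) := by
  have h1 : Tendsto A l (𝓝 B) := tendsto_pi_nhds.2 fun i => tendsto_pi_nhds.2 fun j => hA i j
  have h2 : ContinuousAt Ring.inverse B.det := by
    rw [Ring.inverse_eq_inv']
    exact continuousAt_inv₀ hB
  have h3 := (continuousAt_matrix_inv B h2).tendsto.comp h1
  exact tendsto_pi_nhds.1 (tendsto_pi_nhds.1 h3 i) j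

lemma eventually_matrix_det_ne_zero {ι : Type*} {l : Filter ι} {A : ι → Matrix κ κ ℝ}
    {B : Matrix κ κ ℝ} (hA : ∀ i j, Tendsto (fun n => A n i j) l (𝓝 (B i j))) (hB : B.det ≠ 0) :
    ∀ᶠ n in l, (A n).det ≠ 0 := by
  have h1 : Tendsto A l (𝓝 B) := tendsto_pi_nhds.2 fun i => tendsto_pi_nhds.2 fun j => hA i j
  have h2 : Tendsto (fun n => (A n).det) l (𝓝 B.det) :=
    (Continuous.matrix_det continuous_id).continuousAt.tendsto.comp h1
  exact h2.eventually_ne hB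

open scoped Matrix.Norms.Frobenius in
lemma tendsto_frobenius_norm_zero {ι ι' ι'' : Type*} [Fintype ι'] [Fintype ι''] {l : Filter ι}
    {A : ι → Matrix ι' ι'' ℝ} (hA : ∀ i j, Tendsto (fun n => A n i j) l (𝓝 0)) :
    Tendsto (fun n => ‖A n‖) l (𝓝 0) := by
  have : ∀ n, ‖A n‖ = √(∑ i, ∑ j, A n i j ^ 2) := fun n => by
    rw [← frobenius_norm_sq, Real.sqrt_sq (norm_nonneg _)]
  simp only [this]
  have h : Tendsto (fun n => ∑ i, ∑ j, A n i j ^ 2) l (𝓝 (∑ i : ι', ∑ j : ι'', (0 : ℝ) ^ 2)) :=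
    tendsto_finsetSum _ fun i _ => tendsto_finsetSum _ fun j _ => (hA i j).pow 2
  have := h.sqrt
  simpa using this

-- Symmetry turns `‖H M‖²` into the inner product of `M` with `H² M`, and Cauchy–Schwarz does the
-- rest. The gain is that `H²` has a far smaller Frobenius norm than the square of that of `H`
-- suggests.
open scoped Matrix.Norms.Frobenius in
lemma frobenius_norm_mul_sq_le {ι ι' : Type*} [Fintype ι] [Fintype ι'] {H : Matrix ι ι ℝ}
    (hH : Hᵀ = H) (M : Matrix ι ι' ℝ) : ‖H * M‖ ^ 2 ≤ ‖H * H‖ * ‖M‖ ^ 2 := by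
  have h1 : ‖H * M‖ ^ 2 = ∑ x : ι × ι', M x.1 x.2 * (H * H * M) x.1 x.2 := by
    rw [frobenius_norm_sq_eq_trace, transpose_mul, hH, Matrix.mul_assoc, ← Matrix.mul_assoc H H,
      Fintype.sum_prod_type, Finset.sum_comm]
    simp [Matrix.trace, Matrix.mul_apply (M := Mᵀ)]
  have h2 : ∀ A : Matrix ι ι' ℝ, √(∑ x : ι × ι', A x.1 x.2 ^ 2) = ‖A‖ := fun A => by
    have h := frobenius_norm_sq A
    rw [← Fintype.sum_prod_type' (f := fun i j => A i j ^ 2)] at h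
    rw [← h, Real.sqrt_sq (norm_nonneg _)]
  have h3 := Real.sum_mul_le_sqrt_mul_sqrt Finset.univ (fun x : ι × ι' => M x.1 x.2)
    (fun x => (H * H * M) x.1 x.2)
  rw [h2, h2] at h3
  rw [h1]
  calc _ ≤ ‖M‖ * ‖H * H * M‖ := h3
    _ ≤ ‖M‖ * (‖H * H‖ * ‖M‖) :=
      mul_le_mul_of_nonneg_left (frobenius_norm_mul_le_of_le le_rfl le_rfl) (norm_nonneg _)
    _ = _ := by ring

end MatrixFunctions

/-! ### Sample means and the sample covariance matrix. -/

section LawOfLargeNumbers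

open Matrix
open scoped Matrix.Norms.Frobenius

/-- The coordinates of a point relative to the mean of `F`. -/
noncomputable def centeredCoord {d : ℕ} (F : Measure (EuclideanSpace ℝ (Fin d))) (l : Fin d)
    (z : EuclideanSpace ℝ (Fin d)) : ℝ :=
  z l - ∫ v, v l ∂F

lemma measurable_centeredCoord {d : ℕ} (F : Measure (EuclideanSpace ℝ (Fin d))) (l : Fin d) :
    Measurable (centeredCoord F l) := by
  unfold centeredCoord; fun_prop

/-- A constant bounding squared features by the weight. -/
noncomputable def featureBound {d : ℕ} (F : Measure (EuclideanSpace ℝ (Fin d))) : ℝ :=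
  2 + 2 * ∑ l, (∫ v, v l ∂F) ^ 2

lemma one_le_featureBound {d : ℕ} (F : Measure (EuclideanSpace ℝ (Fin d))) :
    1 ≤ featureBound F := by
  have : 0 ≤ ∑ l, (∫ v, v l ∂F) ^ 2 := Finset.sum_nonneg fun l _ => sq_nonneg _
  unfold featureBound; linarith

lemma one_sq_le_featureBound_mul {d : ℕ} (F : Measure (EuclideanSpace ℝ (Fin d)))
    (z : EuclideanSpace ℝ (Fin d)) : (1 : ℝ) ^ 2 ≤ featureBound F * weight z := by
  have := one_le_mul_of_one_le_of_one_le (one_le_featureBound F) (one_le_weight z)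
  simpa using this

lemma centeredCoord_sq_le {d : ℕ} (F : Measure (EuclideanSpace ℝ (Fin d))) (l : Fin d)
    (z : EuclideanSpace ℝ (Fin d)) : centeredCoord F l z ^ 2 ≤ featureBound F * weight z := by
  have h1 : z l ^ 2 ≤ ‖z‖ ^ 2 := by
    rw [EuclideanSpace.norm_sq_eq]
    refine le_trans (by simp) (Finset.single_le_sum (fun k _ => sq_nonneg ‖z k‖)
      (Finset.mem_univ l))
  have h2 : (∫ v, v l ∂F) ^ 2 ≤ ∑ l, (∫ v, v l ∂F) ^ 2 :=
    Finset.single_le_sum (f := fun l => (∫ v, v l ∂F) ^ 2) (fun k _ => sq_nonneg _)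
      (Finset.mem_univ l)
  unfold centeredCoord featureBound weight
  set m := ∫ v, v l ∂F
  set s := ∑ l, (∫ v, v l ∂F) ^ 2
  have h3 : 0 ≤ s := (sq_nonneg _).trans h2
  nlinarith only [sq_nonneg (z l + m), h1, h2, h3, mul_nonneg h3 (sq_nonneg ‖z‖)]

variable {Ω : Type*} [MeasurableSpace Ω]

namespace IsNoisyDistanceModel

variable {d : ℕ} {P : Measure Ω} [IsProbabilityMeasure P]
  {F : Measure (EuclideanSpace ℝ (Fin d))}
  {Z : ℕ → Ω → EuclideanSpace ℝ (Fin d)} {E : (n : ℕ) → Ω → Matrix (Fin n) (Fin n) ℝ}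
  {σ γ ξ K : ℝ}

lemma ae_tendsto_average (hM : IsNoisyDistanceModel P F Z E σ γ ξ K)
    {f : EuclideanSpace ℝ (Fin d) → ℝ} (hf : Measurable f) (hfi : Integrable f F) :
    ∀ᵐ ω ∂P, Tendsto (fun n : ℕ => (n : ℝ)⁻¹ * ∑ j : Fin n, f (Z j ω)) atTop
      (𝓝 (∫ z, f z ∂F)) := by
  have h0 : Integrable (fun ω => f (Z 0 ω)) P := by
    rw [← hM.Z_law 0] at hfi
    exact hfi.comp_measurable (hM.Z_meas 0)
  have hid : ∀ i, IdentDistrib (fun ω => f (Z i ω)) (fun ω => f (Z 0 ω)) P P := fun i =>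
    (IdentDistrib.mk (hM.Z_meas i).aemeasurable (hM.Z_meas 0).aemeasurable
      (by rw [hM.Z_law, hM.Z_law])).comp hf
  have := strong_law_ae (μ := P) (fun i ω => f (Z i ω)) h0
    (fun i j hij => (hM.Z_indep.indepFun hij).comp hf hf) hid
  have he : ∫ ω, f (Z 0 ω) ∂P = ∫ z, f z ∂F := by
    rw [← hM.Z_law 0, integral_map (hM.Z_meas 0).aemeasurable hf.aestronglyMeasurable]
  simp only [he, smul_eq_mul] at this
  filter_upwards [this] with ω hω
  refine hω.congr fun n => ?_
  rw [Finset.sum_range fun j => f (Z j ω)]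

lemma memLp_centeredCoord (hM : IsNoisyDistanceModel P F Z E σ γ ξ K) (l : Fin d) (p : ℕ) :
    MemLp (centeredCoord F l) p F := by
  have := hM.isProbabilityMeasure
  exact (hM.integrable_norm_coord_pow l p).sub (memLp_const (∫ v, v l ∂F))

lemma integral_centeredCoord (hM : IsNoisyDistanceModel P F Z E σ γ ξ K) (l : Fin d) :
    ∫ z, centeredCoord F l z ∂F = 0 := by
  have := hM.isProbabilityMeasure
  have h1 : Integrable (fun z : EuclideanSpace ℝ (Fin d) => z l) F := by
    have := hM.integrable_norm_coord_pow l 1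
    rwa [Nat.cast_one, memLp_one_iff_integrable] at this
  unfold centeredCoord
  rw [integral_sub h1 (integrable_const _)]
  simp

lemma integrable_centeredCoord_mul (hM : IsNoisyDistanceModel P F Z E σ γ ξ K) (k l : Fin d) :
    Integrable (fun z => centeredCoord F k z * centeredCoord F l z) F :=
  (show MemLp (centeredCoord F k) 2 F from hM.memLp_centeredCoord k 2).integrable_mul
    (show MemLp (centeredCoord F l) 2 F from hM.memLp_centeredCoord l 2)

/-- The centered sample Gram matrix, scaled by `1 / n`. -/
lemma ae_tendsto_gram (hM : IsNoisyDistanceModel P F Z E σ γ ξ K) :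
    ∀ᵐ ω ∂P, (∀ a l, Tendsto (fun n : ℕ =>
        ((n : ℝ)⁻¹ • (onesRow n * featureMatrix Z (centeredCoord F) n ω)) a l) atTop (𝓝 0)) ∧
      ∀ k l, Tendsto (fun n : ℕ => ((n : ℝ)⁻¹ •
        ((centeringMatrix n * featureMatrix Z (centeredCoord F) n ω)ᵀ *
          (centeringMatrix n * featureMatrix Z (centeredCoord F) n ω))) k l) atTop
        (𝓝 (covMatrix F k l)) := by
  have h1 : ∀ᵐ ω ∂P, ∀ l, Tendsto (fun n : ℕ =>
      (n : ℝ)⁻¹ * ∑ j : Fin n, centeredCoord F l (Z j ω)) atTop (𝓝 0) := by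
    refine ae_all_iff.2 fun l => ?_
    have hi : Integrable (centeredCoord F l) F := by
      have := hM.memLp_centeredCoord l 1
      rwa [Nat.cast_one, memLp_one_iff_integrable] at this
    simpa only [hM.integral_centeredCoord l] using
      hM.ae_tendsto_average (measurable_centeredCoord F l) hi
  have h2 : ∀ᵐ ω ∂P, ∀ k l, Tendsto (fun n : ℕ =>
      (n : ℝ)⁻¹ * ∑ j : Fin n, centeredCoord F k (Z j ω) * centeredCoord F l (Z j ω)) atTop
        (𝓝 (covMatrix F k l)) :=
    ae_all_iff.2 fun k => ae_all_iff.2 fun l => hM.ae_tendsto_average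
      ((measurable_centeredCoord F k).mul (measurable_centeredCoord F l))
      (hM.integrable_centeredCoord_mul k l)
  filter_upwards [h1, h2] with ω h1 h2
  have h3 : ∀ a l, Tendsto (fun n : ℕ =>
        ((n : ℝ)⁻¹ • (onesRow n * featureMatrix Z (centeredCoord F) n ω)) a l) atTop (𝓝 0) := by
    intro a l
    refine (h1 l).congr fun n => ?_
    simp [Matrix.mul_apply, onesRow, featureMatrix]
  refine ⟨h3, fun k l => ?_⟩
  -- The sample covariance is the average of products minus the product of averages; the latter
  -- vanishes in the limit since the coordinates are centered at `μ`.
  have h4 := (h2 k l).sub ((h3 0 k).mul (h3 0 l))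
  rw [mul_zero, sub_zero] at h4
  refine h4.congr' ?_
  filter_upwards [eventually_gt_atTop 0] with n hn
  have hn0 : (n : ℝ) ≠ 0 := by positivity
  set Y := featureMatrix Z (centeredCoord F) n ω with hY
  have e1 : (centeringMatrix n * Y)ᵀ * (centeringMatrix n * Y)
      = Yᵀ * Y - (n : ℝ)⁻¹ • ((onesRow n * Y)ᵀ * (onesRow n * Y)) := by
    rw [transpose_mul, transpose_centeringMatrix, Matrix.mul_assoc,
      ← Matrix.mul_assoc (centeringMatrix n), centeringMatrix_mul_self hn, centeringMatrix_eq,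
      Matrix.sub_mul, Matrix.mul_sub, Matrix.one_mul, Matrix.smul_mul, Matrix.mul_smul,
      transpose_mul]
    simp only [Matrix.mul_assoc]
  rw [e1]
  have e2 : (Yᵀ * Y) k l
      = ∑ j : Fin n, centeredCoord F k (Z j ω) * centeredCoord F l (Z j ω) := by
    simp [Matrix.mul_apply, hY, featureMatrix]
  have e3 : ((onesRow n * Y)ᵀ * (onesRow n * Y)) k l
      = (onesRow n * Y) 0 k * (onesRow n * Y) 0 l := by
    rw [Matrix.mul_apply]
    exact Fintype.sum_unique _
  simp only [Matrix.smul_apply, Matrix.sub_apply, e2, e3, smul_eq_mul]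
  field_simp

lemma measurable_gram (hM : IsNoisyDistanceModel P F Z E σ γ ξ K) (n : ℕ) (k l : Fin d) :
    Measurable fun ω => ((centeringMatrix n * featureMatrix Z (centeredCoord F) n ω)ᵀ *
          (centeringMatrix n * featureMatrix Z (centeredCoord F) n ω)) k l := by
  have h : ∀ i l, Measurable fun ω =>
      (centeringMatrix n * featureMatrix Z (centeredCoord F) n ω) i l :=
    measurable_matrix_mul_apply (fun i j => measurable_const) fun i l =>
      (measurable_centeredCoord F l).comp (hM.Z_meas i)
  exact measurable_matrix_mul_apply (fun i j => h j i) h k l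

lemma nullInProb_mean (hM : IsNoisyDistanceModel P F Z E σ γ ξ K) : NullInProb P fun n ω =>
    ‖(n : ℝ)⁻¹ • (onesRow n * featureMatrix Z (centeredCoord F) n ω)‖ := by
  refine NullInProb.of_ae_tendsto (fun n => measurable_frobenius_norm fun a l => ?_) ?_
  · have h : Measurable fun ω => (onesRow n * featureMatrix Z (centeredCoord F) n ω) a l :=
      measurable_matrix_mul_apply (A := fun _ => onesRow n) (fun _ _ => measurable_const)
        (fun i l => (measurable_centeredCoord F l).comp (hM.Z_meas i)) a l
    exact h.const_mul _
  · filter_upwards [hM.ae_tendsto_gram] with ω hω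
    exact tendsto_frobenius_norm_zero hω.1

lemma nullInProb_gram_inv (hM : IsNoisyDistanceModel P F Z E σ γ ξ K)
    (hΞ : (covMatrix F).det ≠ 0) : NullInProb P fun n ω =>
    ‖((n : ℝ)⁻¹ • ((centeringMatrix n * featureMatrix Z (centeredCoord F) n ω)ᵀ *
          (centeringMatrix n * featureMatrix Z (centeredCoord F) n ω)))⁻¹ - (covMatrix F)⁻¹‖ := by
  refine NullInProb.of_ae_tendsto (fun n => measurable_frobenius_norm fun k l => ?_) ?_
  · refine Measurable.sub (measurable_matrix_inv_apply (fun i j => ?_) k l) measurable_const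
    exact (hM.measurable_gram n i j).const_mul _
  · filter_upwards [hM.ae_tendsto_gram] with ω hω
    refine tendsto_frobenius_norm_zero fun k l => ?_
    have := (tendsto_matrix_inv_apply hω.2 hΞ k l).sub_const ((covMatrix F)⁻¹ k l)
    rwa [sub_self] at this

/-- Almost sure convergence to the nonsingular `Ξ` makes the determinant eventually nonzero. Applied
to the indicator of singularity, it gives vanishing probabilities. -/
lemma tendsto_measure_gram_singular (hM : IsNoisyDistanceModel P F Z E σ γ ξ K)
    (hΞ : (covMatrix F).det ≠ 0) : Tendsto (fun n : ℕ => P.real {ω |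
      ¬ ((n : ℝ)⁻¹ • ((centeringMatrix n * featureMatrix Z (centeredCoord F) n ω)ᵀ *
          (centeringMatrix n * featureMatrix Z (centeredCoord F) n ω))).det ≠ 0})
      atTop (𝓝 0) := by
  classical
  have h := NullInProb.of_ae_tendsto (P := P) (f := fun n ω =>
    if ((n : ℝ)⁻¹ • ((centeringMatrix n * featureMatrix Z (centeredCoord F) n ω)ᵀ *
          (centeringMatrix n * featureMatrix Z (centeredCoord F) n ω))).det = 0 then (1 : ℝ) else 0)
    (fun n => ?_) ?_
  · refine tendsto_measureReal_zero_of_le (h (1 / 2) (by norm_num)) (.of_forall fun n ω hω => ?_)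
    have h0 := not_not.1 hω
    show (1 / 2 : ℝ) < |if _ then (1 : ℝ) else 0|
    rw [if_pos h0]
    norm_num
  · refine Measurable.ite ?_ measurable_const measurable_const
    exact (measurable_matrix_det fun k l => (hM.measurable_gram n k l).const_mul _)
      (measurableSet_singleton 0)
  · filter_upwards [hM.ae_tendsto_gram] with ω hω
    refine tendsto_const_nhds.congr' ?_
    filter_upwards [eventually_matrix_det_ne_zero hω.2 hΞ] with n hn
    exact (if_neg hn).symm

end IsNoisyDistanceModel

end LawOfLargeNumbers

/-! ### Linearization of a row of the embedding, in probability. -/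

section Remainder

open Matrix
open scoped Matrix.Norms.Frobenius

variable {Ω : Type*} [MeasurableSpace Ω]

lemma norm_rowSelector_le (n i : ℕ) : ‖rowSelector n i‖ ≤ 1 := by
  have h : ‖rowSelector n i‖ ^ 2 ≤ 1 := by
    rw [frobenius_norm_sq]
    simp only [Finset.univ_unique, Finset.sum_singleton, rowSelector, Matrix.of_apply]
    by_cases hi : i < n
    · have : ∀ j : Fin n, (j : ℕ) = i ↔ j = ⟨i, hi⟩ := fun j => by simp [Fin.ext_iff]
      simp [this]
    · have : ∀ j : Fin n, (j : ℕ) ≠ i := fun j => by omega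
      simp [this]
  nlinarith only [h, norm_nonneg (rowSelector n i)]

lemma rowSelector_mul_onesRow_transpose {n i : ℕ} (h : i < n) :
    rowSelector n i * (onesRow n)ᵀ = 1 := by
  ext a b
  rw [rowSelector_mul_apply h, Subsingleton.elim a b]
  simp [onesRow]

namespace IsNoisyDistanceModel

variable {d : ℕ} {P : Measure Ω} [IsProbabilityMeasure P]
  {F : Measure (EuclideanSpace ℝ (Fin d))}
  {Z : ℕ → Ω → EuclideanSpace ℝ (Fin d)} {E : (n : ℕ) → Ω → Matrix (Fin n) (Fin n) ℝ}
  {σ γ ξ K : ℝ}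

lemma transpose_modelNoise (hM : IsNoisyDistanceModel P F Z E σ γ ξ K) (n : ℕ) (ω : Ω) :
    (modelNoise Z E σ n ω)ᵀ = modelNoise Z E σ n ω := by
  ext i j
  exact congrFun ((hM.isWignerArray fun k : Fin n => Z k ω).symm j i) ω

/-- The sum of all normalized quantities that are bounded in probability. -/
lemma bddInProb_all (hM : IsNoisyDistanceModel P F Z E σ γ ξ K) (i : ℕ) :
    BddInProb P fun n ω =>
      ‖featureMatrix Z (centeredCoord F) n ω‖ / √n
      + ‖rowSelector n i * featureMatrix Z (centeredCoord F) n ω‖ / 1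
      + ‖modelNoise Z E σ n ω * featureMatrix Z (centeredCoord F) n ω‖ / n
      + ‖modelNoise Z E σ n ω * (onesRow n)ᵀ‖ / n
      + ‖(featureMatrix Z (centeredCoord F) n ω)ᵀ * modelNoise Z E σ n ω
          * featureMatrix Z (centeredCoord F) n ω‖ / n
      + ‖onesRow n * modelNoise Z E σ n ω * featureMatrix Z (centeredCoord F) n ω‖ / n
      + ‖onesRow n * modelNoise Z E σ n ω * (onesRow n)ᵀ‖ / n
      + ‖rowSelector n i * modelNoise Z E σ n ω‖ / √n
      + ‖rowSelector n i * modelNoise Z E σ n ω * featureMatrix Z (centeredCoord F) n ω‖ / √n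
      + ‖rowSelector n i * modelNoise Z E σ n ω * (onesRow n)ᵀ‖ / √n
      + ‖rowSelector n i * modelNoise Z E σ n ω * modelNoise Z E σ n ω
          * featureMatrix Z (centeredCoord F) n ω‖ / n
      + ‖rowSelector n i * modelNoise Z E σ n ω * modelNoise Z E σ n ω * (onesRow n)ᵀ‖ / n := by
  have hA : 0 ≤ featureBound F := zero_le_one.trans (one_le_featureBound F)
  have m1 := measurable_centeredCoord F
  have b1 := centeredCoord_sq_le F
  have m2 : ∀ _ : Fin 1, Measurable fun _ : EuclideanSpace ℝ (Fin d) => (1 : ℝ) :=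
    fun _ => measurable_const
  have b2 : ∀ (_ : Fin 1) z, (1 : ℝ) ^ 2 ≤ featureBound F * weight z :=
    fun _ => one_sq_le_featureBound_mul F
  exact (hM.bddInProb_feature m1 hA b1).add
    (hM.bddInProb_row_feature m1 hA b1 i) |>.add
    (hM.bddInProb_noise_mul_feature m1 hA b1) |>.add
    (hM.bddInProb_noise_mul_feature m2 hA b2) |>.add
    (hM.bddInProb_feature_mul_noise_mul_feature m1 m1 hA b1 b1) |>.add
    (hM.bddInProb_feature_mul_noise_mul_feature m2 m1 hA b2 b1) |>.add
    (hM.bddInProb_feature_mul_noise_mul_feature m2 m2 hA b2 b2) |>.add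
    (hM.bddInProb_row_noise i) |>.add
    (hM.bddInProb_row_noise_mul_feature m1 hA b1 i) |>.add
    (hM.bddInProb_row_noise_mul_feature m2 hA b2 i) |>.add
    (hM.bddInProb_row_noise_mul_noise_mul_feature m1 hA b1 i) |>.add
    (hM.bddInProb_row_noise_mul_noise_mul_feature m2 hA b2 i)

lemma nullInProb_noise_mul_noise (hM : IsNoisyDistanceModel P F Z E σ γ ξ K) :
    NullInProb P fun n ω => (√(n : ℝ))⁻¹ *
      (‖modelNoise Z E σ n ω * modelNoise Z E σ n ω‖ / (√n * n)) := by
  refine hM.bddInProb_noise_mul_noise.nullInProb_const_mul ?_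
  exact tendsto_inv_atTop_zero.comp (Real.tendsto_sqrt_atTop.comp tendsto_natCast_atTop_atTop)

set_option maxHeartbeats 1000000 in
/-- The scaled embedding error in a row is asymptotically linear in the noise. -/
theorem nullInProb_remainder (hM : IsNoisyDistanceModel P F Z E σ γ ξ K)
    (hΞ : (covMatrix F).det ≠ 0)
    {Xhat : (n : ℕ) → Ω → Matrix (Fin n) (Fin d) ℝ}
    (hX : ∀ n ω, IsCMDSEmbedding (distMatrix (fun k : Fin n => Z k ω) + E n ω) (Xhat n ω))
    {W : (n : ℕ) → Ω → Matrix (Fin d) (Fin d) ℝ}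
    (hWo : ∀ n ω, W n ω ∈ orthogonalGroup (Fin d) ℝ)
    {Q : (n : ℕ) → Ω → Matrix (Fin d) (Fin d) ℝ}
    (hQ : ∀ n ω, Q n ω = (centeringMatrix n * featureMatrix Z (centeredCoord F) n ω)ᵀ * Xhat n ω
      * ((Xhat n ω)ᵀ * Xhat n ω)⁻¹)
    (hW : ∀ n ω, 0 < n → ‖Q n ω * W n ω - 1‖ ≤ ‖(Q n ω)ᵀ * Q n ω - 1‖ + (n : ℝ)⁻¹) (i : ℕ) :
    NullInProb P fun n ω => √(n : ℝ) * ‖rowSelector n i *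
        (Xhat n ω * W n ω - centeringMatrix n * featureMatrix Z (centeredCoord F) n ω)
      + (n : ℝ)⁻¹ • (rowSelector n i * modelNoise Z E σ n ω
        * featureMatrix Z (centeredCoord F) n ω * (covMatrix F)⁻¹)‖ := by
  set Ψ := (covMatrix F)⁻¹ with hΨ
  -- All tight quantities are collected in one sum, controlled by `C`; those tending to zero form
  -- the event at level `η`. On both events the deterministic expansion applies.
  refine nullInProb_of_control (hM.bddInProb_all i) (S := fun η n ω =>
    (‖(n : ℝ)⁻¹ • (onesRow n * featureMatrix Z (centeredCoord F) n ω)‖ ≤ η ∧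
      (√(n : ℝ))⁻¹ * (‖modelNoise Z E σ n ω * modelNoise Z E σ n ω‖ / (√n * n)) ≤ η ^ 2) ∧
    (‖((n : ℝ)⁻¹ • ((centeringMatrix n * featureMatrix Z (centeredCoord F) n ω)ᵀ *
          (centeringMatrix n * featureMatrix Z (centeredCoord F) n ω)))⁻¹ - Ψ‖ ≤ η ∧
      ((n : ℝ)⁻¹ • ((centeringMatrix n * featureMatrix Z (centeredCoord F) n ω)ᵀ *
          (centeringMatrix n * featureMatrix Z (centeredCoord F) n ω))).det ≠ 0)) ?_ ?_
  · intro η hη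
    refine tendsto_measureReal_zero_of_le (tendsto_measureReal_zero_union
      (tendsto_measureReal_zero_union (hM.nullInProb_mean η hη)
        (hM.nullInProb_noise_mul_noise (η ^ 2) (by positivity)))
      (tendsto_measureReal_zero_union (hM.nullInProb_gram_inv hΞ η hη)
        (hM.tendsto_measure_gram_singular hΞ))) (.of_forall fun n ω hω => ?_)
    simp only [Set.mem_ofPred_eq, not_and_or, not_le] at hω
    refine hω.imp (Or.imp (fun h => ?_) fun h => ?_) (Or.imp (fun h => ?_) fun h => h)
    · exact h.trans_le (le_abs_self _)
    · exact h.trans_le (le_abs_self _)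
    · exact h.trans_le (le_abs_self _)
  · intro C hC
    -- A single constant that also dominates `‖Ψ‖` and the Frobenius norm `√d` of an orthogonal
    -- matrix.
    set D := C + ‖Ψ‖ + √d with hD
    have hCD : C ≤ D := by
      have := norm_nonneg Ψ
      have := Real.sqrt_nonneg d
      linarith
    have hD1 : 1 ≤ D := hC.trans hCD
    have hΨD : ‖Ψ‖ ≤ D := by
      have := Real.sqrt_nonneg d
      linarith
    have hdD : √d ≤ D := by
      have := norm_nonneg Ψ
      linarith
    have hD0 : 0 < D := by linarith
    set τ : ℝ := σ ^ 2 / 2 with hτ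
    have hτ0 : 0 ≤ τ := by positivity
    -- The constant is copied from `cmds_row_expansion_of_noise`, and `η₀` is the largest value
    -- allowed by its two smallness conditions on `η`.
    refine ⟨22 * (4 * ((2 * τ + 4) ^ 2 * D ^ 2) * (d + 1)) ^ 11 * (2 * τ + 4)
        + (4 * τ + 7) * D ^ 2, by positivity,
      min 1 (1 / 2 / (4 * ((2 * τ + 4) ^ 2 * D ^ 2) * (d + 1) * (2 * τ + 4))), by positivity, ?_⟩
    intro η hη hη0
    have hη1 : η ≤ 1 := hη0.trans (min_le_left _ _)
    have hη2 : 4 * ((2 * τ + 4) ^ 2 * D ^ 2) * (d + 1) * ((2 * τ + 4) * η) ≤ 1 / 2 := by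
      have := hη0.trans (min_le_right _ _)
      rw [le_div_iff₀ (by positivity)] at this
      linarith
    have hev : ∀ᶠ n : ℕ in atTop, 1 ≤ η * √n :=
      ((Real.tendsto_sqrt_atTop.comp tendsto_natCast_atTop_atTop).const_mul_atTop hη
        |>.eventually_ge_atTop 1)
    filter_upwards [hev, eventually_gt_atTop i, eventually_ge_atTop d, eventually_gt_atTop 0]
      with n hηn hin hdn hn ω hB hS
    obtain ⟨⟨hm, hHH⟩, hG, hdet⟩ := hS
    have hn0 : (0 : ℝ) < n := by exact_mod_cast hn
    have hr0 : 0 < √(n : ℝ) := Real.sqrt_pos.2 hn0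
    have hsq : √(n : ℝ) * √n = n := Real.mul_self_sqrt hn0.le
    rw [abs_of_nonneg (mul_nonneg hr0.le (norm_nonneg _))]
    set Y := featureMatrix Z (centeredCoord F) n ω with hY
    set H := modelNoise Z E σ n ω with hH
    set e := rowSelector n i with he
    set o := onesRow n with ho
    set X := centeringMatrix n * Y with hXdef
    replace hB := (le_abs_self _).trans hB
    have p1 : 0 ≤ ‖Y‖ / √n := div_nonneg (norm_nonneg _) hr0.le
    have p2 : 0 ≤ ‖e * Y‖ / 1 := div_nonneg (norm_nonneg _) zero_le_one
    have p3 : 0 ≤ ‖H * Y‖ / n := div_nonneg (norm_nonneg _) hn0.le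
    have p4 : 0 ≤ ‖H * oᵀ‖ / n := div_nonneg (norm_nonneg _) hn0.le
    have p5 : 0 ≤ ‖Yᵀ * H * Y‖ / n := div_nonneg (norm_nonneg _) hn0.le
    have p6 : 0 ≤ ‖o * H * Y‖ / n := div_nonneg (norm_nonneg _) hn0.le
    have p7 : 0 ≤ ‖o * H * oᵀ‖ / n := div_nonneg (norm_nonneg _) hn0.le
    have p8 : 0 ≤ ‖e * H‖ / √n := div_nonneg (norm_nonneg _) hr0.le
    have p9 : 0 ≤ ‖e * H * Y‖ / √n := div_nonneg (norm_nonneg _) hr0.le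
    have p10 : 0 ≤ ‖e * H * oᵀ‖ / √n := div_nonneg (norm_nonneg _) hr0.le
    have p11 : 0 ≤ ‖e * H * H * Y‖ / n := div_nonneg (norm_nonneg _) hn0.le
    have p12 : 0 ≤ ‖e * H * H * oᵀ‖ / n := div_nonneg (norm_nonneg _) hn0.le
    have hXX : Xᵀ * X = (n : ℝ) • ((n : ℝ)⁻¹ • (Xᵀ * X)) := by
      rw [smul_smul, mul_inv_cancel₀ hn0.ne', one_smul]
    set S := (n : ℝ)⁻¹ • (Xᵀ * X) with hSdef
    have hSu : IsUnit S.det := isUnit_iff_ne_zero.2 hdet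
    have hHs : Hᵀ = H := hM.transpose_modelNoise n ω
    refine cmds_row_expansion_of_noise (G := (n : ℝ)⁻¹ • S⁻¹) (Ψ := Ψ) (W := W n ω) (C := D)
      (η := η) (τ := τ) hn hdn (hX n ω) hXdef ?_ hHs ?_
      (rowSelector_mul_onesRow_transpose hin) (norm_rowSelector_le n i) hτ0 hD1 hη1 hηn hη2
      ?_ ?_ hm ?_ ?_ ?_ ?_ ?_ ?_ ?_ ?_ ?_ ?_ ?_ hΨD ?_ ?_ ?_
    · have := doubleCentered_distMatrix_add hn (fun k : Fin n => Z k ω)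
        (WithLp.toLp 2 fun l => ∫ v, v l ∂F) (E n ω) (hM.E_hollow n ω) σ
      exact this
    · rw [hXX, Matrix.smul_mul, Matrix.mul_smul, smul_smul, inv_mul_cancel₀ hn0.ne', one_smul,
        Matrix.nonsing_inv_mul _ hSu]
    · rw [← div_le_iff₀ hr0]; linarith
    · rw [← div_one ‖e * Y‖]; linarith
    · intro m M
      -- This is what the event of level `η²` says; taking roots gives the operator bound `η n` for
      -- `H`.
      have h1 : ‖H * H‖ ≤ η ^ 2 * n ^ 2 := by
        rw [inv_mul_eq_div, div_div, div_le_iff₀ (by positivity)] at hHH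
        refine hHH.trans (le_of_eq ?_)
        linear_combination η ^ 2 * n * hsq
      have h2 : ‖H * M‖ ^ 2 ≤ (η * n * ‖M‖) ^ 2 := by
        refine (frobenius_norm_mul_sq_le hHs M).trans ?_
        rw [mul_pow, mul_pow]
        exact mul_le_mul_of_nonneg_right h1 (sq_nonneg _)
      exact le_of_sq_le_sq h2 (mul_nonneg (mul_nonneg hη.le hn0.le) (norm_nonneg _))
    · rw [← div_le_iff₀ hn0]; linarith
    · rw [← div_le_iff₀ hn0]; linarith
    · rw [← div_le_iff₀ hn0]; linarith
    · rw [← div_le_iff₀ hn0]; linarith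
    · rw [← div_le_iff₀ hn0]; linarith
    · rw [← div_le_iff₀ hr0]; linarith
    · rw [← div_le_iff₀ hr0]; linarith
    · rw [← div_le_iff₀ hr0]; linarith
    · rw [← div_le_iff₀ hn0]; linarith
    · rw [← div_le_iff₀ hn0]; linarith
    · rwa [smul_smul, mul_inv_cancel₀ hn0.ne', one_smul]
    · rw [frobenius_norm_orthogonal (hWo n ω)]
      simpa using hdD
    · have := hW n ω hn
      rwa [hQ] at this

end IsNoisyDistanceModel

end Remainder

/-! ### Conditional central limit theorem for a row of the noise. -/

section RowCharFun

variable {Ω : Type*} [MeasurableSpace Ω]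

lemma abs_pow_three_le (x : ℝ) : |x| ^ 3 ≤ x ^ 2 + x ^ 4 := by
  have h : |x| ^ 3 = |x| * x ^ 2 := by rw [pow_succ', sq_abs]
  have h4 : x ^ 4 = x ^ 2 * |x| ^ 2 := by rw [sq_abs]; ring
  rw [h, h4]
  nlinarith only [mul_nonneg (sq_nonneg x) (sq_nonneg (|x| - 1)), sq_nonneg x,
    mul_nonneg (sq_nonneg x) (sq_nonneg |x|)]

namespace IsNoisyDistanceModel

variable {d : ℕ} {P : Measure Ω} [IsProbabilityMeasure P]
  {F : Measure (EuclideanSpace ℝ (Fin d))}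
  {Z : ℕ → Ω → EuclideanSpace ℝ (Fin d)} {E : (n : ℕ) → Ω → Matrix (Fin n) (Fin n) ℝ}
  {σ γ ξ K : ℝ}

lemma integral_noise_config (hM : IsNoisyDistanceModel P F Z E σ γ ξ K) {n : ℕ}
    {f : (Fin n × Fin n → ℝ) × (Fin n → EuclideanSpace ℝ (Fin d)) → ℂ} (hf : Measurable f)
    (hb : ∀ p, ‖f p‖ ≤ 1) :
    Integrable (fun ω' => ∫ ω, f (fun p => E n ω p.1 p.2, fun k => Z k ω') ∂P) P ∧
    ∫ ω, f (fun p => E n ω p.1 p.2, fun k => Z k ω) ∂P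
      = ∫ ω', ∫ ω, f (fun p => E n ω p.1 p.2, fun k => Z k ω') ∂P ∂P := by
  have hE : Measurable fun ω (p : Fin n × Fin n) => E n ω p.1 p.2 :=
    measurable_pi_lambda _ fun p => hM.E_meas n _ _
  have hZ : Measurable fun ω (k : Fin n) => Z k ω := measurable_pi_lambda _ fun k => hM.Z_meas k
  have hmap := (indepFun_iff_map_prod_eq_prod_map_map hE.aemeasurable hZ.aemeasurable).1
    (hM.E_indep_Z n)
  have h1 : ∫ ω, f (fun p => E n ω p.1 p.2, fun k => Z k ω) ∂P
      = ∫ x, f x ∂(P.map fun ω => ((fun p : Fin n × Fin n => E n ω p.1 p.2),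
          (fun k : Fin n => Z k ω))) := by
    rw [integral_map (hE.prodMk hZ).aemeasurable hf.aestronglyMeasurable]
  have hpE : IsProbabilityMeasure (P.map fun ω (p : Fin n × Fin n) => E n ω p.1 p.2) :=
    Measure.isProbabilityMeasure_map hE.aemeasurable
  have hpZ : IsProbabilityMeasure (P.map fun ω (k : Fin n) => Z k ω) :=
    Measure.isProbabilityMeasure_map hZ.aemeasurable
  have hint : Integrable f ((P.map fun ω (p : Fin n × Fin n) => E n ω p.1 p.2).prod
      (P.map fun ω (k : Fin n) => Z k ω)) :=
    Integrable.of_bound hf.aestronglyMeasurable 1 (.of_forall hb)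
  have h2 : ∀ z, ∫ e, f (e, z) ∂(P.map fun ω (p : Fin n × Fin n) => E n ω p.1 p.2)
      = ∫ ω, f (fun p => E n ω p.1 p.2, z) ∂P := fun z =>
    integral_map hE.aemeasurable (hf.comp (by fun_prop)).aestronglyMeasurable
  have h3 := hint.integral_prod_right
  simp only [h2] at h3
  refine ⟨h3.comp_measurable hZ, ?_⟩
  rw [h1, hmap, integral_prod_symm _ hint]
  simp only [h2]
  rw [integral_map hZ.aemeasurable h3.aestronglyMeasurable]

lemma integral_abs_effectiveNoise_pow_three_le (hM : IsNoisyDistanceModel P F Z E σ γ ξ K) {n : ℕ}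
    (z : Fin n → EuclideanSpace ℝ (Fin d)) (i j : Fin n) :
    ∫ ω, |effectiveNoise (distMatrix z) (E n ω) σ i j| ^ 3 ∂P
      ≤ 2 * noiseBound σ γ ξ K * (weight (z i) ^ 2 * weight (z j) ^ 2) := by
  have hw := hM.isWignerArray z
  have hnb := noiseBound_nonneg σ γ ξ K
  have h4 : Integrable (fun ω => effectiveNoise (distMatrix z) (E n ω) σ i j ^ 4) P :=
    (integrable_mul_four (hw.memLp i j) (hw.memLp i j) (hw.memLp i j) (hw.memLp i j)).congr
      (.of_forall fun ω => by ring)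
  have h2 : Integrable (fun ω => effectiveNoise (distMatrix z) (E n ω) σ i j ^ 2) P :=
    (hw.memLp_two i j).integrable_sq
  have hwi := one_le_weight (z i)
  have hwj := one_le_weight (z j)
  have h5 : weight (z i) * weight (z j) ≤ weight (z i) ^ 2 * weight (z j) ^ 2 := by
    rw [← mul_pow]
    exact le_self_pow₀ (one_le_mul_of_one_le_of_one_le hwi hwj) two_ne_zero
  calc ∫ ω, |effectiveNoise (distMatrix z) (E n ω) σ i j| ^ 3 ∂P
      ≤ ∫ ω, (effectiveNoise (distMatrix z) (E n ω) σ i j ^ 2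
          + effectiveNoise (distMatrix z) (E n ω) σ i j ^ 4) ∂P :=
        integral_mono_of_nonneg (.of_forall fun ω => by positivity) (h2.add h4)
          (.of_forall fun ω => abs_pow_three_le _)
    _ ≤ noiseBound σ γ ξ K * (weight (z i) * weight (z j))
        + noiseBound σ γ ξ K * (weight (z i) ^ 2 * weight (z j) ^ 2) := by
        rw [integral_add h2 h4]
        exact add_le_add (hM.integral_effectiveNoise_sq_le z i j)
          (hM.integral_effectiveNoise_pow_four_le z i j)
    _ ≤ _ := by linarith [mul_le_mul_of_nonneg_left h5 hnb]

/-- Gaussian approximation of a row of the noise, given the points. -/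
lemma norm_integral_exp_row_sub_le (hM : IsNoisyDistanceModel P F Z E σ γ ξ K)
    {f : EuclideanSpace ℝ (Fin d) → ℝ} {A : ℝ} (hA : 0 ≤ A) (hfA : ∀ z, f z ^ 2 ≤ A * weight z)
    {n : ℕ} (z : Fin n → EuclideanSpace ℝ (Fin d)) (i : Fin n) :
    ‖∫ ω, Complex.exp ((∑ j, (-(√(n : ℝ))⁻¹ * f (z j)) *
          effectiveNoise (distMatrix z) (E n ω) σ i j : ℝ) * Complex.I) ∂P
        - Complex.exp ((-((n : ℝ)⁻¹ * ∑ j, if j = i then 0 else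
            f (z j) ^ 2 * noiseVariance σ γ ξ ‖z i - z j‖) / 2 : ℝ))‖
      ≤ ((1 + A) ^ 2 * (2 * noiseBound σ γ ξ K + noiseBound σ γ ξ K ^ 2)) * (√(n : ℝ))⁻¹ *
        ((n : ℝ)⁻¹ * ∑ j, (weight (z i) ^ 6 + weight (z j) ^ 6 + weight (z j) ^ 6)) := by
  have hnb := noiseBound_nonneg σ γ ξ K
  have hn1 : (1 : ℝ) ≤ n := by exact_mod_cast i.pos
  have hn0 : (0 : ℝ) < n := by linarith
  set r := (√(n : ℝ))⁻¹ with hr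
  have hr0 : 0 < r := inv_pos.2 (Real.sqrt_pos.2 hn0)
  have hrr : r ^ 2 = (n : ℝ)⁻¹ := by rw [hr, inv_pow, Real.sq_sqrt hn0.le]
  have hr1 : r ≤ 1 := inv_le_one_of_one_le₀ (Real.one_le_sqrt.2 hn1)
  -- The coefficients are of size `n^{-1/2}`, so the cubic errors of `n` summands add up to order
  -- `n^{-1/2}`.
  have key := (hM.isWignerArray z).norm_integral_exp_row_sub_gaussian_le i fun j => -r * f (z j)
  have e1 : ∑ j, (-r * f (z j)) ^ 2 * ∫ ω, effectiveNoise (distMatrix z) (E n ω) σ i j ^ 2 ∂P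
      = (n : ℝ)⁻¹ * ∑ j, if j = i then 0 else
            f (z j) ^ 2 * noiseVariance σ γ ξ ‖z i - z j‖ := by
    rw [Finset.mul_sum]
    refine Finset.sum_congr rfl fun j _ => ?_
    rw [mul_pow, neg_sq, hrr]
    split_ifs with hij
    · subst hij
      simp [effectiveNoise]
    · rw [hM.integral_effectiveNoise_sq z (Ne.symm hij)]
      ring
  rw [e1] at key
  refine key.trans ?_
  rw [Finset.mul_sum, Finset.mul_sum]
  refine Finset.sum_le_sum fun j _ => ?_
  have hwi := (weight_pos (z i)).le
  have hwj := (weight_pos (z j)).le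
  have hwj1 := one_le_weight (z j)
  have hf2 : f (z j) ^ 2 ≤ A * weight (z j) := hfA _
  have hf4 : f (z j) ^ 4 ≤ A ^ 2 * weight (z j) ^ 2 := by
    have := pow_le_pow_left₀ (sq_nonneg _) hf2 2
    calc f (z j) ^ 4 = (f (z j) ^ 2) ^ 2 := by ring
      _ ≤ _ := this.trans (le_of_eq (by ring))
  have hf3 : |f (z j)| ^ 3 ≤ (1 + A) ^ 2 * weight (z j) ^ 2 := by
    have h1 : A * weight (z j) ≤ A * weight (z j) ^ 2 :=
      mul_le_mul_of_nonneg_left (le_self_pow₀ hwj1 two_ne_zero) hA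
    have h2 : 0 ≤ A * weight (z j) ^ 2 := by positivity
    have h3 : 0 ≤ weight (z j) ^ 2 := by positivity
    refine (abs_pow_three_le _).trans ((add_le_add hf2 hf4).trans ?_)
    linarith
  have hv2 : (∫ ω, effectiveNoise (distMatrix z) (E n ω) σ i j ^ 2 ∂P) ^ 2
      ≤ noiseBound σ γ ξ K ^ 2 * (weight (z i) ^ 2 * weight (z j) ^ 2) := by
    have := pow_le_pow_left₀ (integral_nonneg fun ω => sq_nonneg _)
      (hM.integral_effectiveNoise_sq_le z i j) 2
    exact this.trans (le_of_eq (by ring))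
  have hm : weight (z i) ^ 2 * weight (z j) ^ 4 * weight (z j) ^ 0
      ≤ weight (z i) ^ 6 + weight (z j) ^ 6 + weight (z j) ^ 6 :=
    weight_mul_le _ _ _ (by norm_num)
  have hAA : A ^ 2 ≤ (1 + A) ^ 2 := by nlinarith only [hA]
  calc |(-r * f (z j))| ^ 3 * ∫ ω, |effectiveNoise (distMatrix z) (E n ω) σ i j| ^ 3 ∂P
        + (-r * f (z j)) ^ 4 * (∫ ω, effectiveNoise (distMatrix z) (E n ω) σ i j ^ 2 ∂P) ^ 2
      = r ^ 3 * (|f (z j)| ^ 3 * ∫ ω, |effectiveNoise (distMatrix z) (E n ω) σ i j| ^ 3 ∂P)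
        + r ^ 4 * (f (z j) ^ 4 *
          (∫ ω, effectiveNoise (distMatrix z) (E n ω) σ i j ^ 2 ∂P) ^ 2) := by
        rw [abs_mul, abs_neg, abs_of_pos hr0]
        ring
    _ ≤ r ^ 3 * (((1 + A) ^ 2 * weight (z j) ^ 2) *
          (2 * noiseBound σ γ ξ K * (weight (z i) ^ 2 * weight (z j) ^ 2)))
        + r ^ 3 * (((1 + A) ^ 2 * weight (z j) ^ 2) *
          (noiseBound σ γ ξ K ^ 2 * (weight (z i) ^ 2 * weight (z j) ^ 2))) := by
        refine add_le_add (mul_le_mul_of_nonneg_left (mul_le_mul hf3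
          (hM.integral_abs_effectiveNoise_pow_three_le z i j)
          (integral_nonneg fun ω => by positivity) (by positivity)) (by positivity))
          (mul_le_mul (pow_le_pow_of_le_one hr0.le hr1 (by norm_num)) (mul_le_mul
            (hf4.trans (mul_le_mul_of_nonneg_right hAA (by positivity))) hv2 (sq_nonneg _)
            (by positivity)) (by positivity) (by positivity))
    _ = ((1 + A) ^ 2 * (2 * noiseBound σ γ ξ K + noiseBound σ γ ξ K ^ 2)) * r *
        ((n : ℝ)⁻¹ * (weight (z i) ^ 2 * weight (z j) ^ 4 * weight (z j) ^ 0)) := by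
        rw [← hrr]; ring
    _ ≤ _ := by gcongr

/-- The conditional variance of a row of the noise against the feature `f`. -/
noncomputable def _root_.rowVariance (f : EuclideanSpace ℝ (Fin d) → ℝ) (σ γ ξ : ℝ)
    (Z : ℕ → Ω → EuclideanSpace ℝ (Fin d)) (i n : ℕ) (z : EuclideanSpace ℝ (Fin d)) (ω : Ω) : ℝ :=
  (n : ℝ)⁻¹ * ∑ k ∈ (Finset.range n).erase i, f (Z k ω) ^ 2 * noiseVariance σ γ ξ ‖z - Z k ω‖

lemma sum_ite_eq_rowVariance (f : EuclideanSpace ℝ (Fin d) → ℝ) (σ γ ξ : ℝ)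
    (Z : ℕ → Ω → EuclideanSpace ℝ (Fin d)) {i n : ℕ} (hi : i < n) (ω : Ω) :
    ((n : ℝ)⁻¹ * ∑ j : Fin n, if j = ⟨i, hi⟩ then 0 else
      f (Z j ω) ^ 2 * noiseVariance σ γ ξ ‖Z i ω - Z j ω‖) = rowVariance f σ γ ξ Z i n (Z i ω) ω := by
  unfold rowVariance
  congr 1
  have h1 : ∀ j : Fin n, j = ⟨i, hi⟩ ↔ (j : ℕ) = i := fun j => by simp [Fin.ext_iff]
  simp only [h1]
  rw [← Finset.sum_range fun j => if j = i then 0 else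
      f (Z j ω) ^ 2 * noiseVariance σ γ ξ ‖Z i ω - Z j ω‖,
    ← Finset.sum_erase (Finset.range n) (a := i) (by simp)]
  exact Finset.sum_congr rfl fun k hk => if_neg (Finset.ne_of_mem_erase hk)

lemma measurable_noiseVariance_norm {α : Type*} [MeasurableSpace α]
    {g : α → EuclideanSpace ℝ (Fin d)} (hg : Measurable g) :
    Measurable fun a => noiseVariance σ γ ξ ‖g a‖ := by
  unfold noiseVariance
  fun_prop

/-- Fubini applies the Gaussian approximation with the points frozen; its error is an average of
weights times `n^{-1/2}`, whose expectation tends to zero. -/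
lemma tendsto_norm_integral_exp_sub (hM : IsNoisyDistanceModel P F Z E σ γ ξ K)
    {f : EuclideanSpace ℝ (Fin d) → ℝ} (hf : Measurable f) {A : ℝ} (hA : 0 ≤ A)
    (hfA : ∀ z, f z ^ 2 ≤ A * weight z) (i : ℕ) :
    Tendsto (fun n : ℕ => ‖∫ ω, Complex.exp ((-(√(n : ℝ))⁻¹ * ∑ j : Fin n,
          (rowSelector n i * modelNoise Z E σ n ω) 0 j * f (Z j ω) : ℝ) * Complex.I) ∂P
        - ∫ ω, Complex.exp ((-rowVariance f σ γ ξ Z i n (Z i ω) ω / 2 : ℝ)) ∂P‖)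
      atTop (𝓝 0) := by
  have hnb := noiseBound_nonneg σ γ ξ K
  have hw : ∀ k, Integrable (fun ω => weight (Z k ω) ^ 6) P := fun k => by
    have := hM.integrable_weight_pow
    rw [← hM.Z_law k] at this
    exact this.comp_measurable (hM.Z_meas k)
  have hw' : ∀ k, ∫ ω, weight (Z k ω) ^ 6 ∂P = ∫ z, weight z ^ 6 ∂F := fun k => by
    rw [← hM.Z_law k, integral_map (hM.Z_meas k).aemeasurable]
    exact (measurable_weight.pow_const 6).aestronglyMeasurable
  set C := (1 + A) ^ 2 * (2 * noiseBound σ γ ξ K + noiseBound σ γ ξ K ^ 2) with hC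
  have hlim : Tendsto (fun n : ℕ => C * (√(n : ℝ))⁻¹ * (3 * ∫ z, weight z ^ 6 ∂F)) atTop
      (𝓝 0) := by
    have := ((tendsto_inv_atTop_zero.comp (Real.tendsto_sqrt_atTop.comp
      tendsto_natCast_atTop_atTop)).const_mul C).mul_const (3 * ∫ z, weight z ^ 6 ∂F)
    simpa using this
  refine tendsto_of_tendsto_of_tendsto_of_le_of_le' tendsto_const_nhds hlim
    (.of_forall fun n => norm_nonneg _) ?_
  filter_upwards [eventually_gt_atTop i] with n hn
  have hn0 : (n : ℝ) ≠ 0 := by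
    have : 0 < n := by omega
    positivity
  have hrow : ∀ ω, (-(√(n : ℝ))⁻¹ * ∑ j : Fin n,
        (rowSelector n i * modelNoise Z E σ n ω) 0 j * f (Z j ω))
      = ∑ j : Fin n, (-(√(n : ℝ))⁻¹ * f (Z j ω)) *
          effectiveNoise (distMatrix fun k : Fin n => Z k ω) (E n ω) σ ⟨i, hn⟩ j := by
    intro ω
    rw [Finset.mul_sum]
    refine Finset.sum_congr rfl fun j _ => ?_
    rw [rowSelector_mul_apply hn, modelNoise]
    ring
  simp only [hrow]
  have hmeas : Measurable fun p : (Fin n × Fin n → ℝ) × (Fin n → EuclideanSpace ℝ (Fin d)) =>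
      Complex.exp ((∑ j : Fin n, (-(√(n : ℝ))⁻¹ * f (p.2 j)) *
          effectiveNoise (distMatrix p.2) (Matrix.of fun i j => p.1 (i, j)) σ ⟨i, hn⟩ j : ℝ)
          * Complex.I) := by
    refine Complex.measurable_exp.comp (Measurable.mul_const (Complex.measurable_ofReal.comp
      (Finset.measurable_sum _ fun j _ => ?_)) _)
    exact ((hf.comp (by fun_prop)).const_mul _).mul (measurable_effectiveNoise σ _ j)
  obtain ⟨hi, heq⟩ := hM.integral_noise_config hmeas
    (fun p => (Complex.norm_exp_ofReal_mul_I _).le)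
  have hE : ∀ ω, (Matrix.of fun i j => E n ω i j) = E n ω := fun ω => rfl
  simp only [hE] at hi heq
  have hZi := hM.Z_meas i
  have hexpi : Integrable
      (fun ω => Complex.exp ((-rowVariance f σ γ ξ Z i n (Z i ω) ω / 2 : ℝ))) P := by
    refine Integrable.of_bound (Measurable.aestronglyMeasurable ?_) 1 (.of_forall fun ω => ?_)
    · refine Complex.measurable_exp.comp (Complex.measurable_ofReal.comp
        (Measurable.div_const (Measurable.neg ?_) _))
      unfold rowVariance
      refine Measurable.const_mul (Finset.measurable_sum _ fun k _ => ?_) _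
      exact ((hf.comp (hM.Z_meas k)).pow_const 2).mul
        (measurable_noiseVariance_norm (hZi.sub (hM.Z_meas k)))
    · rw [← Complex.ofReal_exp, Complex.norm_real, Real.norm_of_nonneg (Real.exp_pos _).le,
        Real.exp_le_one_iff]
      have : 0 ≤ rowVariance f σ γ ξ Z i n (Z i ω) ω :=
        mul_nonneg (by positivity) (Finset.sum_nonneg fun k _ =>
          mul_nonneg (sq_nonneg _) (hM.noiseVariance_nonneg _))
      linarith
  rw [heq, ← integral_sub hi hexpi]
  have h3 : ∀ j : Fin n, Integrable (fun ω => weight (Z i ω) ^ 6 + weight (Z j ω) ^ 6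
      + weight (Z j ω) ^ 6) P := fun j => ((hw i).add (hw j)).add (hw j)
  have hbi : Integrable (fun ω => C * (√(n : ℝ))⁻¹ * ((n : ℝ)⁻¹ * ∑ j : Fin n,
      (weight (Z i ω) ^ 6 + weight (Z j ω) ^ 6 + weight (Z j ω) ^ 6))) P :=
    ((integrable_finsetSum _ fun j _ => h3 j).const_mul _).const_mul _
  refine (norm_integral_le_of_norm_le hbi (.of_forall fun ω' => ?_)).trans (le_of_eq ?_)
  · have := hM.norm_integral_exp_row_sub_le hA hfA (fun k : Fin n => Z k ω') ⟨i, hn⟩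
    rw [← sum_ite_eq_rowVariance f σ γ ξ Z hn ω']
    exact this
  · rw [integral_const_mul, integral_const_mul]
    rw [integral_finsetSum _ fun j _ => h3 j]
    have h4 : ∀ j : Fin n, ∫ ω, (weight (Z i ω) ^ 6 + weight (Z j ω) ^ 6 + weight (Z j ω) ^ 6) ∂P
        = 3 * ∫ z, weight z ^ 6 ∂F := by
      intro j
      have hpq : Integrable (fun ω => weight (Z i ω) ^ 6 + weight (Z j ω) ^ 6) P :=
        (hw i).add (hw j)
      rw [integral_add hpq (hw _), integral_add (hw _) (hw _), hw', hw']
      ring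
    simp only [h4, Finset.sum_const, Finset.card_univ, Fintype.card_fin, nsmul_eq_mul]
    rw [← mul_assoc (n : ℝ)⁻¹, inv_mul_cancel₀ hn0, one_mul]

end IsNoisyDistanceModel

end RowCharFun

/-! ### Convergence of the conditional variance of a row. -/

section RowVarianceLimit

variable {Ω : Type*} [MeasurableSpace Ω]

namespace IsNoisyDistanceModel

variable {d : ℕ} {P : Measure Ω} [IsProbabilityMeasure P]
  {F : Measure (EuclideanSpace ℝ (Fin d))}
  {Z : ℕ → Ω → EuclideanSpace ℝ (Fin d)} {E : (n : ℕ) → Ω → Matrix (Fin n) (Fin n) ℝ}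
  {σ γ ξ K : ℝ}

/-- The limiting variance of a row of the noise against the feature `f`. -/
noncomputable def _root_.limitVariance (F : Measure (EuclideanSpace ℝ (Fin d)))
    (f : EuclideanSpace ℝ (Fin d) → ℝ) (σ γ ξ : ℝ) (z : EuclideanSpace ℝ (Fin d)) : ℝ :=
  ∫ w, f w ^ 2 * noiseVariance σ γ ξ ‖z - w‖ ∂F

lemma rowVariance_nonneg (hM : IsNoisyDistanceModel P F Z E σ γ ξ K)
    (f : EuclideanSpace ℝ (Fin d) → ℝ) (i n : ℕ) (z : EuclideanSpace ℝ (Fin d)) (ω : Ω) :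
    0 ≤ rowVariance f σ γ ξ Z i n z ω :=
  mul_nonneg (by positivity) (Finset.sum_nonneg fun k _ =>
    mul_nonneg (sq_nonneg _) (hM.noiseVariance_nonneg _))

lemma limitVariance_nonneg (hM : IsNoisyDistanceModel P F Z E σ γ ξ K)
    (f : EuclideanSpace ℝ (Fin d) → ℝ) (z : EuclideanSpace ℝ (Fin d)) :
    0 ≤ limitVariance F f σ γ ξ z :=
  integral_nonneg fun w => mul_nonneg (sq_nonneg _) (hM.noiseVariance_nonneg _)

lemma integrable_sq_mul_noiseVariance (hM : IsNoisyDistanceModel P F Z E σ γ ξ K)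
    {f : EuclideanSpace ℝ (Fin d) → ℝ} (hf : Measurable f) {A : ℝ} (hA : 0 ≤ A)
    (hfA : ∀ z, f z ^ 2 ≤ A * weight z) (z : EuclideanSpace ℝ (Fin d)) :
    Integrable (fun w => f w ^ 2 * noiseVariance σ γ ξ ‖z - w‖) F := by
  have := hM.isProbabilityMeasure
  have hnb := noiseBound_nonneg σ γ ξ K
  refine Integrable.mono' (((hM.integrable_weight_pow.add hM.integrable_weight_pow).add
    (integrable_const (weight z ^ 6))).const_mul (A * noiseBound σ γ ξ K)) ?_
    (.of_forall fun w => ?_)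
  · exact ((hf.pow_const 2).mul
      (measurable_noiseVariance_norm (by fun_prop))).aestronglyMeasurable
  · have hwz := (weight_pos z).le
    have hww := (weight_pos w).le
    rw [Real.norm_of_nonneg (mul_nonneg (sq_nonneg _) (hM.noiseVariance_nonneg _))]
    calc f w ^ 2 * noiseVariance σ γ ξ ‖z - w‖
        ≤ (A * weight w) * (noiseBound σ γ ξ K * (weight z * weight w)) :=
          mul_le_mul (hfA w) (noiseVariance_le _ _ _ _ _ _) (hM.noiseVariance_nonneg _)
            (by positivity)
      _ = A * noiseBound σ γ ξ K * (weight w ^ 2 * weight w ^ 0 * weight z ^ 1) := by ring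
      _ ≤ _ := mul_le_mul_of_nonneg_left (weight_mul_le w w z (by norm_num)) (by positivity)

lemma exp_neg_half_le_one {x : ℝ} (hx : 0 ≤ x) : ‖Real.exp (-x / 2)‖ ≤ 1 := by
  rw [Real.norm_of_nonneg (Real.exp_pos _).le, Real.exp_le_one_iff]
  linarith

lemma measurable_rowVariance (hM : IsNoisyDistanceModel P F Z E σ γ ξ K)
    {f : EuclideanSpace ℝ (Fin d) → ℝ} (hf : Measurable f) (i n : ℕ)
    (z : EuclideanSpace ℝ (Fin d)) : Measurable (rowVariance f σ γ ξ Z i n z) := by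
  unfold rowVariance
  refine Measurable.const_mul (Finset.measurable_sum _ fun k _ => ?_) _
  exact ((hf.comp (hM.Z_meas k)).pow_const 2).mul
    (measurable_noiseVariance_norm (measurable_const.sub (hM.Z_meas k)))

lemma ae_tendsto_rowVariance (hM : IsNoisyDistanceModel P F Z E σ γ ξ K)
    {f : EuclideanSpace ℝ (Fin d) → ℝ} (hf : Measurable f) {A : ℝ} (hA : 0 ≤ A)
    (hfA : ∀ z, f z ^ 2 ≤ A * weight z) (i : ℕ) (z : EuclideanSpace ℝ (Fin d)) :
    ∀ᵐ ω ∂P, Tendsto (fun n => rowVariance f σ γ ξ Z i n z ω) atTop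
      (𝓝 (limitVariance F f σ γ ξ z)) := by
  have h := hM.ae_tendsto_average (f := fun w => f w ^ 2 * noiseVariance σ γ ξ ‖z - w‖)
    ((hf.pow_const 2).mul (measurable_noiseVariance_norm (by fun_prop)))
    (hM.integrable_sq_mul_noiseVariance hf hA hfA z)
  filter_upwards [h] with ω hω
  -- The omitted index `i` is a single term of the average and disappears in the limit.
  have h2 : Tendsto (fun n : ℕ => (n : ℝ)⁻¹ *
      (f (Z i ω) ^ 2 * noiseVariance σ γ ξ ‖z - Z i ω‖)) atTop (𝓝 0) := by
    simpa using (tendsto_inv_atTop_zero.comp tendsto_natCast_atTop_atTop).mul_const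
      (f (Z i ω) ^ 2 * noiseVariance σ γ ξ ‖z - Z i ω‖)
  have h3 := hω.sub h2
  rw [sub_zero] at h3
  refine h3.congr' ?_
  filter_upwards [eventually_gt_atTop i] with n hn
  unfold rowVariance
  rw [← Finset.sum_range fun j => f (Z j ω) ^ 2 * noiseVariance σ γ ξ ‖z - Z j ω‖,
    ← Finset.add_sum_erase _ _ (Finset.mem_range.2 hn)]
  ring

/-- The sum defining `rowVariance` omits the index `i`, so `Z i` is independent of it and can be
replaced by a fixed `z` averaged over `F`. This is where the mixture over `z` originates. -/
lemma integral_exp_rowVariance (hM : IsNoisyDistanceModel P F Z E σ γ ξ K)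
    {f : EuclideanSpace ℝ (Fin d) → ℝ} (hf : Measurable f) (i n : ℕ) :
    AEStronglyMeasurable (fun z => ∫ ω, Real.exp (-rowVariance f σ γ ξ Z i n z ω / 2) ∂P) F ∧
    ∫ ω, Real.exp (-rowVariance f σ γ ξ Z i n (Z i ω) ω / 2) ∂P
      = ∫ z, ∫ ω, Real.exp (-rowVariance f σ γ ξ Z i n z ω / 2) ∂P ∂F := by
  have := hM.isProbabilityMeasure
  set T := (Finset.range n).erase i with hT
  have hZT : Measurable fun ω (k : T) => Z k ω := measurable_pi_lambda _ fun k => hM.Z_meas k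
  have hind : IndepFun (Z i) (fun ω (k : T) => Z k ω) P := by
    have h := hM.Z_indep.indepFun_finset {i} T (by simp [hT]) hM.Z_meas
    exact h.comp (φ := fun a : ({i} : Finset ℕ) → EuclideanSpace ℝ (Fin d) =>
      a ⟨i, Finset.mem_singleton_self i⟩) (ψ := id)
      (measurable_pi_apply (⟨i, Finset.mem_singleton_self i⟩ : ({i} : Finset ℕ))) measurable_id
  have hmap := (indepFun_iff_map_prod_eq_prod_map_map (hM.Z_meas i).aemeasurable
    hZT.aemeasurable).1 hind
  rw [hM.Z_law i] at hmap
  set G : EuclideanSpace ℝ (Fin d) × (T → EuclideanSpace ℝ (Fin d)) → ℝ := fun p =>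
    Real.exp (-((n : ℝ)⁻¹ * ∑ k : T, f (p.2 k) ^ 2 * noiseVariance σ γ ξ ‖p.1 - p.2 k‖) / 2) with hG
  have hGm : Measurable G := by
    refine Real.measurable_exp.comp (Measurable.div_const (Measurable.neg
      (Measurable.const_mul (Finset.measurable_sum _ fun k _ => ?_) _)) _)
    exact ((hf.comp (by fun_prop)).pow_const 2).mul (measurable_noiseVariance_norm (by fun_prop))
  have hGe : ∀ z ω, G (z, fun k : T => Z k ω) = Real.exp (-rowVariance f σ γ ξ Z i n z ω / 2) := by
    intro z ω
    simp only [hG, rowVariance]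
    rw [← hT, Finset.sum_coe_sort T fun k => f (Z k ω) ^ 2 * noiseVariance σ γ ξ ‖z - Z k ω‖]
  have hGb : ∀ p, ‖G p‖ ≤ 1 := fun p => exp_neg_half_le_one (mul_nonneg (by positivity)
    (Finset.sum_nonneg fun k _ => mul_nonneg (sq_nonneg _) (hM.noiseVariance_nonneg _)))
  have hpT : IsProbabilityMeasure (P.map fun ω (k : T) => Z k ω) :=
    Measure.isProbabilityMeasure_map hZT.aemeasurable
  have hint : Integrable G (F.prod (P.map fun ω (k : T) => Z k ω)) :=
    Integrable.of_bound hGm.aestronglyMeasurable 1 (.of_forall hGb)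
  have h1 : ∀ z, ∫ b, G (z, b) ∂(P.map fun ω (k : T) => Z k ω)
      = ∫ ω, Real.exp (-rowVariance f σ γ ξ Z i n z ω / 2) ∂P := by
    intro z
    have hGz : Measurable fun b => G (z, b) := hGm.comp measurable_prodMk_left
    rw [integral_map hZT.aemeasurable hGz.aestronglyMeasurable]
    simp only [hGe]
  have h2 := hint.integral_prod_left
  simp only [h1] at h2
  refine ⟨h2.aestronglyMeasurable, ?_⟩
  have h3 : ∫ ω, Real.exp (-rowVariance f σ γ ξ Z i n (Z i ω) ω / 2) ∂P
      = ∫ p, G p ∂(P.map fun ω => (Z i ω, fun k : T => Z k ω)) := by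
    rw [integral_map ((hM.Z_meas i).prodMk hZT).aemeasurable hGm.aestronglyMeasurable]
    simp only [hGe]
  rw [h3, hmap, integral_prod _ hint]
  simp only [h1]

/-- Dominated convergence twice: over the sample at frozen `z`, where the law of large numbers
applies, and then over `z`. The exponential of a nonpositive number supplies the bound `1`. -/
lemma tendsto_integral_exp_rowVariance (hM : IsNoisyDistanceModel P F Z E σ γ ξ K)
    {f : EuclideanSpace ℝ (Fin d) → ℝ} (hf : Measurable f) {A : ℝ} (hA : 0 ≤ A)
    (hfA : ∀ z, f z ^ 2 ≤ A * weight z) (i : ℕ) :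
    Tendsto (fun n => ∫ ω, Real.exp (-rowVariance f σ γ ξ Z i n (Z i ω) ω / 2) ∂P) atTop
      (𝓝 (∫ z, Real.exp (-limitVariance F f σ γ ξ z / 2) ∂F)) := by
  have := hM.isProbabilityMeasure
  simp only [(hM.integral_exp_rowVariance hf i _).2]
  refine tendsto_integral_of_dominated_convergence (fun _ => (1 : ℝ))
    (fun n => (hM.integral_exp_rowVariance hf i n).1) (integrable_const _)
    (fun n => .of_forall fun z => ?_) (.of_forall fun z => ?_)
  · refine (norm_integral_le_of_norm_le_const (C := 1) (.of_forall fun ω =>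
      exp_neg_half_le_one (hM.rowVariance_nonneg f i n z ω))).trans (by simp)
  · have h : Tendsto (fun n => ∫ ω, Real.exp (-rowVariance f σ γ ξ Z i n z ω / 2) ∂P) atTop
        (𝓝 (∫ _, Real.exp (-limitVariance F f σ γ ξ z / 2) ∂P)) := by
      refine tendsto_integral_of_dominated_convergence (fun _ => (1 : ℝ))
        (fun n => ?_) (integrable_const _)
        (fun n => .of_forall fun ω => exp_neg_half_le_one (hM.rowVariance_nonneg f i n z ω)) ?_
      · exact (Real.measurable_exp.comp
          ((hM.measurable_rowVariance hf i n z).neg.div_const 2)).aestronglyMeasurable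
      · filter_upwards [hM.ae_tendsto_rowVariance hf hA hfA i z] with ω hω
        exact (Real.continuous_exp.tendsto _).comp (hω.neg.div_const 2)
    simpa using h

/-- The characteristic function of a normalized row sum converges. -/
theorem tendsto_integral_exp_row (hM : IsNoisyDistanceModel P F Z E σ γ ξ K)
    {f : EuclideanSpace ℝ (Fin d) → ℝ} (hf : Measurable f) {A : ℝ} (hA : 0 ≤ A)
    (hfA : ∀ z, f z ^ 2 ≤ A * weight z) (i : ℕ) :
    Tendsto (fun n : ℕ => ∫ ω, Complex.exp ((-(√(n : ℝ))⁻¹ * ∑ j : Fin n,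
          (rowSelector n i * modelNoise Z E σ n ω) 0 j * f (Z j ω) : ℝ) * Complex.I) ∂P)
      atTop (𝓝 ((∫ z, Real.exp (-limitVariance F f σ γ ξ z / 2) ∂F : ℝ) : ℂ)) := by
  have h1 := tendsto_zero_iff_norm_tendsto_zero.2 (hM.tendsto_norm_integral_exp_sub hf hA hfA i)
  have h2 := (Complex.continuous_ofReal.tendsto _).comp
    (hM.tendsto_integral_exp_rowVariance hf hA hfA i)
  have h3 := h1.add h2
  rw [zero_add] at h3
  refine h3.congr fun n => ?_
  rw [Function.comp_apply, ← integral_complex_ofReal]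
  simp only [Complex.ofReal_exp, sub_add_cancel]

end IsNoisyDistanceModel

end RowVarianceLimit

/-! ### The Gaussian mixture and its null boundaries. -/

section Mixture

open Matrix

variable {Ω : Type*} [MeasurableSpace Ω] {d : ℕ}

lemma transpose_covMatrix (F : Measure (EuclideanSpace ℝ (Fin d))) :
    (covMatrix F)ᵀ = covMatrix F := by
  ext k l
  exact covariance_comm _ _

lemma transpose_sigmaTilde (F : Measure (EuclideanSpace ℝ (Fin d))) (σ γ ξ : ℝ)
    (z : EuclideanSpace ℝ (Fin d)) : (sigmaTilde F σ γ ξ z)ᵀ = sigmaTilde F σ γ ξ z := by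
  ext k l
  simp only [Matrix.transpose_apply, sigmaTilde, Matrix.of_apply]
  exact integral_congr_ae (.of_forall fun w => by ring)

lemma transpose_sigmaMatrix (F : Measure (EuclideanSpace ℝ (Fin d))) (σ γ ξ : ℝ)
    (z : EuclideanSpace ℝ (Fin d)) : (sigmaMatrix F σ γ ξ z)ᵀ = sigmaMatrix F σ γ ξ z := by
  rw [sigmaMatrix, transpose_mul, transpose_mul, transpose_nonsing_inv, transpose_covMatrix,
    transpose_sigmaTilde, Matrix.mul_assoc]

/-- The linear feature of a point whose noisy sum gives the limit in direction `t`. -/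
noncomputable def dualFeature (F : Measure (EuclideanSpace ℝ (Fin d))) (t : Fin d → ℝ)
    (w : EuclideanSpace ℝ (Fin d)) : ℝ :=
  ∑ l, centeredCoord F l w * ((covMatrix F)⁻¹ *ᵥ t) l

lemma measurable_dualFeature (F : Measure (EuclideanSpace ℝ (Fin d))) (t : Fin d → ℝ) :
    Measurable (dualFeature F t) :=
  Finset.measurable_sum _ fun l _ => (measurable_centeredCoord F l).mul_const _

/-- A constant bounding the square of the dual feature by the weight. -/
noncomputable def dualFeatureBound (F : Measure (EuclideanSpace ℝ (Fin d))) (t : Fin d → ℝ) : ℝ :=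
  d * featureBound F * ∑ l, ((covMatrix F)⁻¹ *ᵥ t) l ^ 2

lemma dualFeatureBound_nonneg (F : Measure (EuclideanSpace ℝ (Fin d))) (t : Fin d → ℝ) :
    0 ≤ dualFeatureBound F t :=
  mul_nonneg (mul_nonneg (Nat.cast_nonneg d) (zero_le_one.trans (one_le_featureBound F)))
    (Finset.sum_nonneg fun l _ => sq_nonneg _)

lemma dualFeature_sq_le (F : Measure (EuclideanSpace ℝ (Fin d))) (t : Fin d → ℝ)
    (w : EuclideanSpace ℝ (Fin d)) : dualFeature F t w ^ 2 ≤ dualFeatureBound F t * weight w := by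
  refine (Finset.sum_mul_sq_le_sq_mul_sq _ _ _).trans ?_
  have h : ∑ l, centeredCoord F l w ^ 2 ≤ d * (featureBound F * weight w) := by
    refine (Finset.sum_le_sum fun l _ => centeredCoord_sq_le F l w).trans (le_of_eq ?_)
    simp
  refine (mul_le_mul_of_nonneg_right h (Finset.sum_nonneg fun l _ => sq_nonneg _)).trans
    (le_of_eq ?_)
  unfold dualFeatureBound
  ring

namespace IsNoisyDistanceModel

variable {P : Measure Ω} [IsProbabilityMeasure P]
  {F : Measure (EuclideanSpace ℝ (Fin d))}
  {Z : ℕ → Ω → EuclideanSpace ℝ (Fin d)} {E : (n : ℕ) → Ω → Matrix (Fin n) (Fin n) ℝ}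
  {σ γ ξ K : ℝ}

/-- Expanding the square of the linear form and integrating term by term; the mixed products are
integrable since `|a b| ≤ a² + b²`. -/
lemma dotProduct_sigmaTilde_mulVec (hM : IsNoisyDistanceModel P F Z E σ γ ξ K)
    (z : EuclideanSpace ℝ (Fin d)) (u : Fin d → ℝ) :
    u ⬝ᵥ sigmaTilde F σ γ ξ z *ᵥ u
      = limitVariance F (fun w => ∑ l, centeredCoord F l w * u l) σ γ ξ z := by
  have hA : 0 ≤ featureBound F := zero_le_one.trans (one_le_featureBound F)
  have hi : ∀ k l, Integrable (fun w => noiseVariance σ γ ξ ‖z - w‖ *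
      (centeredCoord F k w * centeredCoord F l w)) F := by
    intro k l
    have h1 := fun k => hM.integrable_sq_mul_noiseVariance (measurable_centeredCoord F k) hA
      (centeredCoord_sq_le F k) z
    refine Integrable.mono' ((h1 k).add (h1 l)) ?_ (.of_forall fun w => ?_)
    · exact ((measurable_noiseVariance_norm (by fun_prop)).mul
        ((measurable_centeredCoord F k).mul (measurable_centeredCoord F l))).aestronglyMeasurable
    · have hv := hM.noiseVariance_nonneg ‖z - w‖
      rw [Real.norm_eq_abs, abs_mul, abs_of_nonneg hv, abs_mul]
      have h2 : |centeredCoord F k w| * |centeredCoord F l w|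
          ≤ centeredCoord F k w ^ 2 + centeredCoord F l w ^ 2 := by
        rw [← sq_abs (centeredCoord F k w), ← sq_abs (centeredCoord F l w)]
        nlinarith only [sq_nonneg (|centeredCoord F k w| - |centeredCoord F l w|),
          sq_nonneg |centeredCoord F k w|, sq_nonneg |centeredCoord F l w|]
      refine (mul_le_mul_of_nonneg_left h2 hv).trans (le_of_eq ?_)
      simp only [Pi.add_apply]
      ring
  have hexp : ∀ w, (∑ l, centeredCoord F l w * u l) ^ 2 * noiseVariance σ γ ξ ‖z - w‖
      = ∑ k, ∑ l, u k * u l * (noiseVariance σ γ ξ ‖z - w‖ *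
        (centeredCoord F k w * centeredCoord F l w)) := by
    intro w
    rw [sq, Finset.sum_mul_sum, Finset.sum_mul]
    refine Finset.sum_congr rfl fun k _ => ?_
    rw [Finset.sum_mul]
    exact Finset.sum_congr rfl fun l _ => by ring
  unfold limitVariance
  simp only [hexp]
  rw [integral_finsetSum _ fun k _ => integrable_finsetSum _ fun l _ => (hi k l).const_mul _]
  simp only [dotProduct, mulVec, Finset.mul_sum]
  refine Finset.sum_congr rfl fun k _ => ?_
  rw [integral_finsetSum _ fun l _ => (hi k l).const_mul _]
  refine Finset.sum_congr rfl fun l _ => ?_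
  rw [integral_const_mul]
  simp only [sigmaTilde, Matrix.of_apply]
  change u k * ((∫ w, noiseVariance σ γ ξ ‖z - w‖ *
        (centeredCoord F k w * centeredCoord F l w) ∂F) * u l) = _
  ring

lemma dotProduct_sigmaMatrix_mulVec (hM : IsNoisyDistanceModel P F Z E σ γ ξ K)
    (z : EuclideanSpace ℝ (Fin d)) (t : Fin d → ℝ) :
    t ⬝ᵥ sigmaMatrix F σ γ ξ z *ᵥ t = limitVariance F (dualFeature F t) σ γ ξ z := by
  have h := hM.dotProduct_sigmaTilde_mulVec z ((covMatrix F)⁻¹ *ᵥ t)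
  unfold dualFeature
  rw [← h, sigmaMatrix, ← Matrix.mulVec_mulVec, ← Matrix.mulVec_mulVec, Matrix.dotProduct_mulVec,
    ← Matrix.mulVec_transpose, transpose_nonsing_inv, transpose_covMatrix]

lemma posSemidef_sigmaMatrix (hM : IsNoisyDistanceModel P F Z E σ γ ξ K)
    (z : EuclideanSpace ℝ (Fin d)) : (sigmaMatrix F σ γ ξ z).PosSemidef := by
  refine Matrix.posSemidef_iff_dotProduct_mulVec.2 ⟨?_, fun x => ?_⟩
  · rw [Matrix.IsHermitian, Matrix.conjTranspose_eq_transpose_of_trivial, transpose_sigmaMatrix]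
  · rw [star_trivial, hM.dotProduct_sigmaMatrix_mulVec]
    exact hM.limitVariance_nonneg _ _

lemma charFun_gaussian_sigmaMatrix (hM : IsNoisyDistanceModel P F Z E σ γ ξ K)
    (z t : EuclideanSpace ℝ (Fin d)) :
    charFun (multivariateGaussian 0 (sigmaMatrix F σ γ ξ z)) t
      = ((Real.exp (-limitVariance F (dualFeature F t) σ γ ξ z / 2) : ℝ) : ℂ) := by
  rw [charFun_multivariateGaussian (hM.posSemidef_sigmaMatrix z), hM.dotProduct_sigmaMatrix_mulVec]
  simp [neg_div]

/-- Near `z` the weights stay below `weight z + 1`, which gives an integrable majorant. -/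
lemma continuous_limitVariance (hM : IsNoisyDistanceModel P F Z E σ γ ξ K)
    {f : EuclideanSpace ℝ (Fin d) → ℝ} (hf : Measurable f) {A : ℝ} (hA : 0 ≤ A)
    (hfA : ∀ z, f z ^ 2 ≤ A * weight z) : Continuous (limitVariance F f σ γ ξ) := by
  have := hM.isProbabilityMeasure
  have hnb := noiseBound_nonneg σ γ ξ K
  rw [continuous_iff_continuousAt]
  intro z
  refine continuousAt_of_dominated (bound := fun w => A * noiseBound σ γ ξ K * (weight z + 1) *
    weight w ^ 6) (.of_forall fun x => ?_) ?_ (hM.integrable_weight_pow.const_mul _)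
    (.of_forall fun w => ?_)
  · exact ((hf.pow_const 2).mul
      (measurable_noiseVariance_norm (by fun_prop))).aestronglyMeasurable
  · have hc : Continuous (weight (d := d)) := by unfold weight; fun_prop
    filter_upwards [hc.continuousAt.eventually_lt_const (lt_add_one (weight z))] with x hx
    refine .of_forall fun w => ?_
    have hwx := (weight_pos x).le
    have hwz := (weight_pos z).le
    have hww := (weight_pos w).le
    have h6 : weight w ^ 2 ≤ weight w ^ 6 := pow_le_pow_right₀ (one_le_weight w) (by norm_num)
    rw [Real.norm_of_nonneg (mul_nonneg (sq_nonneg _) (hM.noiseVariance_nonneg _))]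
    calc f w ^ 2 * noiseVariance σ γ ξ ‖x - w‖
        ≤ (A * weight w) * (noiseBound σ γ ξ K * (weight x * weight w)) :=
          mul_le_mul (hfA w) (noiseVariance_le _ _ _ _ _ _) (hM.noiseVariance_nonneg _)
            (by positivity)
      _ = A * noiseBound σ γ ξ K * weight x * weight w ^ 2 := by ring
      _ ≤ _ := by gcongr
  · unfold noiseVariance
    fun_prop

/-- The Gaussian law depends weakly continuously on `z`, since its characteristic function does. By
the portmanteau theorem the mass of an open set is then lower semicontinuous, hence measurable, and
open sets form a generating π-system. -/
lemma measurable_gaussian_sigmaMatrix (hM : IsNoisyDistanceModel P F Z E σ γ ξ K) :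
    Measurable fun z => multivariateGaussian 0 (sigmaMatrix F σ γ ξ z) := by
  let ν : EuclideanSpace ℝ (Fin d) → ProbabilityMeasure (EuclideanSpace ℝ (Fin d)) :=
    fun z => ⟨multivariateGaussian 0 (sigmaMatrix F σ γ ξ z), inferInstance⟩
  have hcont : Continuous ν := by
    rw [continuous_iff_seqContinuous]
    intro x z hx
    refine ProbabilityMeasure.tendsto_of_tendsto_charFun fun t => ?_
    have hν : ∀ z, charFun (ν z : Measure (EuclideanSpace ℝ (Fin d))) t
        = ((Real.exp (-limitVariance F (dualFeature F t) σ γ ξ z / 2) : ℝ) : ℂ) :=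
      fun z => hM.charFun_gaussian_sigmaMatrix z t
    have hc : Continuous fun z =>
        ((Real.exp (-limitVariance F (dualFeature F t) σ γ ξ z / 2) : ℝ) : ℂ) :=
      Complex.continuous_ofReal.comp (Real.continuous_exp.comp ((hM.continuous_limitVariance
        (measurable_dualFeature F t) (dualFeatureBound_nonneg F t)
        (dualFeature_sq_le F t)).neg.div_const 2))
    simp only [Function.comp_apply, hν]
    exact (hc.tendsto z).comp hx
  refine Measurable.measure_of_isPiSystem_of_isProbabilityMeasure (BorelSpace.measurable_eq)
    isPiSystem_isOpen fun G hG => LowerSemicontinuous.measurable fun z => ?_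
  exact lowerSemicontinuousAt_iff_le_liminf.2
    (ProbabilityMeasure.le_liminf_measure_open_of_tendsto (hcont.tendsto z) hG)

end IsNoisyDistanceModel

/-- The Gaussian mixture with distribution function `mixtureCDF`. -/
noncomputable def gaussianMixture (F : Measure (EuclideanSpace ℝ (Fin d))) (σ γ ξ : ℝ) :
    Measure (EuclideanSpace ℝ (Fin d)) :=
  F.bind fun z => multivariateGaussian 0 (sigmaMatrix F σ γ ξ z)

lemma measurableSet_orthant (α : EuclideanSpace ℝ (Fin d)) :
    MeasurableSet {x : EuclideanSpace ℝ (Fin d) | ∀ k, x k ≤ α k} := by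
  simp only [Set.ofPred_forall]
  exact MeasurableSet.iInter fun k => measurableSet_le (by fun_prop) measurable_const

namespace IsNoisyDistanceModel

variable {P : Measure Ω} [IsProbabilityMeasure P]
  {F : Measure (EuclideanSpace ℝ (Fin d))}
  {Z : ℕ → Ω → EuclideanSpace ℝ (Fin d)} {E : (n : ℕ) → Ω → Matrix (Fin n) (Fin n) ℝ}
  {σ γ ξ K : ℝ}

lemma gaussianMixture_apply (hM : IsNoisyDistanceModel P F Z E σ γ ξ K)
    {s : Set (EuclideanSpace ℝ (Fin d))} (hs : MeasurableSet s) :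
    gaussianMixture F σ γ ξ s = ∫⁻ z, multivariateGaussian 0 (sigmaMatrix F σ γ ξ z) s ∂F :=
  Measure.bind_apply hs hM.measurable_gaussian_sigmaMatrix.aemeasurable

lemma isProbabilityMeasure_gaussianMixture (hM : IsNoisyDistanceModel P F Z E σ γ ξ K) :
    IsProbabilityMeasure (gaussianMixture F σ γ ξ) := by
  have := hM.isProbabilityMeasure
  exact ⟨by simp [hM.gaussianMixture_apply MeasurableSet.univ]⟩

lemma gaussianMixture_real_orthant (hM : IsNoisyDistanceModel P F Z E σ γ ξ K)
    (α : EuclideanSpace ℝ (Fin d)) :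
    (gaussianMixture F σ γ ξ).real {x | ∀ k, x k ≤ α k} = mixtureCDF F σ γ ξ α := by
  have hs := measurableSet_orthant α
  rw [measureReal_def, hM.gaussianMixture_apply hs, mixtureCDF]
  simp only [gaussianCDF, measureReal_def]
  rw [integral_toReal]
  · exact ((Measure.measurable_coe hs).comp hM.measurable_gaussian_sigmaMatrix).aemeasurable
  · exact .of_forall fun z => measure_lt_top _ _

lemma charFun_gaussianMixture (hM : IsNoisyDistanceModel P F Z E σ γ ξ K)
    (t : EuclideanSpace ℝ (Fin d)) :
    charFun (gaussianMixture F σ γ ξ) t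
      = ((∫ z, Real.exp (-limitVariance F (dualFeature F t) σ γ ξ z / 2) ∂F : ℝ) : ℂ) := by
  have := hM.isProbabilityMeasure
  have := hM.isProbabilityMeasure_gaussianMixture
  let κ : Kernel (EuclideanSpace ℝ (Fin d)) (EuclideanSpace ℝ (Fin d)) :=
    ⟨fun z => multivariateGaussian 0 (sigmaMatrix F σ γ ξ z), hM.measurable_gaussian_sigmaMatrix⟩
  have hκ : gaussianMixture F σ γ ξ = (κ ∘ₖ Kernel.const Unit F) () :=
    Measure.comp_eq_comp_const_apply (κ := κ) (μ := F)
  have hint : Integrable (fun x : EuclideanSpace ℝ (Fin d) =>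
      Complex.exp (inner ℝ x t * Complex.I)) (gaussianMixture F σ γ ξ) := by
    refine Integrable.of_bound (Measurable.aestronglyMeasurable (by fun_prop)) 1
      (.of_forall fun x => (Complex.norm_exp_ofReal_mul_I _).le)
  rw [charFun_apply, hκ, Kernel.integral_comp (hκ ▸ hint), ← integral_complex_ofReal,
    Kernel.const_apply]
  refine integral_congr_ae (.of_forall fun z => ?_)
  exact (charFun_apply t).symm.trans (hM.charFun_gaussian_sigmaMatrix z t)

lemma frontier_orthant_subset (α : EuclideanSpace ℝ (Fin d)) :
    frontier {x : EuclideanSpace ℝ (Fin d) | ∀ k, x k ≤ α k}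
      ⊆ {x | ∀ k, x k ≤ α k} \ {x | ∀ k, x k < α k} := by
  have hc : IsClosed {x : EuclideanSpace ℝ (Fin d) | ∀ k, x k ≤ α k} := by
    simp only [Set.ofPred_forall]
    exact isClosed_iInter fun k => isClosed_le (by fun_prop) continuous_const
  have ho : IsOpen {x : EuclideanSpace ℝ (Fin d) | ∀ k, x k < α k} := by
    simp only [Set.ofPred_forall]
    exact isOpen_iInter_of_finite fun k => isOpen_lt (by fun_prop) continuous_const
  rw [hc.frontier_eq]
  exact Set.sdiff_subset_sdiff_right (interior_maximal (fun x hx k => (hx k).le) ho)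

/-- The boundary of the orthant lies between the orthants with corners `α - δ (1, …, 1)` and `α`, so
its mass is at most an increment of the distribution function, which vanishes as `δ` decreases to
`0`. -/
lemma gaussianMixture_frontier_of_continuousAt (hM : IsNoisyDistanceModel P F Z E σ γ ξ K)
    {α : EuclideanSpace ℝ (Fin d)} (hα : ContinuousAt (mixtureCDF F σ γ ξ) α) :
    gaussianMixture F σ γ ξ (frontier {x | ∀ k, x k ≤ α k}) = 0 := by
  have := hM.isProbabilityMeasure_gaussianMixture
  set ν := gaussianMixture F σ γ ξ with hν
  have hle : ∀ δ : ℝ, 0 < δ → ν.real (frontier {x | ∀ k, x k ≤ α k})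
      ≤ mixtureCDF F σ γ ξ α - mixtureCDF F σ γ ξ (α - δ • WithLp.toLp 2 fun _ => (1 : ℝ)) := by
    intro δ hδ
    set β := α - δ • WithLp.toLp 2 fun _ : Fin d => (1 : ℝ) with hβ
    have hβk : ∀ k, β k = α k - δ := fun k => by simp [hβ]
    have hsub : {x : EuclideanSpace ℝ (Fin d) | ∀ k, x k ≤ β k} ⊆ {x | ∀ k, x k ≤ α k} := by
      intro x hx k
      have := hx k
      rw [hβk] at this
      linarith
    rw [← hM.gaussianMixture_real_orthant, ← hM.gaussianMixture_real_orthant,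
      ← measureReal_sdiff hsub (measurableSet_orthant β)]
    refine measureReal_mono ((frontier_orthant_subset α).trans ?_)
    refine Set.sdiff_subset_sdiff_right fun x hx k => ?_
    have := hx k
    rw [hβk] at this
    linarith
  have hlim : Tendsto (fun δ : ℝ => mixtureCDF F σ γ ξ α -
      mixtureCDF F σ γ ξ (α - δ • WithLp.toLp 2 fun _ => (1 : ℝ))) (𝓝[>] 0) (𝓝 0) := by
    have h1 : Tendsto (fun δ : ℝ => α - δ • WithLp.toLp 2 fun _ : Fin d => (1 : ℝ)) (𝓝[>] 0)
        (𝓝 α) := by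
      have : Continuous fun δ : ℝ => α - δ • WithLp.toLp 2 fun _ : Fin d => (1 : ℝ) := by fun_prop
      have h := this.tendsto 0
      rw [zero_smul, sub_zero] at h
      exact h.mono_left nhdsWithin_le_nhds
    have := (hα.tendsto.comp h1).const_sub (mixtureCDF F σ γ ξ α)
    rwa [sub_self] at this
  have h0 : ν.real (frontier {x | ∀ k, x k ≤ α k}) ≤ 0 :=
    ge_of_tendsto hlim (eventually_nhdsWithin_of_forall fun δ hδ => hle δ hδ)
  exact (measureReal_eq_zero_iff).1 (le_antisymm h0 measureReal_nonneg)

/-- The boundary lies in finitely many coordinate hyperplanes. Almost every component of the mixture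
has positive definite covariance, so its coordinates are nondegenerate Gaussians without atoms. -/
lemma gaussianMixture_frontier_of_nonsingular (hM : IsNoisyDistanceModel P F Z E σ γ ξ K)
    (α : EuclideanSpace ℝ (Fin d)) (h : ∀ᵐ z ∂F, (sigmaMatrix F σ γ ξ z).det ≠ 0) :
    gaussianMixture F σ γ ξ (frontier {x | ∀ k, x k ≤ α k}) = 0 := by
  have hsub : frontier {x : EuclideanSpace ℝ (Fin d) | ∀ k, x k ≤ α k}
      ⊆ ⋃ k, {x | x k = α k} := by
    intro x hx
    obtain ⟨h1, h2⟩ := frontier_orthant_subset α hx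
    simp only [Set.mem_ofPred_eq, not_forall, not_lt] at h2
    obtain ⟨k, hk⟩ := h2
    exact Set.mem_iUnion.2 ⟨k, le_antisymm (h1 k) hk⟩
  refine measure_mono_null hsub (measure_iUnion_null fun k => ?_)
  have hmk : MeasurableSet {x : EuclideanSpace ℝ (Fin d) | x k = α k} :=
    measurableSet_eq_fun (by fun_prop) measurable_const
  have hmz : Measurable fun z => multivariateGaussian 0 (sigmaMatrix F σ γ ξ z)
      {x : EuclideanSpace ℝ (Fin d) | x k = α k} :=
    (Measure.measurable_coe hmk).comp hM.measurable_gaussian_sigmaMatrix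
  rw [hM.gaussianMixture_apply hmk, lintegral_eq_zero_iff hmz]
  filter_upwards [h] with z hz
  have hps := hM.posSemidef_sigmaMatrix z
  have hpd := hps.posDef_iff_det_ne_zero.2 hz
  have hmp := measurePreserving_eval_multivariateGaussian (μ := 0) hps (i := k)
  have hv : (sigmaMatrix F σ γ ξ z k k).toNNReal ≠ 0 := by
    simpa using hpd.diag_pos
  have := nullSingletonClass_gaussianReal (μ := (0 : EuclideanSpace ℝ (Fin d)) k) hv
  have h3 := hmp.measure_preimage (s := {α k}) (measurableSet_singleton _).nullMeasurableSet
  rw [measure_singleton] at h3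
  exact h3

end IsNoisyDistanceModel

end Mixture

/-! ### Measurable choice of the alignment. -/

section Selection

open Matrix
open scoped Matrix.Norms.Frobenius

/-- A measurable near-optimal choice of the orthogonal factor. -/
lemma exists_measurable_orthogonal {Ω : Type*} [MeasurableSpace Ω] {d : ℕ}
    {Q : Ω → Matrix (Fin d) (Fin d) ℝ} (hQ : ∀ i j, Measurable fun ω => Q ω i j) {δ : ℝ}
    (hδ : 0 < δ) :
    ∃ W : Ω → Matrix (Fin d) (Fin d) ℝ, (∀ ω, W ω ∈ orthogonalGroup (Fin d) ℝ) ∧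
      (∀ i j, Measurable fun ω => W ω i j) ∧
      ∀ ω, ‖Q ω * W ω - 1‖ ≤ ‖(Q ω)ᵀ * Q ω - 1‖ + δ := by
  classical
  haveI : ProperSpace (Matrix (Fin d) (Fin d) ℝ) := FiniteDimensional.proper ℝ _
  haveI : SecondCountableTopology (Matrix (Fin d) (Fin d) ℝ) := secondCountable_of_proper
  let O : Set (Matrix (Fin d) (Fin d) ℝ) := {W | W ∈ orthogonalGroup (Fin d) ℝ}
  haveI : Nonempty O := ⟨⟨1, (orthogonalGroup (Fin d) ℝ).one_mem⟩⟩
  let D : ℕ → O := TopologicalSpace.denseSeq O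
  have hD : DenseRange D := TopologicalSpace.denseRange_denseSeq O
  have hex : ∀ ω, ∃ k, ‖Q ω * (D k).1 - 1‖ < ‖(Q ω)ᵀ * Q ω - 1‖ + δ := by
    intro ω
    -- Half of the slack pays for a nearly optimal orthogonal matrix and half for replacing it by a
    -- member of a countable dense set. The first admissible index is then measurable, being defined
    -- by countably many measurable conditions.
    obtain ⟨W, hW, hlt⟩ := exists_orthogonal_norm_mul_sub_one_lt (Q ω) (half_pos hδ)
    obtain ⟨k, hk⟩ := hD.exists_dist_lt (⟨W, hW⟩ : O) (ε := δ / 2 / (‖Q ω‖ + 1)) (by positivity)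
    refine ⟨k, ?_⟩
    rw [Subtype.dist_eq, dist_eq_norm, norm_sub_rev, lt_div_iff₀ (by positivity)] at hk
    have e : Q ω * (D k).1 - 1 = (Q ω * W - 1) + Q ω * ((D k).1 - W) := by
      rw [Matrix.mul_sub]; abel
    have h1 : ‖Q ω * ((D k).1 - W)‖ ≤ ‖Q ω‖ * ‖(D k).1 - W‖ :=
      frobenius_norm_mul_le_of_le le_rfl le_rfl
    have h2 := norm_nonneg ((D k).1 - W)
    have h3 := norm_add_le (Q ω * W - 1) (Q ω * ((D k).1 - W))
    rw [e]
    have h4 : ‖(D k).1 - W‖ * (‖Q ω‖ + 1) < δ / 2 := hk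
    linarith
  have hmeas : ∀ k, MeasurableSet {ω | ‖Q ω * (D k).1 - 1‖ < ‖(Q ω)ᵀ * Q ω - 1‖ + δ} := by
    intro k
    have h1 : Measurable fun ω => ‖Q ω * (D k).1 - 1‖ :=
      measurable_frobenius_norm fun i j => (measurable_matrix_mul_apply hQ
        (B := fun _ => (D k).1) (fun _ _ => measurable_const) i j).sub measurable_const
    have h2 : Measurable fun ω => ‖(Q ω)ᵀ * Q ω - 1‖ :=
      measurable_frobenius_norm fun i j => (measurable_matrix_mul_apply
        (A := fun ω => (Q ω)ᵀ) (fun i j => hQ j i) hQ i j).sub measurable_const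
    exact measurableSet_lt h1 (h2.add_const δ)
  have hfind := measurable_find hex hmeas
  refine ⟨fun ω => (D (Nat.find (hex ω))).1, fun ω => (D _).2, fun i j => ?_, fun ω =>
    (Nat.find_spec (hex ω)).le⟩
  exact (measurable_from_nat (f := fun k => (D k).1 i j)).comp hfind

end Selection

/-! ### Weak convergence of the scaled row error. -/

section Limit

open Matrix
open scoped Matrix.Norms.Frobenius

variable {Ω : Type*} [MeasurableSpace Ω] {d : ℕ}

/-- The row vector `A` as a point of Euclidean space. -/
noncomputable def rowVector (A : Matrix (Fin 1) (Fin d) ℝ) : EuclideanSpace ℝ (Fin d) :=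
  WithLp.toLp 2 fun k => A 0 k

lemma norm_rowVector (A : Matrix (Fin 1) (Fin d) ℝ) : ‖rowVector A‖ = ‖A‖ := by
  rw [EuclideanSpace.norm_eq, ← Real.sqrt_sq (norm_nonneg A), frobenius_norm_sq]
  simp [rowVector]

lemma inner_rowVector (A : Matrix (Fin 1) (Fin d) ℝ) (t : EuclideanSpace ℝ (Fin d)) :
    inner ℝ (rowVector A) t = (A *ᵥ t) 0 := by
  simp [rowVector, PiLp.inner_apply, mulVec, dotProduct, mul_comm]

lemma measurable_rowVector {A : Ω → Matrix (Fin 1) (Fin d) ℝ}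
    (hA : ∀ i j, Measurable fun ω => A ω i j) : Measurable fun ω => rowVector (A ω) := by
  have h : Measurable fun ω k => A ω 0 k := measurable_pi_lambda _ fun k => hA 0 k
  exact (PiLp.continuous_toLp 2 _).measurable.comp h

namespace IsNoisyDistanceModel

variable {P : Measure Ω} [IsProbabilityMeasure P]
  {F : Measure (EuclideanSpace ℝ (Fin d))}
  {Z : ℕ → Ω → EuclideanSpace ℝ (Fin d)} {E : (n : ℕ) → Ω → Matrix (Fin n) (Fin n) ℝ}
  {σ γ ξ K : ℝ}

/-- The leading term of the row error converges to the Gaussian mixture. -/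
lemma tendsto_charFun_leading (hM : IsNoisyDistanceModel P F Z E σ γ ξ K) (i : ℕ)
    (t : EuclideanSpace ℝ (Fin d)) :
    Tendsto (fun n : ℕ => ∫ ω, Complex.exp ((inner ℝ (rowVector (-(√(n : ℝ))⁻¹ •
      (rowSelector n i * modelNoise Z E σ n ω * featureMatrix Z (centeredCoord F) n ω
        * (covMatrix F)⁻¹))) t : ℝ) * Complex.I) ∂P) atTop
      (𝓝 (charFun (gaussianMixture F σ γ ξ) t)) := by
  rw [hM.charFun_gaussianMixture t]
  refine (hM.tendsto_integral_exp_row (measurable_dualFeature F t) (dualFeatureBound_nonneg F t)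
    (dualFeature_sq_le F t) i).congr fun n => ?_
  refine integral_congr_ae (.of_forall fun ω => ?_)
  have h : ∑ j : Fin n, (rowSelector n i * modelNoise Z E σ n ω) 0 j * dualFeature F t (Z j ω)
      = ((rowSelector n i * modelNoise Z E σ n ω * featureMatrix Z (centeredCoord F) n ω
        * (covMatrix F)⁻¹) *ᵥ t) 0 := by
    rw [← Matrix.mulVec_mulVec, ← Matrix.mulVec_mulVec]
    rfl
  simp only [inner_rowVector, Matrix.smul_mulVec, Pi.smul_apply, smul_eq_mul]
  rw [h]

/-- The scaled error of a row of the aligned embedding converges weakly to the mixture. -/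
theorem tendsto_measure_row_error (hM : IsNoisyDistanceModel P F Z E σ γ ξ K)
    (hΞ : (covMatrix F).det ≠ 0)
    {Xhat : (n : ℕ) → Ω → Matrix (Fin n) (Fin d) ℝ}
    (hXm : ∀ n i k, Measurable fun ω => Xhat n ω i k)
    (hX : ∀ n ω, IsCMDSEmbedding (distMatrix (fun k : Fin n => Z k ω) + E n ω) (Xhat n ω))
    {W : (n : ℕ) → Ω → Matrix (Fin d) (Fin d) ℝ}
    (hWo : ∀ n ω, W n ω ∈ orthogonalGroup (Fin d) ℝ)
    (hWm : ∀ n k l, Measurable fun ω => W n ω k l)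
    {Q : (n : ℕ) → Ω → Matrix (Fin d) (Fin d) ℝ}
    (hQ : ∀ n ω, Q n ω = (centeringMatrix n * featureMatrix Z (centeredCoord F) n ω)ᵀ * Xhat n ω
      * ((Xhat n ω)ᵀ * Xhat n ω)⁻¹)
    (hW : ∀ n ω, 0 < n → ‖Q n ω * W n ω - 1‖ ≤ ‖(Q n ω)ᵀ * Q n ω - 1‖ + (n : ℝ)⁻¹) (i : ℕ)
    {s : Set (EuclideanSpace ℝ (Fin d))} (hs : MeasurableSet s)
    (hfr : gaussianMixture F σ γ ξ (frontier s) = 0) :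
    Tendsto (fun n : ℕ => P.real {ω | rowVector (√(n : ℝ) • (rowSelector n i *
        (Xhat n ω * W n ω - centeringMatrix n * featureMatrix Z (centeredCoord F) n ω))) ∈ s})
      atTop (𝓝 ((gaussianMixture F σ γ ξ).real s)) := by
  have hpm := hM.isProbabilityMeasure_gaussianMixture
  set V : ℕ → Ω → EuclideanSpace ℝ (Fin d) := fun n ω => rowVector (√(n : ℝ) • (rowSelector n i *
        (Xhat n ω * W n ω - centeringMatrix n * featureMatrix Z (centeredCoord F) n ω))) with hV
  set L : ℕ → Ω → EuclideanSpace ℝ (Fin d) := fun n ω => rowVector (-(√(n : ℝ))⁻¹ •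
      (rowSelector n i * modelNoise Z E σ n ω * featureMatrix Z (centeredCoord F) n ω
        * (covMatrix F)⁻¹)) with hL
  have hYm : ∀ n k l, Measurable fun ω => featureMatrix Z (centeredCoord F) n ω k l :=
    fun n k l => (measurable_centeredCoord F l).comp (hM.Z_meas k)
  have hLm : ∀ n, Measurable (L n) := fun n => measurable_rowVector fun a k =>
    (measurable_matrix_mul_apply (B := fun _ => (covMatrix F)⁻¹)
      (measurable_matrix_mul_apply (measurable_matrix_mul_apply (A := fun _ => rowSelector n i)
        (fun _ _ => measurable_const) (hM.measurable_modelNoise n)) (hYm n))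
        (fun _ _ => measurable_const) a k).const_mul _
  have hVm : ∀ n, Measurable (V n) := fun n => measurable_rowVector fun a k =>
    (measurable_matrix_mul_apply (A := fun _ => rowSelector n i)
        (B := fun ω => Xhat n ω * W n ω - centeringMatrix n *
          featureMatrix Z (centeredCoord F) n ω) (fun _ _ => measurable_const)
        (fun j l => (measurable_matrix_mul_apply (hXm n) (hWm n) j l).sub
          (measurable_matrix_mul_apply (A := fun _ => centeringMatrix n)
            (fun _ _ => measurable_const) (hYm n) j l)) a k).const_mul _
  -- Lévy's continuity theorem for the leading term; Slutsky's lemma then transfers the limit to the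
  -- full error, which differs by a quantity tending to zero in probability.
  have hLd : TendstoInDistribution L atTop id (fun _ => P) (gaussianMixture F σ γ ξ) := by
    refine ⟨fun n => (hLm n).aemeasurable, aemeasurable_id, ?_⟩
    refine ProbabilityMeasure.tendsto_of_tendsto_charFun fun t => ?_
    simp only [ProbabilityMeasure.coe_mk, Measure.map_id]
    refine (hM.tendsto_charFun_leading i t).congr fun n => ?_
    rw [charFun_apply, integral_map (hLm n).aemeasurable
      (Measurable.aestronglyMeasurable (by fun_prop))]
  have hsub : ∀ n ω, 0 < n → ‖V n ω - L n ω‖ = √(n : ℝ) * ‖rowSelector n i *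
        (Xhat n ω * W n ω - centeringMatrix n * featureMatrix Z (centeredCoord F) n ω)
      + (n : ℝ)⁻¹ • (rowSelector n i * modelNoise Z E σ n ω
        * featureMatrix Z (centeredCoord F) n ω * (covMatrix F)⁻¹)‖ := by
    intro n ω hn
    have hn0 : (0 : ℝ) < n := by exact_mod_cast hn
    have hr0 : √(n : ℝ) ≠ 0 := (Real.sqrt_pos.2 hn0).ne'
    have hrn : √(n : ℝ) * (n : ℝ)⁻¹ = (√(n : ℝ))⁻¹ := by
      nth_rw 2 [← Real.mul_self_sqrt hn0.le]
      rw [mul_inv, ← mul_assoc, mul_inv_cancel₀ hr0, one_mul]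
    rw [← Real.norm_of_nonneg (Real.sqrt_nonneg (n : ℝ)), ← norm_smul, smul_add, smul_smul, hrn, ← norm_rowVector]
    congr 1
    ext k
    simp [hV, hL, rowVector]
  have hdiff : TendstoInMeasure P (V - L) atTop 0 := by
    rw [tendstoInMeasure_iff_measureReal_norm]
    intro ε hε
    -- The threshold `ε / 2` turns the weak inequality of convergence in measure into the strict one
    -- of `NullInProb`.
    refine tendsto_measureReal_zero_of_le
      (hM.nullInProb_remainder hΞ hX hWo hQ hW i (ε / 2) (half_pos hε)) ?_
    filter_upwards [eventually_gt_atTop 0] with n hn ω hω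
    have hω' : ε ≤ ‖V n ω - L n ω‖ := by simpa using hω
    rw [hsub n ω hn] at hω'
    show ε / 2 < |_|
    exact ((half_lt_self hε).trans_le hω').trans_le (le_abs_self _)
  have hVd := tendstoInDistribution_of_tendstoInMeasure_sub V id hLd hdiff
    fun n => (hVm n).aemeasurable
  have h := ProbabilityMeasure.tendsto_measure_of_null_frontier_of_tendsto' hVd.tendsto (E := s)
    (by simpa using hfr)
  have h2 := (ENNReal.tendsto_toReal
    (by simpa using measure_ne_top (gaussianMixture F σ γ ξ) s)).comp h
  simp only [ProbabilityMeasure.coe_mk, Measure.map_id] at h2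
  refine h2.congr fun n => ?_
  rw [Function.comp_apply, Measure.map_apply (hVm n) hs]
  rfl

end IsNoisyDistanceModel

end Limit

/-! ### Assembly. -/

section Main

open Matrix

/-- The unknown mean `μ` cancels under centering, so subtracting it first for the estimates does not
change the configuration. -/
lemma centeringMatrix_mul_centeredCoord_apply {Ω : Type*} {d n : ℕ}
    (F : Measure (EuclideanSpace ℝ (Fin d))) (Z : ℕ → Ω → EuclideanSpace ℝ (Fin d)) (ω : Ω)
    (i : Fin n) (k : Fin d) :
    (centeringMatrix n * featureMatrix Z (centeredCoord F) n ω) i k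
      = Z i ω k - (n : ℝ)⁻¹ * ∑ j : Fin n, Z j ω k := by
  have hn : (n : ℝ) ≠ 0 := by
    have := i.pos
    positivity
  have e : ((onesRow n)ᵀ * (onesRow n * featureMatrix Z (centeredCoord F) n ω)) i k
      = ∑ j : Fin n, centeredCoord F k (Z j ω) := by
    simp [Matrix.mul_apply, onesRow, featureMatrix]
  rw [centeringMatrix_eq, Matrix.sub_mul, Matrix.one_mul, Matrix.smul_mul, Matrix.mul_assoc,
    Matrix.sub_apply, Matrix.smul_apply, e]
  simp only [featureMatrix, Matrix.of_apply, centeredCoord, Finset.sum_sub_distrib,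
    Finset.sum_const, Finset.card_univ, Fintype.card_fin, nsmul_eq_mul, smul_eq_mul]
  field_simp
  ring

end Main

theorem theorem2 {Ω : Type*} [MeasurableSpace Ω] (P : Measure Ω) [IsProbabilityMeasure P]
    (d : ℕ) (F : Measure (EuclideanSpace ℝ (Fin d))) [IsProbabilityMeasure F]
    (hF : IsSubGaussianLaw F) (hΞ : (covMatrix F).det ≠ 0)
    -- the points: i.i.d. with distribution `F`
    (Z : ℕ → Ω → EuclideanSpace ℝ (Fin d))
    (hZ_meas : ∀ k, Measurable (Z k)) (hZ_law : ∀ k, P.map (Z k) = F) (hZ_indep : iIndepFun Z P)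
    -- the noise matrices
    (σ γ ξ K : ℝ)
    (E : (n : ℕ) → Ω → Matrix (Fin n) (Fin n) ℝ)
    (hE_meas : ∀ n i j, Measurable fun ω => E n ω i j)
    (hE_symm : ∀ n ω i j, E n ω i j = E n ω j i)
    (hE_hollow : ∀ n ω i, E n ω i i = 0)
    (hE_indep : ∀ n, iIndepFun
      (fun (p : {p : Fin n × Fin n // p.1 < p.2}) ω => E n ω p.1.1 p.1.2) P)
    (hE_indep_Z : ∀ n, IndepFun (fun ω (p : Fin n × Fin n) => E n ω p.1 p.2)
      (fun ω (k : Fin n) => Z k ω) P)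
    (hE_subG : ∀ n i j, HasSubGaussianTail P (fun ω => E n ω i j) K)
    (hE_mean : ∀ n i j, ∫ ω, E n ω i j ∂P = 0)
    (hE_var : ∀ n i j, i ≠ j → variance (fun ω => E n ω i j) P = σ ^ 2)
    (hE_third : ∀ n i j, i ≠ j → ∫ ω, E n ω i j ^ 3 ∂P = γ)
    (hE_fourth : ∀ n i j, i ≠ j → ∫ ω, E n ω i j ^ 4 ∂P = ξ)
    -- the embeddings of `Δ = D + E`
    (Xhat : (n : ℕ) → Ω → Matrix (Fin n) (Fin d) ℝ)
    (hX_meas : ∀ n i k, Measurable fun ω => Xhat n ω i k)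
    (hX : ∀ n ω, IsCMDSEmbedding (distMatrix (fun k : Fin n => Z k ω) + E n ω) (Xhat n ω)) :
    ∃ W : (n : ℕ) → Ω → Matrix (Fin d) (Fin d) ℝ,
      (∀ n ω, W n ω ∈ Matrix.orthogonalGroup (Fin d) ℝ) ∧
      (∀ n k l, Measurable fun ω => W n ω k l) ∧
      ∀ (i : ℕ) (α : EuclideanSpace ℝ (Fin d)),
        (ContinuousAt (mixtureCDF F σ γ ξ) α ∨ ∀ᵐ z ∂F, (sigmaMatrix F σ γ ξ z).det ≠ 0) →
        Tendsto
          (fun n : ℕ => P.real {ω | ∃ h : i < n, ∀ k : Fin d,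
            √(n : ℝ) * ((Xhat n ω * W n ω) ⟨i, h⟩ k
              - (Z i ω k - (n : ℝ)⁻¹ * ∑ j : Fin n, Z j ω k)) ≤ α k})
          atTop (𝓝 (mixtureCDF F σ γ ξ α)) := by
  have hM : IsNoisyDistanceModel P F Z E σ γ ξ K := ⟨hF, hZ_meas, hZ_law, hZ_indep, hE_meas,
    hE_symm, hE_hollow, hE_indep, hE_indep_Z, hE_subG, hE_mean, hE_var, hE_third, hE_fourth⟩
  -- The overlap matrix of the expansion, as a measurable function of sample and embedding. Where
  -- `Xhatᵀ Xhat` is singular the inverse takes its default value `0`; the selection of `W` allows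
  -- every `Q`.
  set Q : (n : ℕ) → Ω → Matrix (Fin d) (Fin d) ℝ := fun n ω =>
    (centeringMatrix n * featureMatrix Z (centeredCoord F) n ω).transpose * Xhat n ω
      * ((Xhat n ω).transpose * Xhat n ω)⁻¹ with hQ
  have hYm : ∀ n k l, Measurable fun ω => featureMatrix Z (centeredCoord F) n ω k l :=
    fun n k l => (measurable_centeredCoord F l).comp (hZ_meas k)
  have hQm : ∀ n k l, Measurable fun ω => Q n ω k l := by
    intro n
    have h1 := measurable_matrix_mul_apply (A := fun _ : Ω => centeringMatrix n)
      (fun _ _ => measurable_const) (hYm n)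
    have h2 := measurable_matrix_mul_apply (A := fun ω =>
      (centeringMatrix n * featureMatrix Z (centeredCoord F) n ω).transpose)
      (fun k l => h1 l k) (hX_meas n)
    have h3 := measurable_matrix_mul_apply (A := fun ω => (Xhat n ω).transpose)
      (fun k l => hX_meas n l k) (hX_meas n)
    exact measurable_matrix_mul_apply h2 (measurable_matrix_inv_apply h3)
  -- The slack `1 / n` is of the order tolerated by the expansion; the value `1` only keeps it
  -- positive at `n = 0`.
  choose W hWo hWm hW using fun n : ℕ => exists_measurable_orthogonal (hQm n)
    (δ := if 0 < n then (n : ℝ)⁻¹ else 1) (by split_ifs <;> positivity)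
  refine ⟨W, hWo, hWm, fun i α hα => ?_⟩
  have hfr : gaussianMixture F σ γ ξ (frontier {x | ∀ k, x k ≤ α k}) = 0 :=
    hα.elim hM.gaussianMixture_frontier_of_continuousAt
      (hM.gaussianMixture_frontier_of_nonsingular α)
  have key := hM.tendsto_measure_row_error hΞ hX_meas hX hWo hWm (Q := Q) (fun _ _ => rfl)
    (fun n ω hn => by simpa only [if_pos hn] using hW n ω) i (measurableSet_orthant α) hfr
  rw [hM.gaussianMixture_real_orthant] at key
  refine key.congr' ?_
  -- Once `n > i` the row exists and the existential in the event is vacuous.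
  filter_upwards [eventually_gt_atTop i] with n hn
  congr 1
  ext ω
  have h : ∀ k, rowVector (√(n : ℝ) • (rowSelector n i * (Xhat n ω * W n ω
        - centeringMatrix n * featureMatrix Z (centeredCoord F) n ω))) k
      = √(n : ℝ) * ((Xhat n ω * W n ω) ⟨i, hn⟩ k
          - (Z i ω k - (n : ℝ)⁻¹ * ∑ j : Fin n, Z j ω k)) := by
    intro k
    have h0 := rowSelector_mul_apply hn (Xhat n ω * W n ω
      - centeringMatrix n * featureMatrix Z (centeredCoord F) n ω) 0 k
    rw [Matrix.sub_apply, centeringMatrix_mul_centeredCoord_apply] at h0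
    rw [← h0]
    rfl
  simp only [Set.mem_ofPred_eq, h]
  exact ⟨fun hx => ⟨hn, hx⟩, fun ⟨_, hx⟩ => hx⟩
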